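/- **Theorem 2.7.** There is an absolute constant $C>0$ such that the following holds. Let $\mathcal G=(\mathcal V,\mathcal E)$ be a finite simple graph with at least one edge, let $D\ge 1$ be its maximal degree, and let $\{X_i,\ i\in\mathcal V\}$ be real random variables on a common probability space for which $\mathcal G$ is a dependency graph: for any disjoint $\Gamma_1,\Gamma_2\subset\mathcal V$ such that no edge of $\mathcal G$ has one endpoint in $\Gamma_1$ and the other in $\Gamma_2$, the families $\{X_i, i\in\Gamma_1\}$ and $\{X_i, i\in\Gamma_2\}$ are independent. Put $W=\sum_{i\in\mathcal V}X_i$. Let $2<p\le 3$ and $\theta>0$, and assume that $EW^2=1$, and that $EX_i=0$ and $E|X_i|^p\le\theta^p$ for every $i\in\mathcal V$. Then, $\Phi$ being the standard normal distribution function, $$\sup_{z\in\mathbb R}|P(W\le z)-\Phi(z)|\le 75\,D^{5(p-1)}\,|\mathcal V|\,\theta^p,$$ and, for every $z\in\mathbb R$, $$|P(W\le z)-\Phi(z)|\le C(1+|z|)^{-p}D^{5p}\,|\mathcal V|\,\theta^p .$$ -/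

import Mathlib

open MeasureTheory ProbabilityTheory

/-- `G` is a dependency graph for the random variables `X i`, `i : V`, under the measure `P`:
for any two disjoint sets of vertices with no edge of `G` running from one to the other, the
corresponding two families of random variables are independent. -/
def IsDependencyGraph {V Ω : Type*} [MeasurableSpace Ω] (G : SimpleGraph V)
    (X : V → Ω → ℝ) (P : Measure Ω) : Prop :=
  ∀ Γ₁ Γ₂ : Set V, Disjoint Γ₁ Γ₂ → (∀ i ∈ Γ₁, ∀ j ∈ Γ₂, ¬ G.Adj i j) →
    IndepFun (fun (ω : Ω) (i : Γ₁) => X i ω) (fun (ω : Ω) (j : Γ₂) => X j ω) P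

/-- The standard normal distribution function. -/
noncomputable def stdNormalCDF (z : ℝ) : ℝ := cdf (gaussianReal 0 1) z

/-!
The proof is Stein's method under local dependence, with a concentration inequality in place of
smoothness of the test function. Write `Y i` for the sum of the `X j` over the closed neighbourhood
of `i`. Since `X i` is independent of `W - Y i`, a centred sum satisfies
`E W F(W) = ∑ i, E X i (F(W) - F(W - Y i))`, and up to an error of third order this equals
`(∑ i, E X i Y i) E F'(W)`, which is `E F'(W)` when `E W ^ 2 = 1` (`LocalLaw.stein_identity`). The
error is estimated by decoupling: `W` is replaced by its part off the ball of radius two about `i`,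
and all that is needed of `F'` is a bound, under weights depending on that ball, for its change when
a combination of the coordinates in the ball is added to the argument (`LocalLaw.SmoothAt`).

For `F` the solution of Stein's equation for a half-line, averaged over thresholds in `[z, z + α]`,
the change of `F'` consists of a Lipschitz part and of the change of a ramp of width `α`, hence of
the probability that `W` falls into a window of width `α` whose position depends on the ball. Such
probabilities are bounded by a multiple of `α` under every change of measure that depends on the
ball only (`LocalLaw.concentration_localTilt`): apply the local Stein identity to the primitive of a
trapezoid over the window, bound the left side by the size of that primitive, and bound the right
side from below by the local variance times the window probability. The fluctuations of the random
kernel `∑ j, X j (1_{-Y j < t ≤ 0} - 1_{0 < t ≤ -Y j})` are small in variance because distant terms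
are uncorrelated. With `α` a constant multiple of `D ^ 5 |V| θ ^ p` this gives the uniform bound
(`LocalLaw.uniform_bound_of_small`).

For the nonuniform bound the summands are truncated at `1 / (2 D ^ 5)`, which makes the local sums
bounded. The local Stein identity for exponentials bounds `E exp W`
(`BoundedLaw.integral_exp_le`), and the previous argument with the weight `exp (W / 2)` yields an
error of order `exp (-z / 4) D ^ (5 p) |V| θ ^ p` for the truncated sum (`BoundedLaw.tail_bound`).
The truncation costs at most the probability that some summand exceeds the level while `W` or the
truncated sum exceeds `z`. Local independence, a Rosenthal inequality for `E |W| ^ p`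
(`LocalLaw.moment_coordSum_le`, again from the local Stein identity, now with `w |w| ^ (p - 2)`) and
Markov's inequality bound it by a multiple of `z ^ (-p) D ^ (5 p) |V| θ ^ p`. Thresholds far to the
left are treated by reflection, and small thresholds by the uniform bound.

Throughout, the random variables are replaced by the coordinates under their joint law on `V → ℝ`,
and `p = 2 + q`.
-/

open Set Filter Topology

set_option linter.unusedSectionVars false

/-! ### The normal distribution function and Mills' ratio -/

/-- The standard normal density. -/
noncomputable def normalDensity (x : ℝ) : ℝ := gaussianPDFReal 0 1 x

lemma normalDensity_eq (x : ℝ) :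
    normalDensity x = (√(2 * Real.pi))⁻¹ * Real.exp (-x ^ 2 / 2) := by
  simp [normalDensity, gaussianPDFReal]

lemma normalDensity_pos (x : ℝ) : 0 < normalDensity x :=
  gaussianPDFReal_pos 0 1 x one_ne_zero

lemma normalDensity_neg (x : ℝ) : normalDensity (-x) = normalDensity x := by
  simp [normalDensity_eq]

lemma inv_sqrt_two_pi_le : (√(2 * Real.pi))⁻¹ ≤ 2 / 5 := by
  have h : (5 / 2 : ℝ) ≤ √(2 * Real.pi) := by
    apply Real.le_sqrt_of_sq_le
    nlinarith [Real.pi_gt_d2]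
  calc (√(2 * Real.pi))⁻¹ ≤ (5 / 2 : ℝ)⁻¹ := inv_anti₀ (by norm_num) h
    _ = 2 / 5 := by norm_num

lemma normalDensity_le_exp (x : ℝ) : normalDensity x ≤ 2 / 5 * Real.exp (-x ^ 2 / 2) := by
  rw [normalDensity_eq]
  exact mul_le_mul_of_nonneg_right inv_sqrt_two_pi_le (Real.exp_pos _).le

lemma normalDensity_le (x : ℝ) : normalDensity x ≤ 2 / 5 := by
  refine (normalDensity_le_exp x).trans ?_
  have : Real.exp (-x ^ 2 / 2) ≤ 1 := Real.exp_le_one_iff.2 (by nlinarith [sq_nonneg x])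
  linarith

lemma hasDerivAt_normalDensity (x : ℝ) :
    HasDerivAt normalDensity (-x * normalDensity x) x := by
  have h : HasDerivAt (fun y : ℝ => (√(2 * Real.pi))⁻¹ * Real.exp (-y ^ 2 / 2))
      ((√(2 * Real.pi))⁻¹ * (Real.exp (-x ^ 2 / 2) * (-(2 * x) / 2))) x := by
    have h1 : HasDerivAt (fun y : ℝ => -y ^ 2 / 2) (-(2 * x) / 2) x := by
      simpa using ((hasDerivAt_pow 2 x).neg).div_const 2
    exact (h1.exp).const_mul _
  have e : normalDensity = fun y : ℝ => (√(2 * Real.pi))⁻¹ * Real.exp (-y ^ 2 / 2) :=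
    funext normalDensity_eq
  rw [e]
  convert h using 1
  ring

lemma continuous_normalDensity : Continuous normalDensity :=
  continuous_iff_continuousAt.2 fun x => (hasDerivAt_normalDensity x).continuousAt

lemma integrable_normalDensity : Integrable normalDensity := integrable_gaussianPDFReal 0 1

lemma stdNormalCDF_eq_integral (z : ℝ) : stdNormalCDF z = ∫ x in Iic z, normalDensity x := by
  rw [stdNormalCDF, cdf_eq_real, measureReal_def,
    gaussianReal_apply_eq_integral 0 one_ne_zero,
    ENNReal.toReal_ofReal (integral_nonneg fun x => gaussianPDFReal_nonneg _ _ _)]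
  rfl

lemma hasDerivAt_stdNormalCDF (z : ℝ) : HasDerivAt stdNormalCDF (normalDensity z) z := by
  have h : stdNormalCDF = fun y => stdNormalCDF 0 + ∫ x in (0 : ℝ)..y, normalDensity x := by
    funext y
    rw [stdNormalCDF_eq_integral, stdNormalCDF_eq_integral,
      ← intervalIntegral.integral_Iic_sub_Iic integrable_normalDensity.integrableOn
        integrable_normalDensity.integrableOn]
    ring
  rw [h]
  exact (intervalIntegral.integral_hasDerivAt_right
    (continuous_normalDensity.intervalIntegrable _ _)
    (continuous_normalDensity.stronglyMeasurableAtFilter _ _)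
    continuous_normalDensity.continuousAt).const_add _

lemma continuous_stdNormalCDF : Continuous stdNormalCDF :=
  continuous_iff_continuousAt.2 fun x => (hasDerivAt_stdNormalCDF x).continuousAt

lemma stdNormalCDF_nonneg (z : ℝ) : 0 ≤ stdNormalCDF z := cdf_nonneg _ _

lemma stdNormalCDF_le_one (z : ℝ) : stdNormalCDF z ≤ 1 := cdf_le_one _ _

lemma monotone_stdNormalCDF : Monotone stdNormalCDF := monotone_cdf _

lemma stdNormalCDF_neg (z : ℝ) : stdNormalCDF (-z) = 1 - stdNormalCDF z := by
  have h1 : (∫ x in Iic (-z), normalDensity x) = ∫ x in Ioi z, normalDensity x := by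
    have h := integral_comp_neg_Iic (-z) normalDensity
    simp_rw [normalDensity_neg, neg_neg] at h
    exact h
  have h2 : (∫ x, normalDensity x) = 1 := integral_gaussianPDFReal_eq_one 0 one_ne_zero
  have h3 := intervalIntegral.integral_Iic_add_Ioi (b := z) (μ := volume)
    integrable_normalDensity.integrableOn integrable_normalDensity.integrableOn
  rw [stdNormalCDF_eq_integral, stdNormalCDF_eq_integral]
  linarith

lemma stdNormalCDF_sub_le {x y : ℝ} (h : x ≤ y) {c : ℝ}
    (hc : ∀ t ∈ Icc x y, normalDensity t ≤ c) :
    stdNormalCDF y - stdNormalCDF x ≤ c * (y - x) := by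
  refine Convex.image_sub_le_mul_sub_of_deriv_le (convex_Icc x y)
    continuous_stdNormalCDF.continuousOn
    (fun t _ => (hasDerivAt_stdNormalCDF t).differentiableAt.differentiableWithinAt) ?_
    x (left_mem_Icc.2 h) y (right_mem_Icc.2 h) h
  intro t ht
  rw [(hasDerivAt_stdNormalCDF t).deriv]
  exact hc t (interior_subset ht)

lemma abs_mul_normalDensity_le {x : ℝ} (hx : x ≠ 0) : |x * normalDensity x| ≤ |x|⁻¹ := by
  have hx' : 0 < |x| := abs_pos.2 hx
  rw [abs_mul, abs_of_pos (normalDensity_pos x), ← one_div, le_div_iff₀ hx']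
  have h1 : normalDensity x ≤ 2 / 5 * (Real.exp (x ^ 2 / 2))⁻¹ := by
    rw [← Real.exp_neg]
    convert normalDensity_le_exp x using 3
    ring
  have h2 : x ^ 2 / 2 + 1 ≤ Real.exp (x ^ 2 / 2) := Real.add_one_le_exp _
  have hsq : 0 < x ^ 2 := by positivity
  have h3 : (Real.exp (x ^ 2 / 2))⁻¹ ≤ (x ^ 2 / 2)⁻¹ := by
    apply inv_anti₀ (by positivity); linarith
  have h4 : |x| * |x| = x ^ 2 := by rw [← sq, sq_abs]
  calc |x| * normalDensity x * |x| = x ^ 2 * normalDensity x := by rw [← h4]; ring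
    _ ≤ x ^ 2 * (2 / 5 * (x ^ 2 / 2)⁻¹) := by
      apply mul_le_mul_of_nonneg_left _ hsq.le
      linarith
    _ ≤ 1 := by
      have : x ^ 2 ≠ 0 := hsq.ne'
      field_simp
      norm_num

lemma tendsto_mul_normalDensity_atBot :
    Tendsto (fun x => x * normalDensity x) atBot (𝓝 0) := by
  apply squeeze_zero_norm' (a := fun x : ℝ => |x|⁻¹)
  · filter_upwards [eventually_lt_atBot 0] with x hx
    exact abs_mul_normalDensity_le hx.ne
  · exact tendsto_inv_atTop_zero.comp tendsto_abs_atBot_atTop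

lemma tendsto_normalDensity_atBot : Tendsto normalDensity atBot (𝓝 0) := by
  apply squeeze_zero_norm' (a := fun x : ℝ => |x|⁻¹)
  · filter_upwards [eventually_le_atBot (-1)] with x hx
    have hx0 : x < 0 := by linarith
    refine le_trans ?_ (abs_mul_normalDensity_le hx0.ne)
    rw [abs_mul, Real.norm_eq_abs]
    have : 1 ≤ |x| := by rw [abs_of_neg (by linarith)]; linarith
    exact le_mul_of_one_le_left (abs_nonneg _) this
  · exact tendsto_inv_atTop_zero.comp tendsto_abs_atBot_atTop

lemma integrable_id_mul_normalDensity : Integrable (fun x => -x * normalDensity x) := by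
  have h := (integrable_mul_exp_neg_mul_sq (b := 1 / 2) (by norm_num)).const_mul
    (-(√(2 * Real.pi))⁻¹)
  refine h.congr (ae_of_all _ fun x => ?_)
  simp only [normalDensity_eq]
  rw [show -(1 / 2) * x ^ 2 = -x ^ 2 / 2 by ring]
  ring

/-- The upper bound for Mills' ratio of the normal law, in the form `φ(w) + w Φ(w) ≥ 0`. -/
lemma normalDensity_add_mul_cdf_nonneg (w : ℝ) : 0 ≤ normalDensity w + w * stdNormalCDF w := by
  have h1 := integral_Iic_of_hasDerivAt_of_tendsto' (a := w)
    (fun x _ => hasDerivAt_normalDensity x)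
    integrable_id_mul_normalDensity.integrableOn tendsto_normalDensity_atBot
  have h2 : ∫ x in Iic w, -w * normalDensity x ≤ ∫ x in Iic w, -x * normalDensity x := by
    apply setIntegral_mono_on (integrable_normalDensity.const_mul _).integrableOn
      integrable_id_mul_normalDensity.integrableOn measurableSet_Iic
    intro x hx
    have : x ≤ w := hx
    have := normalDensity_pos x
    nlinarith
  rw [integral_const_mul, ← stdNormalCDF_eq_integral] at h2
  linarith

/-- The lower bound for Mills' ratio of the normal law, in the form
`(1 + w²) Φ(w) + w φ(w) ≥ 0`. -/
lemma cdf_add_mul_normalDensity_nonneg (w : ℝ) :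
    0 ≤ (1 + w ^ 2) * stdNormalCDF w + w * normalDensity w := by
  set H : ℝ → ℝ := fun w => (1 + w ^ 2) * stdNormalCDF w + w * normalDensity w with hH
  have hd : ∀ x, HasDerivAt H (2 * (normalDensity x + x * stdNormalCDF x)) x := by
    intro x
    have h1 : HasDerivAt (fun w : ℝ => 1 + w ^ 2) (2 * x) x := by
      simpa using (hasDerivAt_pow 2 x).const_add 1
    have h2 := (h1.mul (hasDerivAt_stdNormalCDF x)).add
      ((hasDerivAt_id x).mul (hasDerivAt_normalDensity x))
    refine h2.congr_deriv ?_
    simp only [id]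
    ring
  have hmono : Monotone H := by
    apply monotone_of_deriv_nonneg (fun x => (hd x).differentiableAt)
    intro x
    rw [(hd x).deriv]
    have := normalDensity_add_mul_cdf_nonneg x
    linarith
  have hlim : Tendsto H atBot (𝓝 0) := by
    have h1 : Tendsto (fun x => x ^ 2 * stdNormalCDF x) atBot (𝓝 0) := by
      apply squeeze_zero_norm' (a := fun x : ℝ => |x * normalDensity x|)
      · filter_upwards [eventually_lt_atBot 0] with x hx
        have h := normalDensity_add_mul_cdf_nonneg x
        have h0 := stdNormalCDF_nonneg x
        rw [Real.norm_of_nonneg (by positivity), abs_mul, abs_of_neg hx,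
          abs_of_pos (normalDensity_pos x)]
        nlinarith
      · simpa using tendsto_mul_normalDensity_atBot.abs
    have h2 : Tendsto stdNormalCDF atBot (𝓝 0) := tendsto_cdf_atBot _
    have h3 := (h2.add h1).add tendsto_mul_normalDensity_atBot
    simp only [add_zero] at h3
    refine h3.congr fun x => ?_
    simp only [hH]
    ring
  exact hmono.le_of_tendsto hlim w

/-- The ratio `Φ / φ` of the normal distribution function to the normal density. -/
noncomputable def normalRatio (w : ℝ) : ℝ := stdNormalCDF w / normalDensity w

/-- The derivative `1 + w Φ(w) / φ(w)` of `normalRatio`. -/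
noncomputable def normalRatioDeriv (w : ℝ) : ℝ := 1 + w * normalRatio w

lemma hasDerivAt_normalRatio (w : ℝ) : HasDerivAt normalRatio (normalRatioDeriv w) w := by
  have h := (hasDerivAt_stdNormalCDF w).div (hasDerivAt_normalDensity w) (normalDensity_pos w).ne'
  refine h.congr_deriv ?_
  unfold normalRatioDeriv normalRatio
  have := (normalDensity_pos w).ne'
  field_simp
  ring

lemma normalRatio_nonneg (w : ℝ) : 0 ≤ normalRatio w :=
  div_nonneg (stdNormalCDF_nonneg w) (normalDensity_pos w).le

lemma normalRatioDeriv_nonneg (w : ℝ) : 0 ≤ normalRatioDeriv w := by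
  have h := div_nonneg (normalDensity_add_mul_cdf_nonneg w) (normalDensity_pos w).le
  rwa [add_div, div_self (normalDensity_pos w).ne', mul_div_assoc] at h

lemma monotone_normalRatio : Monotone normalRatio := by
  apply monotone_of_deriv_nonneg (fun x => (hasDerivAt_normalRatio x).differentiableAt)
  intro x
  rw [(hasDerivAt_normalRatio x).deriv]
  exact normalRatioDeriv_nonneg x

lemma monotone_normalRatioDeriv : Monotone normalRatioDeriv := by
  have hd : ∀ x, HasDerivAt normalRatioDeriv (normalRatio x + x * normalRatioDeriv x) x := by
    intro x
    have h := ((hasDerivAt_id x).mul (hasDerivAt_normalRatio x)).const_add 1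
    refine h.congr_deriv ?_
    simp only [id]
    ring
  apply monotone_of_deriv_nonneg (fun x => (hd x).differentiableAt)
  intro x
  rw [(hd x).deriv]
  have h := div_nonneg (cdf_add_mul_normalDensity_nonneg x) (normalDensity_pos x).le
  rw [add_div, mul_div_assoc, mul_div_assoc, div_self (normalDensity_pos x).ne'] at h
  simp only [normalRatioDeriv, normalRatio] at *
  nlinarith

lemma continuous_normalRatio : Continuous normalRatio :=
  continuous_iff_continuousAt.2 fun x => (hasDerivAt_normalRatio x).continuousAt

lemma continuous_normalRatioDeriv : Continuous normalRatioDeriv :=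
  continuous_const.add (continuous_id.mul continuous_normalRatio)

lemma normalRatio_mul_cdf_neg (z : ℝ) :
    normalRatio z * stdNormalCDF (-z) = normalRatio (-z) * stdNormalCDF z := by
  rw [normalRatio, normalRatio, normalDensity_neg]
  ring

lemma normalRatio_zero_le : normalRatio 0 ≤ 13 / 10 := by
  have h : stdNormalCDF 0 = 1 / 2 := by
    have := stdNormalCDF_neg 0
    rw [neg_zero] at this
    linarith
  have h1 : normalRatio 0 = √(2 * Real.pi) / 2 := by
    rw [normalRatio, h, normalDensity_eq, div_eq_mul_inv, mul_inv, inv_inv]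
    norm_num
    ring
  rw [h1]
  have h2 : √(2 * Real.pi) ≤ 2.6 := by
    apply Real.sqrt_le_iff.2 ⟨by norm_num, ?_⟩
    nlinarith [Real.pi_lt_d2]
  linarith

lemma normalRatio_mul_cdf_neg_le (z : ℝ) : normalRatio z * stdNormalCDF (-z) ≤ 13 / 10 := by
  have key : ∀ y ≤ 0, ∀ x, normalRatio y * stdNormalCDF x ≤ 13 / 10 := by
    intro y hy x
    have h1 := (monotone_normalRatio hy).trans normalRatio_zero_le
    have h2 := normalRatio_nonneg y
    nlinarith [stdNormalCDF_nonneg x, stdNormalCDF_le_one x]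
  rcases le_total z 0 with h | h
  · exact key z h _
  · rw [normalRatio_mul_cdf_neg]
    exact key _ (by linarith) _

/-! ### The solution of Stein's equation for a half-line -/

/-- The bounded solution `f` of Stein's equation `f'(w) - w f(w) = 1(w ≤ z) - Φ(z)`. -/
noncomputable def steinSol (z w : ℝ) : ℝ :=
  if w ≤ z then normalRatio w * stdNormalCDF (-z) else normalRatio (-w) * stdNormalCDF z

/-- The derivative of `steinSol z`, with the left derivative taken at the kink `w = z`. -/
noncomputable def steinDeriv (z w : ℝ) : ℝ :=
  if w ≤ z then stdNormalCDF (-z) * normalRatioDeriv w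
  else -(stdNormalCDF z * normalRatioDeriv (-w))

lemma continuous_uncurry_steinSol : Continuous (Function.uncurry steinSol) := by
  apply Continuous.if_le
  · exact (continuous_normalRatio.comp continuous_snd).mul
      (continuous_stdNormalCDF.comp continuous_fst.neg)
  · exact (continuous_normalRatio.comp continuous_snd.neg).mul
      (continuous_stdNormalCDF.comp continuous_fst)
  · exact continuous_snd
  · exact continuous_fst
  · rintro ⟨z, w⟩ h
    simp only at h
    subst h
    exact normalRatio_mul_cdf_neg _

lemma measurable_uncurry_steinDeriv : Measurable (Function.uncurry steinDeriv) := by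
  apply Measurable.ite (measurableSet_le measurable_snd measurable_fst)
  · exact ((continuous_stdNormalCDF.comp continuous_fst.neg).mul
      (continuous_normalRatioDeriv.comp continuous_snd)).measurable
  · exact ((continuous_stdNormalCDF.comp continuous_fst).mul
      (continuous_normalRatioDeriv.comp continuous_snd.neg)).neg.measurable

lemma steinDeriv_eq (z w : ℝ) :
    steinDeriv z w = w * steinSol z w + ((if w ≤ z then 1 else 0) - stdNormalCDF z) := by
  unfold steinDeriv steinSol
  split_ifs
  · rw [stdNormalCDF_neg, normalRatioDeriv]; ring
  · rw [normalRatioDeriv]; ring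

lemma steinSol_nonneg (z w : ℝ) : 0 ≤ steinSol z w := by
  unfold steinSol
  split_ifs <;> exact mul_nonneg (normalRatio_nonneg _) (stdNormalCDF_nonneg _)

lemma steinSol_le (z w : ℝ) : steinSol z w ≤ 13 / 10 := by
  unfold steinSol
  split_ifs with h
  · exact (mul_le_mul_of_nonneg_right (monotone_normalRatio h) (stdNormalCDF_nonneg _)).trans
      (normalRatio_mul_cdf_neg_le z)
  · refine (mul_le_mul_of_nonneg_right (monotone_normalRatio (by linarith : -w ≤ -z))
      (stdNormalCDF_nonneg _)).trans ?_
    rw [← normalRatio_mul_cdf_neg]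
    exact normalRatio_mul_cdf_neg_le z

lemma steinDeriv_jump (z : ℝ) :
    stdNormalCDF (-z) * normalRatioDeriv z + stdNormalCDF z * normalRatioDeriv (-z) = 1 := by
  have h := normalRatio_mul_cdf_neg z
  have h2 := stdNormalCDF_neg z
  simp only [normalRatioDeriv]
  linear_combination z * h + h2

lemma steinDeriv_le (z w : ℝ) : steinDeriv z w ≤ stdNormalCDF (-z) * normalRatioDeriv z := by
  unfold steinDeriv
  have h1 := stdNormalCDF_nonneg z
  have h2 := stdNormalCDF_nonneg (-z)
  split_ifs with h
  · exact mul_le_mul_of_nonneg_left (monotone_normalRatioDeriv h) h2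
  · have := mul_nonneg h1 (normalRatioDeriv_nonneg (-w))
    have := mul_nonneg h2 (normalRatioDeriv_nonneg z)
    linarith

lemma le_steinDeriv (z w : ℝ) : -(stdNormalCDF z * normalRatioDeriv (-z)) ≤ steinDeriv z w := by
  unfold steinDeriv
  have h1 := stdNormalCDF_nonneg z
  have h2 := stdNormalCDF_nonneg (-z)
  split_ifs with h
  · have := mul_nonneg h1 (normalRatioDeriv_nonneg (-z))
    have := mul_nonneg h2 (normalRatioDeriv_nonneg w)
    linarith
  · have := mul_le_mul_of_nonneg_left
      (monotone_normalRatioDeriv (by linarith : -w ≤ -z)) h1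
    linarith

lemma steinDeriv_sub_le (z v w : ℝ) : |steinDeriv z v - steinDeriv z w| ≤ 1 := by
  have := steinDeriv_jump z
  rw [abs_le]
  constructor <;>
    linarith [steinDeriv_le z v, steinDeriv_le z w, le_steinDeriv z v, le_steinDeriv z w]

lemma abs_steinDeriv_le (z w : ℝ) : |steinDeriv z w| ≤ 1 := by
  have := steinDeriv_jump z
  have h1 := mul_nonneg (stdNormalCDF_nonneg z) (normalRatioDeriv_nonneg (-z))
  have h2 := mul_nonneg (stdNormalCDF_nonneg (-z)) (normalRatioDeriv_nonneg z)
  rw [abs_le]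
  constructor <;> linarith [steinDeriv_le z w, le_steinDeriv z w]

lemma steinSol_sub_eq_integral (z a b : ℝ) :
    ∫ w in a..b, steinDeriv z w = steinSol z b - steinSol z a := by
  apply integral_eq_of_hasDerivAt_off_countable (s := {z}) _ _ (countable_singleton z)
  · exact (continuous_uncurry_steinSol.comp (Continuous.prodMk_right z)).continuousOn
  · rintro w ⟨_, hw⟩
    have hw' : w ≠ z := hw
    rcases lt_or_gt_of_ne hw' with h | h
    · have h1 := (hasDerivAt_normalRatio w).mul_const (stdNormalCDF (-z))
      rw [steinDeriv, if_pos h.le, mul_comm]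
      apply h1.congr_of_eventuallyEq
      filter_upwards [eventually_lt_nhds h] with y hy
      rw [steinSol, if_pos hy.le]
    · have h1 := ((hasDerivAt_normalRatio (-w)).comp w (hasDerivAt_neg w)).mul_const
        (stdNormalCDF z)
      rw [steinDeriv, if_neg (not_le.2 h)]
      have h2 : -(stdNormalCDF z * normalRatioDeriv (-w))
        = normalRatioDeriv (-w) * -1 * stdNormalCDF z := by ring
      rw [h2]
      apply h1.congr_of_eventuallyEq
      filter_upwards [eventually_gt_nhds h] with y hy
      rw [steinSol, if_neg (not_le.2 hy)]
      rfl
  · refine (intervalIntegrable_const (c := (1 : ℝ))).mono_fun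
      ((measurable_uncurry_steinDeriv.comp measurable_prodMk_left).aestronglyMeasurable) ?_
    exact ae_of_all _ fun w => by simpa using abs_steinDeriv_le z w

/-- Far to the left of a large level `z` the solution of Stein's equation and its derivative are
exponentially small. -/
lemma steinSol_steinDeriv_small {z w : ℝ} (hz : 2 ≤ z) (hw : w ≤ z / 2) :
    steinSol z w ≤ Real.exp (-z / 4) ∧ |steinDeriv z w| ≤ 2 * Real.exp (-z / 4) := by
  have hwz : w ≤ z := by linarith
  have hc : stdNormalCDF (-z) ≤ normalDensity z := by
    have h := normalDensity_add_mul_cdf_nonneg (-z)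
    rw [normalDensity_neg] at h
    nlinarith [stdNormalCDF_nonneg (-z)]
  have hden : normalDensity z = Real.exp (-(3 / 8) * z ^ 2) * normalDensity (z / 2) := by
    rw [normalDensity_eq, normalDensity_eq, mul_left_comm, ← Real.exp_add]
    congr 2
    ring
  have hr : normalRatio w * stdNormalCDF (-z) ≤ Real.exp (-(3 / 8) * z ^ 2) := by
    calc normalRatio w * stdNormalCDF (-z) ≤ normalRatio (z / 2) * normalDensity z :=
          mul_le_mul (monotone_normalRatio hw) hc (stdNormalCDF_nonneg _) (normalRatio_nonneg _)
      _ = Real.exp (-(3 / 8) * z ^ 2) * stdNormalCDF (z / 2) := by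
          rw [hden, normalRatio]
          have := (normalDensity_pos (z / 2)).ne'
          field_simp
      _ ≤ Real.exp (-(3 / 8) * z ^ 2) * 1 := by
          gcongr
          exact stdNormalCDF_le_one _
      _ = _ := mul_one _
  have hexp : (1 + z / 2) * Real.exp (-(3 / 8) * z ^ 2) ≤ Real.exp (-z / 4) := by
    have h1 : 1 + z / 2 ≤ Real.exp (z / 2) := by linarith [Real.add_one_le_exp (z / 2)]
    calc (1 + z / 2) * Real.exp (-(3 / 8) * z ^ 2)
        ≤ Real.exp (z / 2) * Real.exp (-(3 / 8) * z ^ 2) := by gcongr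
      _ = Real.exp (z / 2 + -(3 / 8) * z ^ 2) := (Real.exp_add _ _).symm
      _ ≤ _ := Real.exp_le_exp.2 (by nlinarith)
  have hpos := Real.exp_pos (-(3 / 8) * z ^ 2)
  constructor
  · rw [steinSol, if_pos hwz]
    nlinarith
  · have hd : stdNormalCDF (-z) * normalRatioDeriv w
        ≤ stdNormalCDF (-z) * normalRatioDeriv (z / 2) :=
      mul_le_mul_of_nonneg_left (monotone_normalRatioDeriv hw) (stdNormalCDF_nonneg _)
    have hr' : normalRatio (z / 2) * stdNormalCDF (-z) ≤ Real.exp (-(3 / 8) * z ^ 2) := by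
      calc normalRatio (z / 2) * stdNormalCDF (-z) ≤ normalRatio (z / 2) * normalDensity z :=
            mul_le_mul_of_nonneg_left hc (normalRatio_nonneg _)
        _ = Real.exp (-(3 / 8) * z ^ 2) * stdNormalCDF (z / 2) := by
            rw [hden, normalRatio]
            have := (normalDensity_pos (z / 2)).ne'
            field_simp
        _ ≤ Real.exp (-(3 / 8) * z ^ 2) * 1 := by
            gcongr
            exact stdNormalCDF_le_one _
        _ = _ := mul_one _
    have hc' : stdNormalCDF (-z) ≤ Real.exp (-z / 4) := by
      refine hc.trans ((normalDensity_le_exp z).trans ?_)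
      have h2 : Real.exp (-z ^ 2 / 2) ≤ Real.exp (-z / 4) :=
        Real.exp_le_exp.2 (by nlinarith)
      have := Real.exp_pos (-z ^ 2 / 2)
      linarith
    rw [steinDeriv, if_pos hwz, abs_of_nonneg
      (mul_nonneg (stdNormalCDF_nonneg _) (normalRatioDeriv_nonneg _))]
    refine hd.trans ?_
    rw [normalRatioDeriv]
    have : z / 2 * (normalRatio (z / 2) * stdNormalCDF (-z))
        ≤ z / 2 * Real.exp (-(3 / 8) * z ^ 2) := by gcongr
    nlinarith

/-! ### Ramps and plateaus -/

/-- The indicator function of the window `[0, α]`. -/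
noncomputable def window (α v : ℝ) : ℝ := (Icc (0 : ℝ) α).indicator (fun _ => (1 : ℝ)) v

/-- The ramp rising linearly from `0` to `1` over the window `[0, α]`. -/
noncomputable def ramp (α v : ℝ) : ℝ := max 0 (min 1 (v / α))

/-- A trapezoid that equals `1` on `[0, α]` and vanishes off `[-α, 2α]`. -/
noncomputable def plateau (α v : ℝ) : ℝ := ramp α (v + α) - ramp α (v - α)

/-- The primitive of `plateau α` vanishing at `-∞`. -/
noncomputable def plateauInt (α v : ℝ) : ℝ := ∫ u in (v - α)..(v + α), ramp α u

lemma window_nonneg (α v : ℝ) : 0 ≤ window α v := indicator_nonneg (fun _ _ => zero_le_one) _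

lemma window_le_one (α v : ℝ) : window α v ≤ 1 :=
  indicator_le_self' (fun _ _ => zero_le_one) v

lemma window_of_mem {α v : ℝ} (h : v ∈ Icc 0 α) : window α v = 1 := indicator_of_mem h _

lemma window_of_notMem {α v : ℝ} (h : v ∉ Icc 0 α) : window α v = 0 := indicator_of_notMem h _

lemma measurable_window (α : ℝ) : Measurable (window α) :=
  measurable_const.indicator measurableSet_Icc

lemma continuous_ramp (α : ℝ) : Continuous (ramp α) := by
  unfold ramp; fun_prop

lemma ramp_nonneg (α v : ℝ) : 0 ≤ ramp α v := le_max_left _ _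

lemma ramp_le_one (α v : ℝ) : ramp α v ≤ 1 := max_le zero_le_one (min_le_left _ _)

lemma ramp_of_nonpos {α v : ℝ} (hα : 0 < α) (hv : v ≤ 0) : ramp α v = 0 :=
  max_eq_left ((min_le_right _ _).trans (div_nonpos_of_nonpos_of_nonneg hv hα.le))

lemma ramp_of_ge {α v : ℝ} (hα : 0 < α) (hv : α ≤ v) : ramp α v = 1 := by
  rw [ramp, min_eq_left ((one_le_div hα).2 hv), max_eq_right zero_le_one]

lemma monotone_ramp {α : ℝ} (hα : 0 < α) : Monotone (ramp α) := fun _ _ h =>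
  max_le_max le_rfl (min_le_min le_rfl ((div_le_div_iff_of_pos_right hα).2 h))

lemma integral_window {α : ℝ} (hα : 0 < α) (a b : ℝ) :
    ∫ v in a..b, window α v / α = ramp α b - ramp α a := by
  apply integral_eq_of_hasDerivAt_off_countable (s := {0, α}) _ _ (by simp)
  · exact (continuous_ramp α).continuousOn
  · rintro v ⟨_, hv⟩
    simp only [mem_insert_iff, mem_singleton_iff, not_or] at hv
    obtain ⟨h0, h1⟩ := hv
    rcases lt_or_gt_of_ne h0 with h | h
    · rw [window_of_notMem (fun h' => absurd h'.1 (not_le.2 h)), zero_div]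
      apply (hasDerivAt_const v (0 : ℝ)).congr_of_eventuallyEq
      filter_upwards [eventually_lt_nhds h] with y hy
      exact ramp_of_nonpos hα hy.le
    · rcases lt_or_gt_of_ne h1 with h' | h'
      · rw [window_of_mem ⟨h.le, h'.le⟩]
        apply ((hasDerivAt_id v).div_const α).congr_of_eventuallyEq
        filter_upwards [eventually_gt_nhds h, eventually_lt_nhds h'] with y hy hy'
        rw [ramp, min_eq_right ((div_le_one hα).2 hy'.le), max_eq_right (by positivity)]
        rfl
      · rw [window_of_notMem (fun h'' => absurd h''.2 (not_le.2 h')), zero_div]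
        apply (hasDerivAt_const v (1 : ℝ)).congr_of_eventuallyEq
        filter_upwards [eventually_gt_nhds h'] with y hy
        exact ramp_of_ge hα hy.le
  · refine (intervalIntegrable_const (c := (1 / α : ℝ))).mono_fun
      ((measurable_window α).div_const α).aestronglyMeasurable ?_
    refine ae_of_all _ fun v => ?_
    have h1 := window_nonneg α v
    have h2 := window_le_one α v
    simp only [Real.norm_eq_abs, abs_div, abs_of_pos hα, abs_of_nonneg h1, abs_one]
    gcongr

lemma ramp_add_sub {α : ℝ} (hα : 0 < α) (y t : ℝ) :
    ramp α (y + t) - ramp α y = t / α * ∫ r in (0 : ℝ)..1, window α (y + r * t) := by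
  have h1 := intervalIntegral.smul_integral_comp_add_mul (a := 0) (b := 1)
    (fun v => window α v / α) t y
  simp only [mul_zero, add_zero, mul_one, smul_eq_mul] at h1
  rw [integral_window hα, intervalIntegral.integral_div] at h1
  rw [← h1]
  simp_rw [mul_comm _ t]
  ring

lemma abs_ramp_add_sub {α : ℝ} (hα : 0 < α) (y t : ℝ) :
    |ramp α (y + t) - ramp α y| = |t| / α * ∫ r in (0 : ℝ)..1, window α (y + r * t) := by
  rw [ramp_add_sub hα, abs_mul, abs_div, abs_of_pos hα, abs_of_nonneg
    (intervalIntegral.integral_nonneg zero_le_one fun r _ => window_nonneg _ _)]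

lemma continuous_plateau (α : ℝ) : Continuous (plateau α) :=
  ((continuous_ramp α).comp (continuous_id.add continuous_const)).sub
    ((continuous_ramp α).comp (continuous_id.sub continuous_const))

lemma hasDerivAt_plateauInt (α v : ℝ) : HasDerivAt (plateauInt α) (plateau α v) v := by
  have h : plateauInt α = fun v => (∫ u in (0 : ℝ)..(v + α), ramp α u)
      - ∫ u in (0 : ℝ)..(v - α), ramp α u := by
    funext v
    rw [plateauInt, intervalIntegral.integral_interval_sub_left] <;>
      exact (continuous_ramp α).intervalIntegrable _ _
  have hp : ∀ c : ℝ, HasDerivAt (fun v => ∫ u in (0 : ℝ)..(v + c), ramp α u)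
      (ramp α (v + c)) v := by
    intro c
    have h1 := intervalIntegral.integral_hasDerivAt_right
      ((continuous_ramp α).intervalIntegrable (0 : ℝ) (v + c))
      ((continuous_ramp α).stronglyMeasurableAtFilter _ _)
      (continuous_ramp α).continuousAt
    exact (HasDerivAt.comp v h1 ((hasDerivAt_id v).add_const c)).congr_deriv (mul_one _)
  rw [h]
  exact (hp α).sub (hp (-α))

lemma continuous_plateauInt (α : ℝ) : Continuous (plateauInt α) :=
  continuous_iff_continuousAt.2 fun v => (hasDerivAt_plateauInt α v).continuousAt

lemma integral_plateau (α a b : ℝ) :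
    ∫ v in a..b, plateau α v = plateauInt α b - plateauInt α a :=
  intervalIntegral.integral_eq_sub_of_hasDerivAt (fun v _ => hasDerivAt_plateauInt α v)
    ((continuous_plateau α).intervalIntegrable _ _)

lemma plateau_nonneg {α : ℝ} (hα : 0 < α) (v : ℝ) : 0 ≤ plateau α v :=
  sub_nonneg.2 (monotone_ramp hα (by linarith))

lemma plateau_le_one (α v : ℝ) : plateau α v ≤ 1 := by
  have h1 := ramp_le_one α (v + α)
  have h2 := ramp_nonneg α (v - α)
  rw [plateau]; linarith

lemma plateau_eq_zero {α v : ℝ} (hα : 0 < α) (hv : v ∉ Icc (-α) (2 * α)) : plateau α v = 0 := by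
  rw [mem_Icc, not_and_or, not_le, not_le] at hv
  rcases hv with h | h
  · rw [plateau, ramp_of_nonpos hα (by linarith), ramp_of_nonpos hα (by linarith), sub_zero]
  · rw [plateau, ramp_of_ge hα (by linarith), ramp_of_ge hα (by linarith), sub_self]

lemma window_le_plateau {α : ℝ} (hα : 0 < α) (v : ℝ) : window α v ≤ plateau α v := by
  by_cases h : v ∈ Icc 0 α
  · rw [window_of_mem h, plateau, ramp_of_ge hα (by linarith [h.1]),
      ramp_of_nonpos hα (by linarith [h.2]), sub_zero]
  · rw [window_of_notMem h]
    exact plateau_nonneg hα v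

lemma plateauInt_nonneg {α : ℝ} (hα : 0 < α) (v : ℝ) : 0 ≤ plateauInt α v :=
  intervalIntegral.integral_nonneg (by linarith) fun _ _ => ramp_nonneg _ _

lemma plateauInt_le {α : ℝ} (hα : 0 < α) (v : ℝ) : plateauInt α v ≤ 2 * α := by
  have h : plateauInt α v ≤ ∫ _ in (v - α)..(v + α), (1 : ℝ) :=
    intervalIntegral.integral_mono_on (by linarith) ((continuous_ramp α).intervalIntegrable _ _)
      intervalIntegrable_const fun u _ => ramp_le_one α u
  rw [intervalIntegral.integral_const, smul_eq_mul, mul_one] at h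
  linarith

lemma plateauInt_eq_zero {α v : ℝ} (hα : 0 < α) (hv : v ≤ -α) : plateauInt α v = 0 := by
  rw [plateauInt, intervalIntegral.integral_congr (g := fun _ => (0 : ℝ)),
    intervalIntegral.integral_zero]
  intro u hu
  rw [uIcc_of_le (by linarith)] at hu
  exact ramp_of_nonpos hα (by linarith [hu.2])

/-! ### The kernel of the local Stein identity -/

/-- The kernel `1_{(-y, 0]} - 1_{(0, -y]}`, for which `∫ k(y, t) g(t) dt = ∫_{-y}^0 g(t) dt`. -/
noncomputable def steinKernel (y t : ℝ) : ℝ :=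
  (Ioc (-y) 0).indicator (fun _ => (1 : ℝ)) t - (Ioc 0 (-y)).indicator (fun _ => (1 : ℝ)) t

/-- The number `-y` clipped to `[-1, 1]`. -/
noncomputable def clipNeg (y : ℝ) : ℝ := max (-1) (min 1 (-y))

lemma measurable_uncurry_steinKernel : Measurable (Function.uncurry steinKernel) := by
  have h1 : MeasurableSet {x : ℝ × ℝ | -x.1 < x.2 ∧ x.2 ≤ 0} :=
    (measurableSet_lt measurable_fst.neg measurable_snd).inter
      (measurableSet_le measurable_snd measurable_const)
  have h2 : MeasurableSet {x : ℝ × ℝ | 0 < x.2 ∧ x.2 ≤ -x.1} :=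
    (measurableSet_lt measurable_const measurable_snd).inter
      (measurableSet_le measurable_snd measurable_fst.neg)
  exact (measurable_const.indicator h1 : Measurable (indicator _ fun _ => (1 : ℝ))).sub
    (measurable_const.indicator h2)

lemma steinKernel_of_nonneg {y : ℝ} (hy : 0 ≤ y) (t : ℝ) :
    steinKernel y t = (Ioc (-y) 0).indicator (fun _ => (1 : ℝ)) t := by
  rw [steinKernel, Ioc_eq_empty (show ¬(0 : ℝ) < -y by linarith)]
  simp

lemma steinKernel_of_nonpos {y : ℝ} (hy : y ≤ 0) (t : ℝ) :
    steinKernel y t = -(Ioc 0 (-y)).indicator (fun _ => (1 : ℝ)) t := by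
  rw [steinKernel, Ioc_eq_empty (show ¬-y < (0 : ℝ) by linarith)]
  simp

lemma abs_steinKernel_le_one (y t : ℝ) : |steinKernel y t| ≤ 1 := by
  rcases le_total 0 y with h | h
  · rw [steinKernel_of_nonneg h]
    by_cases ht : t ∈ Ioc (-y) 0 <;> simp [ht]
  · rw [steinKernel_of_nonpos h]
    by_cases ht : t ∈ Ioc 0 (-y) <;> simp [ht]

lemma steinKernel_sq (y t : ℝ) : steinKernel y t ^ 2 = |steinKernel y t| := by
  rcases le_total 0 y with h | h
  · rw [steinKernel_of_nonneg h]
    by_cases ht : t ∈ Ioc (-y) 0 <;> simp [ht]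
  · rw [steinKernel_of_nonpos h]
    by_cases ht : t ∈ Ioc 0 (-y) <;> simp [ht]

lemma integral_steinKernel_mul (g : ℝ → ℝ) (y : ℝ) :
    ∫ t in (-1 : ℝ)..1, steinKernel y t * g t = ∫ t in (clipNeg y)..0, g t := by
  rw [intervalIntegral.integral_of_le (by norm_num)]
  rcases le_total 0 y with h | h
  · have hc : clipNeg y = max (-1) (-y) := by
      rw [clipNeg, min_eq_right (by linarith)]
    have e : ∀ t, steinKernel y t * g t = (Ioc (-y) 0).indicator g t := by
      intro t
      rw [steinKernel_of_nonneg h]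
      by_cases ht : t ∈ Ioc (-y) 0 <;> simp [ht]
    simp_rw [e]
    rw [setIntegral_indicator measurableSet_Ioc, Ioc_inter_Ioc, hc,
      intervalIntegral.integral_of_le (max_le (by norm_num) (by linarith))]
    rw [min_eq_right zero_le_one]
  · have hc : clipNeg y = min 1 (-y) := by
      rw [clipNeg, max_eq_right (le_min (by norm_num) (by linarith))]
    have e : ∀ t, steinKernel y t * g t = -(Ioc 0 (-y)).indicator g t := by
      intro t
      rw [steinKernel_of_nonpos h]
      by_cases ht : t ∈ Ioc 0 (-y) <;> simp [ht]
    simp_rw [e]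
    rw [integral_neg, setIntegral_indicator measurableSet_Ioc, Ioc_inter_Ioc, hc,
      intervalIntegral.integral_symm,
      intervalIntegral.integral_of_le (le_min zero_le_one (by linarith))]
    rw [max_eq_right (by norm_num)]

lemma abs_clipNeg (y : ℝ) : |clipNeg y| = min |y| 1 := by
  rcases le_total 0 y with h | h
  · rw [clipNeg, min_eq_right (by linarith : -y ≤ 1), abs_of_nonneg h,
      abs_of_nonpos (max_le (by norm_num) (by linarith))]
    rcases le_total y 1 with h1 | h1
    · rw [max_eq_right (by linarith), min_eq_left h1]; ring
    · rw [max_eq_left (by linarith), min_eq_right h1]; ring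
  · rw [clipNeg, max_eq_right (le_min (by norm_num) (by linarith : (-1 : ℝ) ≤ -y)),
      abs_of_nonpos h, abs_of_nonneg (le_min zero_le_one (by linarith)), min_comm]

lemma abs_neg_sub_clipNeg (y : ℝ) : |-y - clipNeg y| = max (|y| - 1) 0 := by
  rcases le_total 0 y with h | h
  · rw [clipNeg, min_eq_right (by linarith : -y ≤ 1), abs_of_nonneg h]
    rcases le_total y 1 with h1 | h1
    · rw [max_eq_right (by linarith), max_eq_right (by linarith)]; simp
    · rw [max_eq_left (by linarith), max_eq_left (by linarith), abs_of_nonpos (by linarith)]; ring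
  · rw [clipNeg, max_eq_right (le_min (by norm_num) (by linarith : (-1 : ℝ) ≤ -y)),
      abs_of_nonpos h]
    rcases le_total (-y) 1 with h1 | h1
    · rw [min_eq_right h1, max_eq_right (by linarith)]; simp
    · rw [min_eq_left h1, max_eq_left (by linarith), abs_of_nonneg (by linarith)]

lemma abs_integral_sub_steinKernel_le {g : ℝ → ℝ} (hg : Continuous g) (hg1 : ∀ t, |g t| ≤ 1)
    (y : ℝ) : |(∫ t in (-y)..0, g t) - ∫ t in (-1 : ℝ)..1, steinKernel y t * g t|
      ≤ max (|y| - 1) 0 := by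
  rw [integral_steinKernel_mul, intervalIntegral.integral_interval_sub_interval_comm'
    (hg.intervalIntegrable _ _) (hg.intervalIntegrable _ _) (hg.intervalIntegrable _ _)]
  rw [intervalIntegral.integral_same, zero_sub, abs_neg, ← abs_neg_sub_clipNeg]
  have h := intervalIntegral.norm_integral_le_of_norm_le_const (a := clipNeg y) (b := -y)
    (f := g) (C := 1) (fun t _ => hg1 t)
  rwa [one_mul] at h

lemma abs_sub_integral_steinKernel_le (y : ℝ) :
    |y - ∫ t in (-1 : ℝ)..1, steinKernel y t| ≤ max (|y| - 1) 0 := by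
  have h := abs_integral_sub_steinKernel_le (g := fun _ => 1) continuous_const (by simp) y
  simpa using h

lemma integral_abs_steinKernel_mul {g : ℝ → ℝ} (y : ℝ) :
    ∫ t in (-1 : ℝ)..1, |steinKernel y t| * g t = |∫ t in (clipNeg y)..0, g t| ∨
    ∫ t in (-1 : ℝ)..1, |steinKernel y t| * g t = -|∫ t in (clipNeg y)..0, g t| := by
  have key : (∀ t, |steinKernel y t| = steinKernel y t) ∨
      (∀ t, |steinKernel y t| = -steinKernel y t) := by
    rcases le_total 0 y with h | h
    · left; intro t
      rw [steinKernel_of_nonneg h, abs_of_nonneg (indicator_nonneg (fun _ _ => zero_le_one) _)]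
    · right; intro t
      rw [steinKernel_of_nonpos h, abs_neg,
        abs_of_nonneg (indicator_nonneg (fun _ _ => zero_le_one) _), neg_neg]
  rcases key with h | h
  · simp_rw [h, integral_steinKernel_mul]
    rcases abs_cases (∫ t in (clipNeg y)..0, g t) with h1 | h1
    · left; rw [h1.1]
    · right; rw [h1.1, neg_neg]
  · simp_rw [h, neg_mul, intervalIntegral.integral_neg, integral_steinKernel_mul]
    rcases abs_cases (∫ t in (clipNeg y)..0, g t) with h1 | h1
    · right; rw [h1.1]
    · left; rw [h1.1]

lemma integral_abs_steinKernel (y : ℝ) :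
    ∫ t in (-1 : ℝ)..1, |steinKernel y t| ≤ min |y| 1 := by
  have h := integral_abs_steinKernel_mul (g := fun _ => 1) y
  simp only [mul_one, intervalIntegral.integral_const, smul_eq_mul, zero_sub, abs_neg,
    abs_clipNeg] at h
  rcases h with h | h
  · exact h.le
  · rw [h]
    have : 0 ≤ min |y| 1 := le_min (abs_nonneg _) zero_le_one
    linarith

lemma integral_abs_steinKernel_mul_abs (y : ℝ) :
    ∫ t in (-1 : ℝ)..1, |steinKernel y t| * |t| ≤ min |y| 1 ^ 2 / 2 := by
  have h := integral_abs_steinKernel_mul (g := fun t => |t|) y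
  have e : abs (∫ t in (clipNeg y)..0, |t|) ≤ min |y| 1 ^ 2 / 2 := by
    rw [← abs_clipNeg, sq_abs]
    rcases le_total (clipNeg y) 0 with hc | hc
    · rw [intervalIntegral.integral_congr (g := fun t => -t)]
      · rw [intervalIntegral.integral_neg, integral_id, abs_neg, abs_div]
        simp
      · intro t ht
        rw [uIcc_of_le hc] at ht
        exact abs_of_nonpos ht.2
    · rw [intervalIntegral.integral_congr (g := fun t => t)]
      · rw [integral_id, abs_div]
        simp
      · intro t ht
        rw [uIcc_of_ge hc] at ht
        exact abs_of_nonneg ht.1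
  have := abs_nonneg (∫ t in (clipNeg y)..0, |t|)
  rcases h with h | h <;> linarith

/-! ### Averaged solutions of Stein's equation -/

/-- The average over `[z, z + α]` of the solutions of Stein's equation for the half-lines; it
solves Stein's equation for the continuous test function `w ↦ 1 - ramp α (w - z)`. -/
noncomputable def avgSol (α z w : ℝ) : ℝ := ∫ s in (0 : ℝ)..1, steinSol (z + s * α) w

/-- The derivative of `avgSol α z`. -/
noncomputable def avgDeriv (α z w : ℝ) : ℝ := ∫ s in (0 : ℝ)..1, steinDeriv (z + s * α) w

/-- The normal mean of the test function `w ↦ 1 - ramp α (w - z)`. -/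
noncomputable def avgCDF (α z : ℝ) : ℝ := ∫ s in (0 : ℝ)..1, stdNormalCDF (z + s * α)

lemma intervalIntegrable_of_bdd {f : ℝ → ℝ} (hf : Measurable f) {C : ℝ} (hC : ∀ s, |f s| ≤ C)
    (a b : ℝ) : IntervalIntegrable f volume a b := by
  refine (intervalIntegrable_const (c := C)).mono_fun hf.aestronglyMeasurable ?_
  exact ae_of_all _ fun s => by
    simpa using (hC s).trans (le_abs_self C)

lemma intervalIntegrable_steinSol (α z w a b : ℝ) :
    IntervalIntegrable (fun s => steinSol (z + s * α) w) volume a b :=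
  intervalIntegrable_of_bdd
    (continuous_uncurry_steinSol.measurable.comp
      (f := fun s : ℝ => (z + s * α, w)) (by fun_prop))
    (C := 13 / 10) (fun s => (abs_of_nonneg (steinSol_nonneg _ _)).trans_le (steinSol_le _ _)) a b

lemma intervalIntegrable_steinDeriv (α z w a b : ℝ) :
    IntervalIntegrable (fun s => steinDeriv (z + s * α) w) volume a b :=
  intervalIntegrable_of_bdd
    (measurable_uncurry_steinDeriv.comp (f := fun s : ℝ => (z + s * α, w)) (by fun_prop))
    (fun _ => abs_steinDeriv_le _ _) a b

lemma integral_half_line {α : ℝ} (hα : 0 < α) (z w : ℝ) :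
    ∫ s in (0 : ℝ)..1, (if w ≤ z + s * α then (1 : ℝ) else 0) = 1 - ramp α (w - z) := by
  rw [intervalIntegral.integral_of_le zero_le_one]
  have hset : ∀ s, (if w ≤ z + s * α then (1 : ℝ) else 0)
      = (Ici ((w - z) / α)).indicator (fun _ => (1 : ℝ)) s := by
    intro s
    have : w ≤ z + s * α ↔ s ∈ Ici ((w - z) / α) := by
      rw [mem_Ici, div_le_iff₀ hα]; constructor <;> intro h <;> linarith
    simp only [indicator, this]
  simp_rw [hset]
  rw [setIntegral_indicator measurableSet_Ici, setIntegral_const, smul_eq_mul, mul_one, ramp]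
  set c := (w - z) / α
  rw [measureReal_def]
  rcases le_total c 0 with h | h
  · rw [max_eq_left ((min_le_right _ _).trans h), inter_eq_left.2]
    · simp
    · intro s hs; exact h.trans hs.1.le
  · rcases lt_or_ge 1 c with h1 | h1
    · rw [min_eq_left h1.le, max_eq_right zero_le_one, disjoint_iff_inter_eq_empty.1]
      · simp
      · rw [disjoint_left]
        intro s hs hs'
        have := hs.2
        have : c ≤ s := hs'
        linarith
    · rw [min_eq_right h1, max_eq_right h]
      have hae : (Ioc (0 : ℝ) 1 ∩ Ici c : Set ℝ) =ᵐ[volume] Icc c 1 := by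
        rw [show (Icc c 1 : Set ℝ) = Icc 0 1 ∩ Ici c by
          ext s; simp only [mem_Icc, mem_inter_iff, mem_Ici]
          constructor
          · rintro ⟨h1, h2⟩; exact ⟨⟨h.trans h1, h2⟩, h1⟩
          · rintro ⟨⟨_, h2⟩, h1⟩; exact ⟨h1, h2⟩]
        exact Ioc_ae_eq_Icc.inter (ae_eq_refl _)
      rw [measure_congr hae, Real.volume_Icc, ENNReal.toReal_ofReal (by linarith)]

lemma avgDeriv_eq {α : ℝ} (hα : 0 < α) (z w : ℝ) :
    avgDeriv α z w = w * avgSol α z w + (1 - ramp α (w - z) - avgCDF α z) := by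
  have hi : IntervalIntegrable (fun s => if w ≤ z + s * α then (1 : ℝ) else 0) volume 0 1 := by
    apply intervalIntegrable_of_bdd (C := 1)
    · exact Measurable.ite (measurableSet_le measurable_const (by fun_prop)) measurable_const
        measurable_const
    · intro s; split_ifs <;> simp
  have hc : IntervalIntegrable (fun s => stdNormalCDF (z + s * α)) volume 0 1 :=
    (continuous_stdNormalCDF.comp (by fun_prop)).intervalIntegrable _ _
  rw [avgDeriv]
  simp_rw [steinDeriv_eq]
  rw [intervalIntegral.integral_add ((intervalIntegrable_steinSol _ _ _ _ _).const_mul _)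
    (hi.sub hc), intervalIntegral.integral_sub hi hc, integral_half_line hα,
    intervalIntegral.integral_const_mul]
  rfl

lemma abs_avgDeriv_sub_le_one (α z v w : ℝ) : |avgDeriv α z v - avgDeriv α z w| ≤ 1 := by
  rw [avgDeriv, avgDeriv, ← intervalIntegral.integral_sub
    (intervalIntegrable_steinDeriv _ _ _ _ _) (intervalIntegrable_steinDeriv _ _ _ _ _)]
  have h := intervalIntegral.norm_integral_le_of_norm_le_const (a := 0) (b := 1)
    (f := fun s => steinDeriv (z + s * α) v - steinDeriv (z + s * α) w) (C := 1)
    (fun s _ => steinDeriv_sub_le _ _ _)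
  simpa using h

lemma abs_avgDeriv_le_one (α z w : ℝ) : |avgDeriv α z w| ≤ 1 := by
  have h := intervalIntegral.norm_integral_le_of_norm_le_const (a := 0) (b := 1)
    (f := fun s => steinDeriv (z + s * α) w) (C := 1) (fun s _ => abs_steinDeriv_le _ _)
  simpa [avgDeriv] using h

lemma abs_avgSol_le (α z w : ℝ) : |avgSol α z w| ≤ 13 / 10 := by
  have h := intervalIntegral.norm_integral_le_of_norm_le_const (a := 0) (b := 1)
    (f := fun s => steinSol (z + s * α) w) (C := 13 / 10) (fun s _ => by
      rw [Real.norm_eq_abs, abs_of_nonneg (steinSol_nonneg _ _)]; exact steinSol_le _ _)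
  simpa [avgSol] using h

lemma integral_avgDeriv (α z a b : ℝ) :
    ∫ w in a..b, avgDeriv α z w = avgSol α z b - avgSol α z a := by
  rw [avgSol, avgSol, ← intervalIntegral.integral_sub
    (intervalIntegrable_steinSol _ _ _ _ _) (intervalIntegrable_steinSol _ _ _ _ _)]
  simp_rw [← steinSol_sub_eq_integral, avgDeriv]
  have hm : Measurable (Function.uncurry fun w s => steinDeriv (z + s * α) w) :=
    measurable_uncurry_steinDeriv.comp (f := fun x : ℝ × ℝ => (z + x.2 * α, x.1)) (by fun_prop)
  have hint : ∀ c d : ℝ, ∫ w in Ioc c d, ∫ s in Ioc (0 : ℝ) 1, steinDeriv (z + s * α) w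
      = ∫ s in Ioc (0 : ℝ) 1, ∫ w in Ioc c d, steinDeriv (z + s * α) w := by
    intro c d
    apply integral_integral_swap
    exact Integrable.of_bound hm.aestronglyMeasurable 1 (ae_of_all _ fun x => abs_steinDeriv_le _ _)
  simp only [intervalIntegral, Ioc_eq_empty (by norm_num : ¬ (1 : ℝ) < 0), Measure.restrict_empty,
    integral_zero_measure, sub_zero]
  rw [hint, hint, integral_sub]
  all_goals
    refine (Integrable.of_bound (μ := (volume.restrict (Ioc (0 : ℝ) 1)).prod
      (volume.restrict (Ioc _ _))) (f := fun x : ℝ × ℝ => steinDeriv (z + x.1 * α) x.2)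
      (hm.comp measurable_swap).aestronglyMeasurable 1
      (ae_of_all _ fun x => abs_steinDeriv_le _ _)).integral_prod_left

lemma abs_integral_avgDeriv_sub_le {α z C a b : ℝ}
    (h : ∀ w ∈ uIoc a b, |avgDeriv α z w| ≤ C) :
    |avgSol α z b - avgSol α z a| ≤ C * |b - a| := by
  rw [← integral_avgDeriv]
  exact intervalIntegral.norm_integral_le_of_norm_le_const (f := avgDeriv α z) h

lemma abs_avgSol_sub_le (α z v w : ℝ) : |avgSol α z v - avgSol α z w| ≤ |v - w| := by
  simpa using abs_integral_avgDeriv_sub_le (C := 1) (a := w) (b := v)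
    fun w _ => abs_avgDeriv_le_one α z w

lemma continuous_avgSol (α z : ℝ) : Continuous (avgSol α z) := by
  have : LipschitzWith 1 (avgSol α z) := LipschitzWith.of_dist_le_mul fun v w => by
    simpa [Real.dist_eq] using abs_avgSol_sub_le α z v w
  exact this.continuous

lemma continuous_avgDeriv {α : ℝ} (hα : 0 < α) (z : ℝ) : Continuous (avgDeriv α z) := by
  have h : avgDeriv α z
      = fun w => w * avgSol α z w + (1 - ramp α (w - z) - avgCDF α z) :=
    funext fun w => avgDeriv_eq hα z w
  rw [h]
  have h1 := continuous_avgSol α z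
  have h2 := continuous_ramp α
  fun_prop

lemma avgSol_sub_eq_mul_integral (α z w y : ℝ) :
    avgSol α z w - avgSol α z (w - y) = y * ∫ u in (0 : ℝ)..1, avgDeriv α z (w - u * y) := by
  have h1 := intervalIntegral.smul_integral_comp_sub_mul (a := 0) (b := 1)
    (avgDeriv α z) y w
  simp only [mul_zero, sub_zero, mul_one, smul_eq_mul] at h1
  rw [← integral_avgDeriv, ← h1]
  simp_rw [mul_comm]

lemma avgDeriv_sub_eq {α : ℝ} (hα : 0 < α) (z v w : ℝ) :
    avgDeriv α z v - avgDeriv α z w = (v * avgSol α z v - w * avgSol α z w)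
      - (ramp α (v - z) - ramp α (w - z)) := by
  rw [avgDeriv_eq hα, avgDeriv_eq hα]
  ring

lemma abs_mul_avgSol_sub_le (α z v w : ℝ) :
    |v * avgSol α z v - w * avgSol α z w| ≤ |v - w| * (13 / 10 + |w|) := by
  have e : v * avgSol α z v - w * avgSol α z w
      = (v - w) * avgSol α z v + w * (avgSol α z v - avgSol α z w) := by ring
  rw [e]
  refine (abs_add_le _ _).trans ?_
  rw [abs_mul, abs_mul, mul_add]
  have h1 := mul_le_mul_of_nonneg_left (abs_avgSol_le α z v) (abs_nonneg (v - w))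
  have h2 := mul_le_mul_of_nonneg_left (abs_avgSol_sub_le α z v w) (abs_nonneg w)
  linarith

lemma abs_avgDeriv_sub_le {α : ℝ} (hα : 0 < α) (z v w : ℝ) :
    |avgDeriv α z v - avgDeriv α z w|
      ≤ |v - w| * (13 / 10 + |w|) + |ramp α (v - z) - ramp α (w - z)| := by
  rw [avgDeriv_sub_eq hα]
  exact (abs_sub _ _).trans (add_le_add_left (abs_mul_avgSol_sub_le α z v w) _)

lemma avgCDF_mem {α : ℝ} (hα : 0 < α) (z : ℝ) :
    avgCDF α z ∈ Icc (stdNormalCDF z) (stdNormalCDF (z + α)) := by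
  have hc : IntervalIntegrable (fun s => stdNormalCDF (z + s * α)) volume 0 1 :=
    (continuous_stdNormalCDF.comp (by fun_prop)).intervalIntegrable _ _
  constructor
  · have h := intervalIntegral.integral_mono_on (zero_le_one) (intervalIntegrable_const
      (c := stdNormalCDF z)) hc fun s hs => monotone_stdNormalCDF (by nlinarith [hs.1])
    simpa [avgCDF] using h
  · have h := intervalIntegral.integral_mono_on (zero_le_one) hc (intervalIntegrable_const
      (c := stdNormalCDF (z + α))) fun s hs => monotone_stdNormalCDF (by nlinarith [hs.2])
    simpa [avgCDF] using h

/-- The averaged solution and its derivative at a large level `z`: exponentially small in `z` up to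
an exponential weight in the argument. -/
lemma avgSol_avgDeriv_weighted {α z : ℝ} (hα : 0 < α) (hz : 2 ≤ z) (w : ℝ) :
    |avgSol α z w| ≤ 2 * Real.exp (-z / 4) * (1 + Real.exp (w / 2)) ∧
    |avgDeriv α z w| ≤ 2 * Real.exp (-z / 4) * (1 + Real.exp (w / 2)) := by
  have hE := Real.exp_pos (-z / 4)
  have hE2 := Real.exp_pos (w / 2)
  rcases le_total w (z / 2) with h | h
  · have key : ∀ s ∈ uIoc (0 : ℝ) 1, steinSol (z + s * α) w ≤ Real.exp (-z / 4) ∧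
        |steinDeriv (z + s * α) w| ≤ 2 * Real.exp (-z / 4) := by
      intro s hs
      rw [uIoc_of_le zero_le_one] at hs
      have hzs : z ≤ z + s * α := by nlinarith [hs.1]
      obtain ⟨h1, h2⟩ := steinSol_steinDeriv_small (hz.trans hzs) (w := w) (by linarith)
      have h3 : Real.exp (-(z + s * α) / 4) ≤ Real.exp (-z / 4) :=
        Real.exp_le_exp.2 (by linarith)
      exact ⟨h1.trans h3, h2.trans (by linarith)⟩
    have h1 := intervalIntegral.norm_integral_le_of_norm_le_const (a := 0) (b := 1)
      (f := fun s => steinSol (z + s * α) w) (C := Real.exp (-z / 4)) (fun s hs => by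
        rw [Real.norm_eq_abs, abs_of_nonneg (steinSol_nonneg _ _)]; exact (key s hs).1)
    have h2 := intervalIntegral.norm_integral_le_of_norm_le_const (a := 0) (b := 1)
      (f := fun s => steinDeriv (z + s * α) w) (C := 2 * Real.exp (-z / 4)) (fun s hs =>
        (key s hs).2)
    simp only [sub_zero, abs_one, mul_one, Real.norm_eq_abs] at h1 h2
    constructor
    · exact h1.trans (by nlinarith)
    · exact h2.trans (by nlinarith)
  · have hexp : 1 ≤ Real.exp (-z / 4) * Real.exp (w / 2) := by
      rw [← Real.exp_add]
      exact Real.one_le_exp (by linarith)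
    constructor
    · exact (abs_avgSol_le α z w).trans (by nlinarith)
    · exact (abs_avgDeriv_le_one α z w).trans (by nlinarith)

lemma one_add_abs_mul_exp_le (w : ℝ) :
    (1 + |w|) * (1 + 3 * Real.exp (w / 2)) ≤ 8 * (Real.exp w + Real.exp (-w)) := by
  have h1 : 1 + |w| ≤ 2 * Real.exp (|w| / 2) := by
    linarith [Real.add_one_le_exp (|w| / 2), abs_nonneg w]
  have h2 : Real.exp (w / 2) ≤ Real.exp (|w| / 2) :=
    Real.exp_le_exp.2 (by linarith [le_abs_self w])
  have h3 : 1 ≤ Real.exp (|w| / 2) := Real.one_le_exp (by positivity)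
  have h4 : Real.exp (|w| / 2) * Real.exp (|w| / 2) = Real.exp |w| := by
    rw [← Real.exp_add]; ring_nf
  have h5 : Real.exp |w| ≤ Real.exp w + Real.exp (-w) := by
    rcases abs_cases w with h | h <;> rw [h.1]
    · linarith [Real.exp_pos (-w)]
    · linarith [Real.exp_pos w]
  calc (1 + |w|) * (1 + 3 * Real.exp (w / 2))
      ≤ (2 * Real.exp (|w| / 2)) * (4 * Real.exp (|w| / 2)) := by
        apply mul_le_mul h1 _ (by positivity) (by positivity)
        linarith
    _ = 8 * Real.exp |w| := by rw [← h4]; ring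
    _ ≤ _ := by linarith

lemma abs_mul_avgSol_sub_le_weighted {α z : ℝ} (hα : 0 < α) (hz : 2 ≤ z) {v w : ℝ}
    (hvw : |v - w| ≤ 2) :
    |v * avgSol α z v - w * avgSol α z w|
      ≤ 16 * Real.exp (-z / 4) * (|v - w| * (Real.exp w + Real.exp (-w))) := by
  have hE := Real.exp_pos (-z / 4)
  have hbound : ∀ x, |x - w| ≤ 2 → 1 + Real.exp (x / 2) ≤ 1 + 3 * Real.exp (w / 2) := by
    intro x hx
    have h1 : Real.exp (x / 2) ≤ Real.exp (1 + w / 2) :=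
      Real.exp_le_exp.2 (by linarith [le_abs_self (x - w)])
    rw [Real.exp_add] at h1
    have := Real.exp_one_lt_d9
    nlinarith [Real.exp_pos (w / 2)]
  have h1 : |avgSol α z v - avgSol α z w|
      ≤ 2 * Real.exp (-z / 4) * (1 + 3 * Real.exp (w / 2)) * |v - w| := by
    apply abs_integral_avgDeriv_sub_le
    intro x hx
    refine (avgSol_avgDeriv_weighted hα hz x).2.trans ?_
    apply mul_le_mul_of_nonneg_left (hbound x _) (by positivity)
    have : x ∈ uIcc w v := uIoc_subset_uIcc hx
    exact (abs_sub_left_of_mem_uIcc this).trans hvw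
  have h2 : |avgSol α z v| ≤ 2 * Real.exp (-z / 4) * (1 + 3 * Real.exp (w / 2)) :=
    (avgSol_avgDeriv_weighted hα hz v).1.trans
      (mul_le_mul_of_nonneg_left (hbound v hvw) (by positivity))
  have e : v * avgSol α z v - w * avgSol α z w
      = (v - w) * avgSol α z v + w * (avgSol α z v - avgSol α z w) := by ring
  rw [e]
  refine (abs_add_le _ _).trans ?_
  rw [abs_mul, abs_mul]
  have h3 := mul_le_mul_of_nonneg_left h2 (abs_nonneg (v - w))
  have h4 := mul_le_mul_of_nonneg_left h1 (abs_nonneg w)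
  have h5 := mul_le_mul_of_nonneg_left (one_add_abs_mul_exp_le w)
    (by positivity : 0 ≤ 2 * Real.exp (-z / 4) * |v - w|)
  linarith

/-! ### Neighbourhoods in a graph of bounded degree -/

lemma two_le_card_of_maxDegree {V : Type*} [Fintype V] {G : SimpleGraph V} [DecidableRel G.Adj]
    (hD : 1 ≤ G.maxDegree) : 2 ≤ Fintype.card V := by
  have hne : Nonempty V := by
    by_contra h
    rw [not_nonempty_iff] at h
    have : G.maxDegree = 0 := by simp [SimpleGraph.maxDegree]
    omega
  obtain ⟨v, hv⟩ := G.exists_maximal_degree_vertex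
  have := G.degree_lt_card_verts v
  omega

section Graph

variable {V : Type*} [Fintype V] [DecidableEq V] (G : SimpleGraph V) [DecidableRel G.Adj]

/-- The closed neighbourhood of a set of vertices. -/
def closedNbhd (S : Finset V) : Finset V := S.biUnion fun i => insert i (G.neighborFinset i)

/-- The ball of radius `r` in the graph distance. -/
def nbhdBall (r : ℕ) (i : V) : Finset V := (closedNbhd G)^[r] {i}

variable {G}

lemma mem_closedNbhd {S : Finset V} {j : V} :
    j ∈ closedNbhd G S ↔ ∃ i ∈ S, j = i ∨ G.Adj i j := by
  simp [closedNbhd]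

lemma subset_closedNbhd (S : Finset V) : S ⊆ closedNbhd G S := fun i hi =>
  mem_closedNbhd.2 ⟨i, hi, Or.inl rfl⟩

lemma closedNbhd_mono {S T : Finset V} (h : S ⊆ T) : closedNbhd G S ⊆ closedNbhd G T :=
  Finset.biUnion_subset_biUnion_of_subset_left _ h

lemma disjoint_closedNbhd_comm {S T : Finset V} :
    Disjoint (closedNbhd G S) T ↔ Disjoint S (closedNbhd G T) := by
  simp only [Finset.disjoint_left, mem_closedNbhd]
  constructor
  · rintro h i hi ⟨j, hj, hij⟩
    refine h ⟨i, hi, ?_⟩ hj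
    rcases hij with hij | hij
    · exact Or.inl hij.symm
    · exact Or.inr hij.symm
  · rintro h j ⟨i, hi, hij⟩ hj
    refine h hi ⟨j, hj, ?_⟩
    rcases hij with hij | hij
    · exact Or.inl hij.symm
    · exact Or.inr hij.symm

lemma nbhdBall_zero (i : V) : nbhdBall G 0 i = {i} := rfl

lemma nbhdBall_succ (r : ℕ) (i : V) : nbhdBall G (r + 1) i = closedNbhd G (nbhdBall G r i) :=
  Function.iterate_succ_apply' _ _ _

lemma nbhdBall_subset_succ (r : ℕ) (i : V) : nbhdBall G r i ⊆ nbhdBall G (r + 1) i := by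
  rw [nbhdBall_succ]
  exact subset_closedNbhd _

lemma nbhdBall_mono {r s : ℕ} (h : r ≤ s) (i : V) : nbhdBall G r i ⊆ nbhdBall G s i :=
  monotone_nat_of_le_succ (f := fun r => nbhdBall G r i) (fun r => nbhdBall_subset_succ r i) h

lemma mem_nbhdBall_self (r : ℕ) (i : V) : i ∈ nbhdBall G r i :=
  nbhdBall_mono (Nat.zero_le r) i (by simp [nbhdBall_zero])

lemma disjoint_iterate_closedNbhd_comm (r : ℕ) (S T : Finset V) :
    Disjoint ((closedNbhd G)^[r] S) T ↔ Disjoint S ((closedNbhd G)^[r] T) := by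
  induction r generalizing S T with
  | zero => rfl
  | succ r ih =>
    rw [Function.iterate_succ_apply, ih, disjoint_closedNbhd_comm, Function.iterate_succ_apply']

lemma mem_nbhdBall_comm {r : ℕ} {i j : V} : j ∈ nbhdBall G r i ↔ i ∈ nbhdBall G r j := by
  have h := disjoint_iterate_closedNbhd_comm (G := G) r {i} {j}
  rw [Finset.disjoint_singleton_right, Finset.disjoint_singleton_left] at h
  exact not_iff_not.1 h

/-- Two balls around `i` and `j` are disjoint unless the distance of `i` and `j` is at most the sum
of the radii. -/
lemma disjoint_nbhdBall {r s t : ℕ} (hrs : r + s ≤ t) {i j : V} (h : j ∉ nbhdBall G t i) :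
    Disjoint (nbhdBall G r i) (nbhdBall G s j) := by
  have h1 : j ∉ nbhdBall G (s + r) i := fun h' => h (nbhdBall_mono (by omega) i h')
  rw [nbhdBall, nbhdBall, ← disjoint_iterate_closedNbhd_comm, ← Function.iterate_add_apply,
    Finset.disjoint_singleton_right]
  exact h1

lemma card_nbhdBall_one_le (hD : 1 ≤ G.maxDegree) (i : V) :
    (nbhdBall G 1 i).card ≤ 2 * G.maxDegree := by
  rw [nbhdBall_succ, nbhdBall_zero, closedNbhd, Finset.singleton_biUnion]
  refine (Finset.card_insert_le _ _).trans ?_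
  rw [G.card_neighborFinset_eq_degree]
  have := G.degree_le_maxDegree i
  omega

/-- From radius one on, a ball grows at most by the factor `maxDegree` when its radius grows by
one: apart from isolated vertices, each vertex of the larger ball has a neighbour in the smaller
one. -/
lemma card_closedNbhd_closedNbhd_le (hD : 1 ≤ G.maxDegree) (S : Finset V) :
    (closedNbhd G (closedNbhd G S)).card ≤ (closedNbhd G S).card * G.maxDegree := by
  have hsub : closedNbhd G (closedNbhd G S) ⊆ (closedNbhd G S).biUnion
      fun j => if G.degree j = 0 then {j} else G.neighborFinset j := by
    intro x hx
    rw [Finset.mem_biUnion]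
    have hadj : ∀ j ∈ closedNbhd G S, G.Adj j x → ∃ a ∈ closedNbhd G S,
        x ∈ if G.degree a = 0 then {a} else G.neighborFinset a := by
      intro j hj hjx
      have : G.degree j ≠ 0 := ((G.degree_pos_iff_exists_adj j).2 ⟨x, hjx⟩).ne'
      exact ⟨j, hj, by simpa [this] using hjx⟩
    obtain ⟨j, hj, rfl | hjx⟩ := mem_closedNbhd.1 hx
    · by_cases h0 : G.degree x = 0
      · exact ⟨x, hj, by simp [h0]⟩
      · obtain ⟨i, hi, rfl | hix⟩ := mem_closedNbhd.1 hj
        · obtain ⟨y, hy⟩ := (G.degree_pos_iff_exists_adj x).1 (Nat.pos_of_ne_zero h0)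
          exact hadj y (mem_closedNbhd.2 ⟨x, hi, Or.inr hy⟩) hy.symm
        · exact hadj i (subset_closedNbhd _ hi) hix
    · exact hadj j hj hjx
  refine (Finset.card_le_card hsub).trans (Finset.card_biUnion_le_card_mul _ _ _ ?_)
  intro j _
  split_ifs
  · simpa using hD
  · rw [G.card_neighborFinset_eq_degree]
    exact G.degree_le_maxDegree j

lemma card_nbhdBall_le (hD : 1 ≤ G.maxDegree) (r : ℕ) (i : V) :
    (nbhdBall G (r + 1) i).card ≤ 2 * G.maxDegree ^ (r + 1) := by
  induction r with
  | zero => simpa using card_nbhdBall_one_le hD i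
  | succ r ih =>
    rw [nbhdBall_succ, nbhdBall_succ]
    refine (card_closedNbhd_closedNbhd_le hD _).trans ?_
    rw [← nbhdBall_succ]
    calc _ ≤ 2 * G.maxDegree ^ (r + 1) * G.maxDegree := Nat.mul_le_mul_right _ ih
      _ = _ := by ring

lemma card_nbhdBall_le_real (hD : 1 ≤ G.maxDegree) (r : ℕ) (i : V) :
    ((nbhdBall G (r + 1) i).card : ℝ) ≤ 2 * (G.maxDegree : ℝ) ^ (r + 1) := by
  exact_mod_cast card_nbhdBall_le hD r i

end Graph

/-! ### Laws with a dependency graph -/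

/-- Exchange of integrals with a bound: nonnegative functions `f t` whose integrals are at most
`g t` can be integrated in `t`. -/
lemma integral_intervalIntegral_le {Ω : Type*} [MeasurableSpace Ω] {Q : Measure Ω} [SFinite Q]
    {f : ℝ → Ω → ℝ} {g : ℝ → ℝ} {a b : ℝ} (hab : a ≤ b)
    (hf : Measurable (Function.uncurry f)) (h0 : ∀ t ω, 0 ≤ f t ω)
    (hi : ∀ t ∈ Icc a b, Integrable (f t) Q) (hg : IntervalIntegrable g volume a b)
    (hle : ∀ t ∈ Icc a b, ∫ ω, f t ω ∂Q ≤ g t) :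
    Integrable (fun ω => ∫ t in a..b, f t ω) Q ∧
      ∫ ω, (∫ t in a..b, f t ω) ∂Q ≤ ∫ t in a..b, g t := by
  have hmI : StronglyMeasurable fun t => ∫ ω, f t ω ∂Q :=
    hf.stronglyMeasurable.integral_prod_right
  have hI : IntegrableOn (fun t => ∫ ω, f t ω ∂Q) (Ioc a b) := by
    refine ((intervalIntegrable_iff_integrableOn_Ioc_of_le hab).1 hg).mono'
      hmI.aestronglyMeasurable ?_
    refine (ae_restrict_iff' measurableSet_Ioc).2 (ae_of_all _ fun t ht => ?_)
    rw [Real.norm_of_nonneg (integral_nonneg (h0 t))]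
    exact hle t (Ioc_subset_Icc_self ht)
  have hprod : Integrable (Function.uncurry f) ((volume.restrict (Ioc a b)).prod Q) := by
    rw [integrable_prod_iff hf.aestronglyMeasurable]
    refine ⟨(ae_restrict_iff' measurableSet_Ioc).2
      (ae_of_all _ fun t ht => hi t (Ioc_subset_Icc_self ht)), ?_⟩
    refine hI.congr (ae_of_all _ fun t => ?_)
    exact integral_congr_ae (ae_of_all _ fun ω => (Real.norm_of_nonneg (h0 t ω)).symm)
  simp_rw [intervalIntegral.integral_of_le hab]
  refine ⟨hprod.integral_prod_right, ?_⟩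
  rw [← integral_integral_swap hprod]
  refine setIntegral_mono_on hI ((intervalIntegrable_iff_integrableOn_Ioc_of_le hab).1 hg)
    measurableSet_Ioc fun t ht => hle t (Ioc_subset_Icc_self ht)

section Coord

variable {V : Type*}

lemma dependsOn_coord {S : Finset V} {i : V} (hi : i ∈ S) :
    DependsOn (fun x : V → ℝ => x i) (S : Set V) := fun _ _ h => h i hi

/-- The sum of the coordinates over a set of vertices. -/
def coordSum (S : Finset V) (x : V → ℝ) : ℝ := ∑ k ∈ S, x k

@[fun_prop]
lemma measurable_coordSum (S : Finset V) : Measurable (coordSum S) :=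
  Finset.measurable_fun_sum S fun i _ => measurable_pi_apply i

lemma dependsOn_coordSum {S T : Finset V} (h : S ⊆ T) :
    DependsOn (coordSum S) (T : Set V) := fun _ _ hxy =>
  Finset.sum_congr rfl fun i hi => hxy i (h hi)

lemma coordSum_sdiff [DecidableEq V] {S T : Finset V} (h : S ⊆ T) (x : V → ℝ) :
    coordSum (T \ S) x = coordSum T x - coordSum S x :=
  eq_sub_of_add_eq (Finset.sum_sdiff h)

lemma abs_coordSum_le (S : Finset V) (x : V → ℝ) : |coordSum S x| ≤ ∑ k ∈ S, |x k| :=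
  Finset.abs_sum_le_sum_abs _ _

end Coord

section Law

variable {V : Type*} [Fintype V] [DecidableEq V] {G : SimpleGraph V} [DecidableRel G.Adj]
  {μ : Measure (V → ℝ)}

lemma DependsOn.exists_measurable_comp {S : Finset V} {f : (V → ℝ) → ℝ} (hf : Measurable f)
    (hS : DependsOn f (S : Set V)) :
    ∃ g : (↥(S : Set V) → ℝ) → ℝ, Measurable g ∧ f = fun x => g fun i => x i := by
  refine ⟨fun y => f fun i => if h : i ∈ (S : Set V) then y ⟨i, h⟩ else 0, ?_, ?_⟩
  · refine hf.comp (measurable_pi_lambda _ fun i => ?_)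
    by_cases h : i ∈ (S : Set V)
    · simpa only [h, dif_pos] using measurable_pi_apply _
    · simpa only [h, dif_neg, not_false_eq_true] using measurable_const
  · funext x
    apply hS
    intro i hi
    simp only [hi, dif_pos]

lemma IsDependencyGraph.indepFun (h : IsDependencyGraph G (fun i (x : V → ℝ) => x i) μ)
    {S T : Finset V} (hST : Disjoint (closedNbhd G S) T) {f g : (V → ℝ) → ℝ}
    (hf : Measurable f) (hg : Measurable g)
    (hfS : DependsOn f (S : Set V)) (hgT : DependsOn g (T : Set V)) : IndepFun f g μ := by
  obtain ⟨f', hf', rfl⟩ := hfS.exists_measurable_comp hf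
  obtain ⟨g', hg', rfl⟩ := hgT.exists_measurable_comp hg
  have h1 := h S T ?_ ?_
  · exact h1.comp hf' hg'
  · rw [Finset.disjoint_coe]
    exact hST.mono_left (subset_closedNbhd S)
  · intro i hi j hj hij
    exact Finset.disjoint_left.1 hST (mem_closedNbhd.2 ⟨i, hi, Or.inr hij⟩) hj

/-- The standing assumptions on a law on `V → ℝ`: the coordinates have the dependency graph `G`,
and their absolute moments of order `2 + q`, with `0 < q ≤ 1`, are at most `θ ^ (2 + q)`. -/
structure LocalLaw (G : SimpleGraph V) [DecidableRel G.Adj] (μ : Measure (V → ℝ)) (q θ : ℝ) :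
    Prop where
  dep : IsDependencyGraph G (fun i (x : V → ℝ) => x i) μ
  one_le_maxDegree : 1 ≤ G.maxDegree
  q_pos : 0 < q
  q_le_one : q ≤ 1
  theta_pos : 0 < θ
  integrable_moment : ∀ i, Integrable (fun x : V → ℝ => |x i| ^ (2 + q)) μ
  moment_le : ∀ i, ∫ x, |x i| ^ (2 + q) ∂μ ≤ θ ^ (2 + q)

end Law

lemma rpow_mul_rpow_mul_rpow_le {p u v w a b c : ℝ} (hp : 0 < p) (hu : 0 ≤ u) (hv : 0 ≤ v)
    (hw : 0 ≤ w) (ha : 0 ≤ a) (hb : 0 ≤ b) (hc : 0 ≤ c) (habc : a + b + c ≤ p) :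
    u ^ a * v ^ b * w ^ c ≤ a / p * u ^ p + b / p * v ^ p + c / p * w ^ p
      + (1 - (a + b + c) / p) := by
  have h := Real.geom_mean_le_arith_mean4_weighted (w₁ := a / p) (w₂ := b / p) (w₃ := c / p)
    (w₄ := 1 - (a + b + c) / p) (p₁ := u ^ p) (p₂ := v ^ p) (p₃ := w ^ p) (p₄ := 1)
    (by positivity) (by positivity) (by positivity)
    (sub_nonneg.2 ((div_le_one hp).2 habc)) (by positivity) (by positivity) (by positivity)
    zero_le_one (by field_simp; ring)
  rw [← Real.rpow_mul hu, ← Real.rpow_mul hv, ← Real.rpow_mul hw, Real.one_rpow, mul_one, mul_one,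
    mul_div_cancel₀ _ hp.ne', mul_div_cancel₀ _ hp.ne', mul_div_cancel₀ _ hp.ne'] at h
  exact h

lemma abs_sum_mul_rpow_le {ι : Type*} (S : Finset ι) (c x : ι → ℝ) {q : ℝ} (hq : 0 < q)
    (hq1 : q ≤ 1) (hc : ∀ k ∈ S, |c k| ≤ 1) :
    |∑ k ∈ S, c k * x k| ^ q ≤ ∑ k ∈ S, |x k| ^ q := by
  classical
  induction S using Finset.induction_on with
  | empty => simp [Real.zero_rpow hq.ne']
  | insert k S hk ih =>
    rw [Finset.sum_insert hk, Finset.sum_insert hk]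
    have h1 : |c k * x k| ≤ |x k| := by
      rw [abs_mul]
      exact mul_le_of_le_one_left (abs_nonneg _) (hc k (Finset.mem_insert_self k S))
    calc _ ≤ (|c k * x k| + |∑ j ∈ S, c j * x j|) ^ q :=
          Real.rpow_le_rpow (abs_nonneg _) (abs_add_le _ _) hq.le
      _ ≤ |c k * x k| ^ q + |∑ j ∈ S, c j * x j| ^ q :=
          Real.rpow_add_le_add_rpow (abs_nonneg _) (abs_nonneg _) hq.le hq1
      _ ≤ _ := by
          gcongr
          exact ih fun j hj => hc j (Finset.mem_insert_of_mem hj)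

namespace LocalLaw

variable {V : Type*} [Fintype V] [DecidableEq V] {G : SimpleGraph V} [DecidableRel G.Adj]
  {μ : Measure (V → ℝ)} [IsProbabilityMeasure μ] {q θ : ℝ}

lemma moment_mul (h : LocalLaw G μ q θ) {a b c : ℝ} (ha : 0 ≤ a) (hb : 0 ≤ b) (hc : 0 ≤ c)
    (habc : a + b + c ≤ 2 + q) (i j k : V) :
    Integrable (fun x => |x i| ^ a * |x j| ^ b * |x k| ^ c) μ ∧
      ∫ x, |x i| ^ a * |x j| ^ b * |x k| ^ c ∂μ ≤ θ ^ (a + b + c) := by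
  have hp : 0 < 2 + q := by linarith [h.q_pos]
  have hθ := h.theta_pos
  have hθp : 0 < θ ^ (2 + q) := Real.rpow_pos_of_pos hθ _
  set p := 2 + q with hpdef
  set g : (V → ℝ) → ℝ := fun x => θ ^ (a + b + c) * (a / p * ((θ ^ p)⁻¹ * |x i| ^ p)
    + b / p * ((θ ^ p)⁻¹ * |x j| ^ p) + c / p * ((θ ^ p)⁻¹ * |x k| ^ p)
    + (1 - (a + b + c) / p)) with hg
  have hgi : Integrable g μ := by
    have h1 := fun i => (h.integrable_moment i).const_mul (θ ^ p)⁻¹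
    exact (((((h1 i).const_mul _).add ((h1 j).const_mul _)).add ((h1 k).const_mul _)).add
      (integrable_const _)).const_mul _
  have hle : ∀ x, |x i| ^ a * |x j| ^ b * |x k| ^ c ≤ g x := by
    intro x
    have h1 := rpow_mul_rpow_mul_rpow_le (p := p) (u := |x i| / θ) (v := |x j| / θ)
      (w := |x k| / θ) hp (by positivity) (by positivity) (by positivity) ha hb hc habc
    simp only [Real.div_rpow (abs_nonneg _) hθ.le] at h1
    have h2 : |x i| ^ a * |x j| ^ b * |x k| ^ c = θ ^ (a + b + c) *
        (|x i| ^ a / θ ^ a * (|x j| ^ b / θ ^ b) * (|x k| ^ c / θ ^ c)) := by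
      rw [Real.rpow_add hθ, Real.rpow_add hθ]
      have := (Real.rpow_pos_of_pos hθ a).ne'
      have := (Real.rpow_pos_of_pos hθ b).ne'
      have := (Real.rpow_pos_of_pos hθ c).ne'
      field_simp
    rw [h2, hg]
    apply mul_le_mul_of_nonneg_left _ (Real.rpow_nonneg hθ.le _)
    simpa only [div_eq_inv_mul _ (θ ^ p)] using h1
  have hint : Integrable (fun x => |x i| ^ a * |x j| ^ b * |x k| ^ c) μ := by
    refine hgi.mono' (Measurable.aestronglyMeasurable (by fun_prop)) (ae_of_all _ fun x => ?_)
    rw [Real.norm_of_nonneg (by positivity)]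
    exact hle x
  refine ⟨hint, (integral_mono hint hgi hle).trans ?_⟩
  have hm : ∀ i, (θ ^ p)⁻¹ * ∫ x, |x i| ^ p ∂μ ≤ 1 := fun i => by
    rw [inv_mul_le_iff₀ hθp, mul_one]
    exact h.moment_le i
  have h1 := fun i => (h.integrable_moment i).const_mul (θ ^ p)⁻¹
  simp only [hg]
  rw [integral_const_mul, integral_add, integral_add, integral_add, integral_const_mul,
    integral_const_mul, integral_const_mul, integral_const_mul, integral_const_mul,
    integral_const_mul, integral_const, probReal_univ, one_smul]
  · have h2 := mul_le_mul_of_nonneg_left (hm i) (by positivity : 0 ≤ a / p)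
    have h3 := mul_le_mul_of_nonneg_left (hm j) (by positivity : 0 ≤ b / p)
    have h4 := mul_le_mul_of_nonneg_left (hm k) (by positivity : 0 ≤ c / p)
    have h5 : a / p + b / p + c / p = (a + b + c) / p := by ring
    refine mul_le_of_le_one_right (Real.rpow_nonneg hθ.le _) ?_
    linarith
  · exact (h1 i).const_mul _
  · exact (h1 j).const_mul _
  · exact ((h1 i).const_mul _).add ((h1 j).const_mul _)
  · exact (h1 k).const_mul _
  · exact (((h1 i).const_mul _).add ((h1 j).const_mul _)).add ((h1 k).const_mul _)
  · exact integrable_const _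

end LocalLaw

/-! ### A concentration inequality -/

/-- If, for every upper bound `M` of a family of numbers, `A + c * M` bounds `k` times the family
and `c ≤ k`, then `k - c` times the family is bounded by `A`. -/
lemma sub_mul_le_of_forall_upperBound {S : Set ℝ} (hS : BddAbove S) {k c A : ℝ}
    (hc : c ≤ k) (hk : 0 ≤ k) (h : ∀ M, (∀ x ∈ S, x ≤ M) → ∀ x ∈ S, k * x ≤ A + c * M) :
    ∀ x ∈ S, (k - c) * x ≤ A := by
  intro x hx
  have hne : S.Nonempty := ⟨x, hx⟩
  have h1 : ∀ y ∈ S, k * y ≤ A + c * sSup S := h (sSup S) fun y hy => le_csSup hS hy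
  have h2 : k * sSup S ≤ A + c * sSup S := by
    rcases hk.eq_or_lt with h0 | h0
    · have := h1 x hx
      rw [← h0] at this ⊢
      simpa using this
    · rw [← le_div_iff₀' h0]
      exact csSup_le hne fun y hy => (le_div_iff₀' h0).2 (h1 y hy)
  have h3 : (k - c) * x ≤ (k - c) * sSup S :=
    mul_le_mul_of_nonneg_left (le_csSup hS hx) (sub_nonneg.2 hc)
  linarith

lemma intervalIntegrable_integral {Ω : Type*} [MeasurableSpace Ω] {Q : Measure Ω} [SFinite Q]
    {f : ℝ → Ω → ℝ} (hf : Measurable (Function.uncurry f)) {H : Ω → ℝ} (hH : Integrable H Q)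
    (hb : ∀ t ω, |f t ω| ≤ H ω) (a b : ℝ) :
    IntervalIntegrable (fun t => ∫ ω, f t ω ∂Q) volume a b := by
  apply intervalIntegrable_of_bdd (C := ∫ ω, H ω ∂Q)
  · exact (hf.stronglyMeasurable.integral_prod_right).measurable
  · intro t
    exact norm_integral_le_of_norm_le (f := f t) hH (ae_of_all _ fun ω => hb t ω)

/-- The random kernel `t ↦ ∑ j ∈ J, X j * k(Y j, t)` of the local Stein identity. -/
noncomputable def randomKernel {Ω ι : Type*} (J : Finset ι) (X Y : ι → Ω → ℝ) (t : ℝ) (ω : Ω) : ℝ :=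
  ∑ j ∈ J, X j ω * steinKernel (Y j ω) t

lemma measurable_uncurry_randomKernel {Ω ι : Type*} [MeasurableSpace Ω] (J : Finset ι)
    {X Y : ι → Ω → ℝ} (hX : ∀ j, Measurable (X j)) (hY : ∀ j, Measurable (Y j)) :
    Measurable (Function.uncurry (randomKernel J X Y)) := by
  apply Finset.measurable_fun_sum
  intro j _
  exact ((hX j).comp measurable_snd).mul
    (measurable_uncurry_steinKernel.comp (((hY j).comp measurable_snd).prodMk measurable_fst))

lemma abs_randomKernel_le {Ω ι : Type*} (J : Finset ι) (X Y : ι → Ω → ℝ) (t : ℝ) (ω : Ω) :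
    |randomKernel J X Y t ω| ≤ ∑ j ∈ J, |X j ω| := by
  refine (Finset.abs_sum_le_sum_abs _ _).trans (Finset.sum_le_sum fun j _ => ?_)
  rw [abs_mul]
  exact mul_le_of_le_one_right (abs_nonneg _) (abs_steinKernel_le_one _ _)

lemma abs_plateau_add_sub_le {α : ℝ} (hα : 0 < α) (v t : ℝ) :
    |plateau α (v + t) - plateau α v| ≤ |t| / α *
      ((∫ r in (0 : ℝ)..1, window α (v + α + r * t))
        + ∫ r in (0 : ℝ)..1, window α (v - α + r * t)) := by
  have e : plateau α (v + t) - plateau α v = (ramp α (v + α + t) - ramp α (v + α))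
      - (ramp α (v - α + t) - ramp α (v - α)) := by
    simp only [plateau]
    rw [show v + t + α = v + α + t by ring, show v + t - α = v - α + t by ring]
    ring
  rw [e, mul_add, ← abs_ramp_add_sub hα, ← abs_ramp_add_sub hα]
  exact abs_sub _ _

lemma integral_plateau_sq_le {α : ℝ} (hα : 0 < α) (v : ℝ) :
    ∫ t in (-1 : ℝ)..1, (Icc (-α) (2 * α)).indicator (fun _ => (1 : ℝ)) (v + t) ≤ 3 * α := by
  rw [intervalIntegral.integral_of_le (by norm_num)]
  have e : ∀ t, (Icc (-α) (2 * α)).indicator (fun _ => (1 : ℝ)) (v + t)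
      = (Icc (-α - v) (2 * α - v)).indicator (fun _ => (1 : ℝ)) t := by
    intro t
    have : v + t ∈ Icc (-α) (2 * α) ↔ t ∈ Icc (-α - v) (2 * α - v) := by
      simp only [mem_Icc]
      constructor <;> rintro ⟨h1, h2⟩ <;> constructor <;> linarith
    simp only [indicator, this]
  simp_rw [e]
  rw [setIntegral_indicator measurableSet_Icc, setIntegral_const, smul_eq_mul, mul_one]
  calc volume.real (Ioc (-1 : ℝ) 1 ∩ Icc (-α - v) (2 * α - v))
      ≤ volume.real (Icc (-α - v) (2 * α - v)) :=
        measureReal_mono inter_subset_right (by simp)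
    _ = 3 * α := by
        rw [Real.volume_real_Icc_of_le (by linarith)]
        ring

/-- The pathwise inequality behind the concentration inequality. The third and the fourth term of
the bound come from `x y ≥ -(x² / 8 + 2 y²)`, applied to the fluctuation of the random kernel; the
fifth is the price of cutting the kernel off at `|t| ≤ 1`. -/
lemma pathwise_concentration {Ω ι : Type*} (J : Finset ι) (X Y : ι → Ω → ℝ)
    {α : ℝ} (hα : 0 < α) (hα1 : α ≤ 1) {lam : ℝ} (hlam : 0 ≤ lam) {K : ℝ → ℝ}
    (hKm : Measurable K) {CK : ℝ} (hKb : ∀ t, |K t| ≤ CK) (w a : ℝ) (ω : Ω) :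
    Real.exp (lam * a) * plateau α (w - a) * (∫ t in (-1 : ℝ)..1, K t)
      ≤ Real.exp (lam * a) * (∑ j ∈ J, X j ω *
          (plateauInt α (w - a) - plateauInt α (w - a - Y j ω)))
        + (∫ t in (-1 : ℝ)..1,
            |K t| * (Real.exp (lam * a) * |plateau α (w - a + t) - plateau α (w - a)|))
        + 3 / 8 * α * Real.exp (4 * lam) * Real.exp (2 * lam * w)
        + 2 * (∫ t in (-1 : ℝ)..1, (randomKernel J X Y t ω - K t) ^ 2)
        + Real.exp (lam * a) * ∑ j ∈ J, |X j ω| * max (|Y j ω| - 1) 0 := by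
  set v := w - a with hv
  set e := Real.exp (lam * a) with he
  have hepos : 0 < e := Real.exp_pos _
  have hkm : ∀ y, Measurable (steinKernel y) := fun y =>
    measurable_uncurry_steinKernel.comp measurable_prodMk_left
  have hψc : Continuous fun t => plateau α (v + t) :=
    (continuous_plateau α).comp (continuous_const.add continuous_id)
  have hψb : ∀ x, |plateau α x| ≤ 1 := fun x => by
    rw [abs_of_nonneg (plateau_nonneg hα x)]; exact plateau_le_one α x
  have hκm : Measurable fun t => randomKernel J X Y t ω := by
    unfold randomKernel
    exact Finset.measurable_fun_sum _ fun j _ => (hkm _).const_mul _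
  have hCK : 0 ≤ CK := (abs_nonneg _).trans (hKb 0)
  have hdm : Measurable fun t => randomKernel J X Y t ω - K t := hκm.sub hKm
  have hdb : ∀ t, |randomKernel J X Y t ω - K t| ≤ (∑ j ∈ J, |X j ω|) + CK := fun t =>
    (abs_sub _ _).trans (add_le_add (abs_randomKernel_le _ _ _ _ _) (hKb t))
  have iK : IntervalIntegrable K volume (-1) 1 := intervalIntegrable_of_bdd hKm hKb _ _
  have bmul : ∀ {f g : ℝ → ℝ} {A B : ℝ}, (∀ t, |f t| ≤ A) → (∀ t, |g t| ≤ B) →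
      ∀ t, |f t * g t| ≤ A * B := fun hf hg t => by
    rw [abs_mul]; exact mul_le_mul (hf t) (hg t) (abs_nonneg _) ((abs_nonneg _).trans (hf t))
  -- the local Stein identity, with the kernel cut off at `|t| ≤ 1`
  have h1 : (∫ t in (-1 : ℝ)..1, randomKernel J X Y t ω * plateau α (v + t))
      ≤ (∑ j ∈ J, X j ω * (plateauInt α v - plateauInt α (v - Y j ω)))
        + ∑ j ∈ J, |X j ω| * max (|Y j ω| - 1) 0 := by
    have e1 : (∫ t in (-1 : ℝ)..1, randomKernel J X Y t ω * plateau α (v + t))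
        = ∑ j ∈ J, X j ω * ∫ t in (-1 : ℝ)..1, steinKernel (Y j ω) t * plateau α (v + t) := by
      simp_rw [randomKernel, Finset.sum_mul, mul_assoc]
      rw [intervalIntegral.integral_finsetSum]
      · simp_rw [intervalIntegral.integral_const_mul]
      · intro j _
        exact (intervalIntegrable_of_bdd ((hkm _).mul hψc.measurable)
          (bmul (abs_steinKernel_le_one _) fun t => hψb _) _ _).const_mul _
    rw [e1, ← Finset.sum_add_distrib]
    refine Finset.sum_le_sum fun j _ => ?_
    have e2 : plateauInt α v - plateauInt α (v - Y j ω)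
        = ∫ t in (-(Y j ω))..0, plateau α (v + t) := by
      rw [intervalIntegral.integral_comp_add_left (fun t => plateau α t), integral_plateau]
      rw [add_zero, sub_eq_add_neg v]
    rw [e2]
    have h2 := abs_integral_sub_steinKernel_le hψc (fun t => hψb _) (Y j ω)
    set A := ∫ t in (-(Y j ω))..0, plateau α (v + t)
    set B := ∫ t in (-1 : ℝ)..1, steinKernel (Y j ω) t * plateau α (v + t)
    have h3 : X j ω * (B - A) ≤ |X j ω| * max (|Y j ω| - 1) 0 := by
      refine (le_abs_self _).trans ?_
      rw [abs_mul, abs_sub_comm]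
      exact mul_le_mul_of_nonneg_left h2 (abs_nonneg _)
    linarith
  have h2 : e * (∫ t in (-1 : ℝ)..1, plateau α v * K t)
      ≤ e * (∫ t in (-1 : ℝ)..1, randomKernel J X Y t ω * plateau α (v + t))
        + (∫ t in (-1 : ℝ)..1, |K t| * (e * |plateau α (v + t) - plateau α v|))
        + (∫ t in (-1 : ℝ)..1, 1 / 8 * (Real.exp (4 * lam) * Real.exp (2 * lam * w))
            * (Icc (-α) (2 * α)).indicator (fun _ => (1 : ℝ)) (v + t))
        + ∫ t in (-1 : ℝ)..1, 2 * (randomKernel J X Y t ω - K t) ^ 2 := by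
    have i1 : IntervalIntegrable (fun t => e * (randomKernel J X Y t ω * plateau α (v + t)))
        volume (-1) 1 :=
      (intervalIntegrable_of_bdd (hκm.mul hψc.measurable)
        (bmul (fun t => abs_randomKernel_le J X Y t ω) fun t => hψb _) _ _).const_mul _
    have i2 : IntervalIntegrable (fun t => |K t| * (e * |plateau α (v + t) - plateau α v|))
        volume (-1) 1 := by
      apply intervalIntegrable_of_bdd (C := CK * (e * 2))
      · exact hKm.abs.mul ((hψc.measurable.sub_const _).abs.const_mul _)
      · apply bmul (fun t => by rw [abs_abs]; exact hKb t)
        intro t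
        rw [abs_mul, abs_abs, abs_of_pos hepos]
        gcongr
        refine (abs_sub _ _).trans ?_
        linarith [hψb (v + t), hψb v]
    have i3 : IntervalIntegrable (fun t => 1 / 8 * (Real.exp (4 * lam) * Real.exp (2 * lam * w))
            * (Icc (-α) (2 * α)).indicator (fun _ => (1 : ℝ)) (v + t)) volume (-1) 1 := by
      refine (intervalIntegrable_of_bdd (C := 1) ?_ ?_ _ _).const_mul _
      · exact (measurable_const.indicator measurableSet_Icc).comp (measurable_const_add v)
      · intro t
        by_cases ht : v + t ∈ Icc (-α) (2 * α) <;> simp only [indicator, ht] <;> norm_num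
    have i4 : IntervalIntegrable (fun t => 2 * (randomKernel J X Y t ω - K t) ^ 2)
        volume (-1) 1 := by
      simp_rw [sq]
      exact (intervalIntegrable_of_bdd (hdm.mul hdm) (bmul hdb hdb) _ _).const_mul _
    rw [← intervalIntegral.integral_const_mul, ← intervalIntegral.integral_const_mul,
      ← intervalIntegral.integral_add i1 i2, ← intervalIntegral.integral_add (i1.add i2) i3,
      ← intervalIntegral.integral_add ((i1.add i2).add i3) i4]
    refine intervalIntegral.integral_mono_on (by norm_num) ((iK.const_mul _).const_mul _)
      (((i1.add i2).add i3).add i4) fun t ht => ?_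
    set d := randomKernel J X Y t ω - K t with hd
    have hκ : randomKernel J X Y t ω = K t + d := by rw [hd]; ring
    have s1 : e * (K t * (plateau α v - plateau α (v + t)))
        ≤ |K t| * (e * |plateau α (v + t) - plateau α v|) := by
      refine (le_abs_self _).trans ?_
      rw [abs_mul, abs_mul, abs_of_pos hepos, abs_sub_comm (plateau α v)]
      exact le_of_eq (by ring)
    have s2 : (e * plateau α (v + t)) ^ 2 ≤ Real.exp (4 * lam) * Real.exp (2 * lam * w)
        * (Icc (-α) (2 * α)).indicator (fun _ => (1 : ℝ)) (v + t) := by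
      by_cases hm : v + t ∈ Icc (-α) (2 * α)
      · rw [indicator_of_mem hm, mul_one, mul_pow, he, ← Real.exp_nat_mul, ← Real.exp_add]
        have h3 : Real.exp (((2 : ℕ) : ℝ) * (lam * a)) ≤ Real.exp (4 * lam + 2 * lam * w) := by
          apply Real.exp_le_exp.2
          have h4 : a ≤ w + 2 := by linarith [hm.1, ht.2]
          push_cast
          nlinarith
        have h5 : plateau α (v + t) ^ 2 ≤ 1 :=
          pow_le_one₀ (plateau_nonneg hα _) (plateau_le_one _ _)
        exact (mul_le_of_le_one_right (Real.exp_pos _).le h5).trans h3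
      · rw [plateau_eq_zero hα hm, indicator_of_notMem hm]
        simp
    have s3 : 0 ≤ (e * plateau α (v + t)) ^ 2 / 8 + (e * plateau α (v + t)) * d + 2 * d ^ 2 := by
      nlinarith [sq_nonneg (e * plateau α (v + t) + 4 * d)]
    rw [hκ]
    linarith
  have h3 := mul_le_mul_of_nonneg_left h1 hepos.le
  rw [intervalIntegral.integral_const_mul, intervalIntegral.integral_const_mul,
    intervalIntegral.integral_const_mul] at h2
  have h4 := mul_le_mul_of_nonneg_left (integral_plateau_sq_le hα v)
    (by positivity : 0 ≤ 1 / 8 * (Real.exp (4 * lam) * Real.exp (2 * lam * w)))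
  linarith

lemma integral_le_integral_add_add_of_le {Ω : Type*} [MeasurableSpace Ω] {Q : Measure Ω}
    {f g₁ g₂ g₃ g₄ g₅ : Ω → ℝ} (hf : Integrable f Q) (h₁ : Integrable g₁ Q)
    (h₂ : Integrable g₂ Q) (h₃ : Integrable g₃ Q) (h₄ : Integrable g₄ Q) (h₅ : Integrable g₅ Q)
    (h : ∀ ω, f ω ≤ g₁ ω + g₂ ω + g₃ ω + g₄ ω + g₅ ω) :
    ∫ ω, f ω ∂Q ≤ ∫ ω, g₁ ω ∂Q + ∫ ω, g₂ ω ∂Q + ∫ ω, g₃ ω ∂Q + ∫ ω, g₄ ω ∂Q + ∫ ω, g₅ ω ∂Q := by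
  have h12 : Integrable (fun ω => g₁ ω + g₂ ω) Q := h₁.add h₂
  have h123 : Integrable (fun ω => g₁ ω + g₂ ω + g₃ ω) Q := h12.add h₃
  have h1234 : Integrable (fun ω => g₁ ω + g₂ ω + g₃ ω + g₄ ω) Q := h123.add h₄
  rw [← integral_add h₁ h₂, ← integral_add h12 h₃, ← integral_add h123 h₄, ← integral_add h1234 h₅]
  exact integral_mono hf (h1234.add h₅) h

/-- A concentration inequality for a random variable `W` and the random windows `[a, a + α]`, for
`a` in a class `𝒜` closed under translations, weighted by `exp (lam * a)`. The hypotheses isolate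
what the proof uses about the summands `X j` and their local sums `Y j`. The modulus of continuity
of the plateau function is controlled by the very quantity that is estimated, which accounts
for the factor on the left of the conclusion. -/
theorem concentration_of_local {Ω ι : Type*} [MeasurableSpace Ω] (Q : Measure Ω)
    [IsProbabilityMeasure Q] (J : Finset ι) (X Y : ι → Ω → ℝ) (W : Ω → ℝ)
    (hXm : ∀ j, Measurable (X j)) (hYm : ∀ j, Measurable (Y j)) (hWm : Measurable W)
    {lam α M₁ M₂ v r₂ r₃ k₀ : ℝ} (hlam : 0 ≤ lam) (hα : 0 < α) (hα1 : α ≤ 1)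
    (hX2 : ∀ j ∈ J, MemLp (X j) 2 Q) (𝒜 : Set (Ω → ℝ)) (hAm : ∀ a ∈ 𝒜, Measurable a)
    (hAshift : ∀ a ∈ 𝒜, ∀ c : ℝ, (fun ω => a ω + c) ∈ 𝒜)
    (hAint : ∀ a ∈ 𝒜, Integrable (fun ω => Real.exp (lam * a ω)) Q)
    (hAX : ∀ a ∈ 𝒜, ∀ j ∈ J, Integrable (fun ω => Real.exp (lam * a ω) * |X j ω|) Q)
    (hAXY : ∀ a ∈ 𝒜, ∀ j ∈ J, Integrable (fun ω => Real.exp (lam * a ω) * (|X j ω| * |Y j ω|)) Q)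
    (hmain : ∀ a ∈ 𝒜, ∫ ω, Real.exp (lam * a ω) * (∑ j ∈ J, X j ω *
      (plateauInt α (W ω - a ω) - plateauInt α (W ω - a ω - Y j ω))) ∂Q ≤ α * M₁)
    (hE : Integrable (fun ω => Real.exp (2 * lam * W ω)) Q)
    (hM₂ : ∫ ω, Real.exp (2 * lam * W ω) ∂Q ≤ M₂)
    (hr₃ : ∀ a ∈ 𝒜, ∫ ω, Real.exp (lam * a ω) *
      (∑ j ∈ J, |X j ω| * max (|Y j ω| - 1) 0) ∂Q ≤ r₃)
    (hv : ∫ t in (-1 : ℝ)..1, Var[randomKernel J X Y t; Q] ≤ v)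
    (hk₀ : k₀ ≤ ∫ t in (-1 : ℝ)..1, ∫ ω, randomKernel J X Y t ω ∂Q)
    (hr₂ : ∫ t in (-1 : ℝ)..1, |∫ ω, randomKernel J X Y t ω ∂Q| * |t| ≤ r₂)
    (hpos : 2 * Real.exp (2 * lam) * r₂ / α ≤ k₀) (hk₀0 : 0 ≤ k₀) {a : Ω → ℝ} (ha : a ∈ 𝒜) :
    (k₀ - 2 * Real.exp (2 * lam) * r₂ / α) *
      ∫ ω, Real.exp (lam * a ω) * window α (W ω - a ω) ∂Q
      ≤ α * M₁ + 3 / 8 * α * Real.exp (4 * lam) * M₂ + 2 * v + r₃ := by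
  set K : ℝ → ℝ := fun t => ∫ ω, randomKernel J X Y t ω ∂Q with hK
  have hκm := measurable_uncurry_randomKernel J hXm hYm
  have hXi : ∀ j ∈ J, Integrable (X j) Q := fun j hj => (hX2 j hj).integrable one_le_two
  have hH : Integrable (fun ω => ∑ j ∈ J, |X j ω|) Q :=
    integrable_finsetSum _ fun j hj => (hXi j hj).abs
  have hH2 : MemLp (fun ω => ∑ j ∈ J, |X j ω|) 2 Q :=
    memLp_finsetSum _ fun j hj => (hX2 j hj).abs
  have hKm : Measurable K := (hκm.stronglyMeasurable.integral_prod_right).measurable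
  set CK : ℝ := ∫ ω, ∑ j ∈ J, |X j ω| ∂Q with hCK
  have hKb : ∀ t, |K t| ≤ CK := fun t =>
    norm_integral_le_of_norm_le (f := randomKernel J X Y t) hH
      (ae_of_all _ fun ω => abs_randomKernel_le J X Y t ω)
  have hκ2 : ∀ t, MemLp (randomKernel J X Y t) 2 Q := fun t =>
    hH2.mono (hκm.comp measurable_prodMk_left).aestronglyMeasurable (ae_of_all _ fun ω => by
      rw [Real.norm_eq_abs, Real.norm_eq_abs]
      exact (abs_randomKernel_le J X Y t ω).trans (le_abs_self _))
  -- the fluctuation of the random kernel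
  have hvar : Integrable (fun ω => ∫ t in (-1 : ℝ)..1, (randomKernel J X Y t ω - K t) ^ 2) Q ∧
      ∫ ω, (∫ t in (-1 : ℝ)..1, (randomKernel J X Y t ω - K t) ^ 2) ∂Q
        ≤ ∫ t in (-1 : ℝ)..1, Var[randomKernel J X Y t; Q] := by
    have hm : Measurable (Function.uncurry fun t ω => (randomKernel J X Y t ω - K t) ^ 2) :=
      (hκm.sub (hKm.comp measurable_fst)).pow_const 2
    have hvar_eq : ∀ t, Var[randomKernel J X Y t; Q]
        = ∫ ω, (randomKernel J X Y t ω - K t) ^ 2 ∂Q := fun t =>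
      variance_eq_integral (hκ2 t).1.aemeasurable
    apply integral_intervalIntegral_le (by norm_num) hm (fun t ω => sq_nonneg _)
    · intro t _
      exact ((hκ2 t).sub (memLp_const (K t))).integrable_sq
    · simp_rw [hvar_eq]
      apply intervalIntegrable_integral hm (H := fun ω => ((∑ j ∈ J, |X j ω|) + CK) ^ 2)
      · exact (hH2.add (memLp_const CK)).integrable_sq
      · intro t ω
        rw [abs_pow]
        exact pow_le_pow_left₀ (abs_nonneg _) ((abs_sub _ _).trans
          (add_le_add (abs_randomKernel_le _ _ _ _ _) (hKb t))) 2
    · intro t _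
      exact (hvar_eq t).ge
  have hWin : ∀ a ∈ 𝒜, Integrable (fun ω => Real.exp (lam * a ω) * window α (W ω - a ω)) Q := by
    intro a ha
    have hm := hAm a ha
    refine (hAint a ha).mono' ?_ (ae_of_all _ fun ω => ?_)
    · exact ((hm.const_mul lam).exp.mul
        ((measurable_window α).comp (hWm.sub hm))).aestronglyMeasurable
    · rw [Real.norm_eq_abs, abs_mul, abs_of_nonneg (window_nonneg _ _), Real.abs_exp]
      exact mul_le_of_le_one_right (Real.exp_pos _).le (window_le_one _ _)
  have hr₂0 : 0 ≤ r₂ := le_trans (intervalIntegral.integral_nonneg (by norm_num)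
    fun t _ => by positivity) hr₂
  have hbdd : BddAbove {x | ∃ a ∈ 𝒜, x = ∫ ω, Real.exp (lam * a ω) * window α (W ω - a ω) ∂Q} := by
    refine ⟨∫ ω, (1 + Real.exp (2 * lam * W ω)) ∂Q, ?_⟩
    rintro x ⟨a, ha, rfl⟩
    refine integral_mono (hWin a ha) ((integrable_const _).add hE) fun ω => ?_
    by_cases hw : W ω - a ω ∈ Icc 0 α
    · rw [window_of_mem hw, mul_one]
      have h1 : lam * a ω ≤ lam * W ω := mul_le_mul_of_nonneg_left (by linarith [hw.1]) hlam
      have h2 : Real.exp (2 * lam * W ω) = Real.exp (lam * W ω) ^ 2 := by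
        rw [← Real.exp_nat_mul]; push_cast; ring_nf
      have h3 := Real.exp_le_exp.2 h1
      simp only
      rw [h2]
      nlinarith [sq_nonneg (Real.exp (lam * W ω) - 1)]
    · rw [window_of_notMem hw, mul_zero]
      positivity
  refine sub_mul_le_of_forall_upperBound hbdd hpos hk₀0 ?_ _ ⟨a, ha, rfl⟩
  clear ha a
  rintro M hM _ ⟨a, ha, rfl⟩
  replace hM : ∀ a ∈ 𝒜, ∫ ω, Real.exp (lam * a ω) * window α (W ω - a ω) ∂Q ≤ M :=
    fun a ha => hM _ ⟨a, ha, rfl⟩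
  have ham := hAm a ha
  have hM0 : 0 ≤ M := le_trans (integral_nonneg fun ω =>
    mul_nonneg (Real.exp_pos _).le (window_nonneg _ _)) (hM a ha)
  -- a shifted window is again a window of the class
  have hshift : ∀ c : ℝ, |c| ≤ 2 →
      Integrable (fun ω => Real.exp (lam * a ω) * window α (W ω - a ω + c)) Q ∧
      ∫ ω, Real.exp (lam * a ω) * window α (W ω - a ω + c) ∂Q ≤ Real.exp (2 * lam) * M := by
    intro c hc
    have ha' := hAshift a ha (-c)
    have e : ∀ ω, Real.exp (lam * a ω) * window α (W ω - a ω + c) = Real.exp (lam * c) *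
        (Real.exp (lam * (a ω + -c)) * window α (W ω - (a ω + -c))) := by
      intro ω
      rw [← mul_assoc, ← Real.exp_add]
      congr 2 <;> ring
    simp_rw [e]
    refine ⟨(hWin _ ha').const_mul _, ?_⟩
    rw [integral_const_mul]
    refine mul_le_mul (Real.exp_le_exp.2 ?_) (hM _ ha') (integral_nonneg fun ω =>
      mul_nonneg (Real.exp_pos _).le (window_nonneg _ _)) (Real.exp_pos _).le
    nlinarith [le_abs_self c]
  have hside : ∀ c : ℝ, |c| ≤ 1 → ∀ t : ℝ, |t| ≤ 1 →
      Integrable (fun ω => ∫ r in (0 : ℝ)..1,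
        Real.exp (lam * a ω) * window α (W ω - a ω + c + r * t)) Q ∧
      ∫ ω, (∫ r in (0 : ℝ)..1, Real.exp (lam * a ω) * window α (W ω - a ω + c + r * t)) ∂Q
        ≤ Real.exp (2 * lam) * M := by
    intro c hc t ht
    have hcr : ∀ r ∈ Icc (0 : ℝ) 1, |c + r * t| ≤ 2 := by
      intro r hr
      refine (abs_add_le _ _).trans ?_
      rw [abs_mul, abs_of_nonneg hr.1]
      nlinarith [hr.1, hr.2, abs_nonneg t]
    have h := integral_intervalIntegral_le (Q := Q) (a := 0) (b := 1)
      (f := fun r ω => Real.exp (lam * a ω) * window α (W ω - a ω + c + r * t))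
      (g := fun _ => Real.exp (2 * lam) * M) zero_le_one ?_ ?_ ?_ intervalIntegrable_const ?_
    · simpa using h
    · have h1 : Measurable fun x : ℝ × Ω => W x.2 - a x.2 + c + x.1 * t := by fun_prop
      have h2 : Measurable fun x : ℝ × Ω => Real.exp (lam * a x.2) := by fun_prop
      exact h2.mul ((measurable_window α).comp h1)
    · intro t ω
      exact mul_nonneg (Real.exp_pos _).le (window_nonneg _ _)
    · intro r hr
      simp only [add_assoc]
      exact (hshift _ (hcr r hr)).1
    · intro r hr
      simp only [add_assoc]
      exact (hshift _ (hcr r hr)).2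
  have hψm : ∀ t, Measurable fun ω => plateau α (W ω - a ω + t) := fun t =>
    (continuous_plateau α).measurable.comp ((hWm.sub ham).add_const t)
  have hexpm : Measurable fun ω => Real.exp (lam * a ω) := by fun_prop
  have hψb : ∀ x, |plateau α x| ≤ 1 := fun x => by
    rw [abs_of_nonneg (plateau_nonneg hα x)]; exact plateau_le_one α x
  have hosc : ∀ t ∈ Icc (-1 : ℝ) 1,
      ∫ ω, Real.exp (lam * a ω) * |plateau α (W ω - a ω + t) - plateau α (W ω - a ω)| ∂Q
        ≤ |t| * (2 / α * (Real.exp (2 * lam) * M)) := by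
    intro t ht
    have ht' : |t| ≤ 1 := abs_le.2 ht
    obtain ⟨i1, b1⟩ := hside α (by rwa [abs_of_pos hα]) t ht'
    obtain ⟨i2, b2⟩ := hside (-α) (by rwa [abs_neg, abs_of_pos hα]) t ht'
    have hle : ∀ ω, Real.exp (lam * a ω) * |plateau α (W ω - a ω + t) - plateau α (W ω - a ω)|
        ≤ |t| / α * ((∫ r in (0 : ℝ)..1, Real.exp (lam * a ω) * window α (W ω - a ω + α + r * t))
          + ∫ r in (0 : ℝ)..1, Real.exp (lam * a ω) * window α (W ω - a ω + -α + r * t)) := by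
      intro ω
      rw [intervalIntegral.integral_const_mul, intervalIntegral.integral_const_mul, ← mul_add,
        mul_left_comm]
      exact mul_le_mul_of_nonneg_left (abs_plateau_add_sub_le hα _ _) (Real.exp_pos _).le
    calc _ ≤ ∫ ω, |t| / α * ((∫ r in (0 : ℝ)..1,
              Real.exp (lam * a ω) * window α (W ω - a ω + α + r * t))
          + ∫ r in (0 : ℝ)..1, Real.exp (lam * a ω) * window α (W ω - a ω + -α + r * t)) ∂Q :=
          integral_mono_of_nonneg (ae_of_all _ fun ω => by positivity)
            ((i1.add i2).const_mul _) (ae_of_all _ hle)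
      _ ≤ |t| / α * (Real.exp (2 * lam) * M + Real.exp (2 * lam) * M) := by
          rw [integral_const_mul, integral_add i1 i2]
          gcongr
      _ = _ := by ring
  have hosci : Integrable (fun ω => ∫ t in (-1 : ℝ)..1, |K t| * (Real.exp (lam * a ω) *
        |plateau α (W ω - a ω + t) - plateau α (W ω - a ω)|)) Q ∧
      ∫ ω, (∫ t in (-1 : ℝ)..1, |K t| * (Real.exp (lam * a ω) *
        |plateau α (W ω - a ω + t) - plateau α (W ω - a ω)|)) ∂Q
      ≤ ∫ t in (-1 : ℝ)..1, |K t| * |t| * (2 / α * (Real.exp (2 * lam) * M)) := by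
    apply integral_intervalIntegral_le (by norm_num)
    · have h1 : Measurable fun x : ℝ × Ω => plateau α (W x.2 - a x.2 + x.1) :=
        (continuous_plateau α).measurable.comp (by fun_prop)
      have h2 : Measurable fun x : ℝ × Ω => plateau α (W x.2 - a x.2) :=
        (continuous_plateau α).measurable.comp (by fun_prop)
      have h3 : Measurable fun x : ℝ × Ω => Real.exp (lam * a x.2) := by fun_prop
      exact (hKm.comp measurable_fst).abs.mul (h3.mul (h1.sub h2).abs)
    · intro t ω
      positivity
    · intro t _
      refine Integrable.const_mul ?_ _
      refine ((hAint a ha).mul_const 2).mono' (hexpm.mul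
        ((hψm t).sub (by simpa using hψm 0)).abs).aestronglyMeasurable (ae_of_all _ fun ω => ?_)
      rw [Real.norm_of_nonneg (by positivity)]
      gcongr
      refine (abs_sub _ _).trans ?_
      linarith [hψb (W ω - a ω + t), hψb (W ω - a ω)]
    · refine IntervalIntegrable.mul_const ?_ _
      exact (intervalIntegrable_of_bdd hKm.abs (fun t => by rw [abs_abs]; exact hKb t)
        _ _).mul_continuousOn continuous_abs.continuousOn
    · intro t ht
      rw [integral_const_mul, mul_assoc]
      exact mul_le_mul_of_nonneg_left (hosc t ht) (abs_nonneg _)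
  rw [intervalIntegral.integral_mul_const] at hosci
  have hosc2 : (∫ t in (-1 : ℝ)..1, |K t| * |t|) * (2 / α * (Real.exp (2 * lam) * M))
      ≤ r₂ * (2 / α * (Real.exp (2 * lam) * M)) := by
    gcongr
  -- integrate the pathwise inequality
  have hpath := fun ω => pathwise_concentration J X Y hα hα1 hlam hKm hKb (W ω) (a ω) ω
  have j0 : Integrable (fun ω => Real.exp (lam * a ω) * plateau α (W ω - a ω)) Q := by
    refine (hAint a ha).mono' (hexpm.mul (by simpa using hψm 0)).aestronglyMeasurable
      (ae_of_all _ fun ω => ?_)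
    rw [Real.norm_eq_abs, abs_mul, Real.abs_exp]
    exact mul_le_of_le_one_right (Real.exp_pos _).le (hψb _)
  have j1 : Integrable (fun ω => Real.exp (lam * a ω) * (∑ j ∈ J, X j ω *
      (plateauInt α (W ω - a ω) - plateauInt α (W ω - a ω - Y j ω)))) Q := by
    simp_rw [Finset.mul_sum]
    refine integrable_finsetSum _ fun j hj => ?_
    refine ((hAX a ha j hj).mul_const (2 * α)).mono' ?_ (ae_of_all _ fun ω => ?_)
    · have h1 : Measurable fun ω => plateauInt α (W ω - a ω) :=
        (continuous_plateauInt α).measurable.comp (hWm.sub ham)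
      have h2 : Measurable fun ω => plateauInt α (W ω - a ω - Y j ω) :=
        (continuous_plateauInt α).measurable.comp ((hWm.sub ham).sub (hYm j))
      exact (hexpm.mul ((hXm j).mul (h1.sub h2))).aestronglyMeasurable
    · rw [Real.norm_eq_abs, abs_mul, abs_mul, Real.abs_exp, ← mul_assoc]
      gcongr
      rw [abs_le]
      constructor <;> linarith [plateauInt_nonneg hα (W ω - a ω), plateauInt_le hα (W ω - a ω),
        plateauInt_nonneg hα (W ω - a ω - Y j ω), plateauInt_le hα (W ω - a ω - Y j ω)]
  have j4 : Integrable (fun ω => Real.exp (lam * a ω) *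
      ∑ j ∈ J, |X j ω| * max (|Y j ω| - 1) 0) Q := by
    simp_rw [Finset.mul_sum]
    refine integrable_finsetSum _ fun j hj => ?_
    refine (hAXY a ha j hj).mono' ?_ (ae_of_all _ fun ω => ?_)
    · exact (hexpm.mul ((hXm j).abs.mul
        (((hYm j).abs.sub_const 1).max measurable_const))).aestronglyMeasurable
    · rw [Real.norm_of_nonneg (by positivity)]
      gcongr
      exact max_le (by linarith) (abs_nonneg _)
  have j2 := hosci.1
  have j3 : Integrable (fun ω => 3 / 8 * α * Real.exp (4 * lam) * Real.exp (2 * lam * W ω)) Q :=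
    hE.const_mul _
  have j5 := hvar.1.const_mul 2
  have j12 := integral_le_integral_add_add_of_le (j0.mul_const _) j1 j2 j3 j5 j4 hpath
  rw [integral_mul_const, integral_const_mul, integral_const_mul] at j12
  have hwp : ∫ ω, Real.exp (lam * a ω) * window α (W ω - a ω) ∂Q
      ≤ ∫ ω, Real.exp (lam * a ω) * plateau α (W ω - a ω) ∂Q :=
    integral_mono (hWin a ha) j0 fun ω =>
      mul_le_mul_of_nonneg_left (window_le_plateau hα _) (Real.exp_pos _).le
  have hP0 : 0 ≤ ∫ ω, Real.exp (lam * a ω) * plateau α (W ω - a ω) ∂Q :=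
    integral_nonneg fun ω => mul_nonneg (Real.exp_pos _).le (plateau_nonneg hα _)
  have hleft : k₀ * ∫ ω, Real.exp (lam * a ω) * window α (W ω - a ω) ∂Q
      ≤ (∫ ω, Real.exp (lam * a ω) * plateau α (W ω - a ω) ∂Q) * ∫ t in (-1 : ℝ)..1, K t := by
    rw [mul_comm]
    exact mul_le_mul hwp hk₀ hk₀0 hP0
  have hm := hmain a ha
  have h3 := hr₃ a ha
  have hM2' : 3 / 8 * α * Real.exp (4 * lam) * ∫ ω, Real.exp (2 * lam * W ω) ∂Q
      ≤ 3 / 8 * α * Real.exp (4 * lam) * M₂ := by gcongr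
  have hfin : r₂ * (2 / α * (Real.exp (2 * lam) * M))
      = 2 * Real.exp (2 * lam) * r₂ / α * M := by ring
  linarith [hvar.2, hosci.2, j12]

/-! ### Moments of local sums -/

lemma intervalIntegral_integral_swap_of_bdd {Ω : Type*} [MeasurableSpace Ω] {Q : Measure Ω}
    [SFinite Q] {f : ℝ → Ω → ℝ} (hf : Measurable (Function.uncurry f)) {H : Ω → ℝ}
    (hH : Integrable H Q) (hb : ∀ t ω, |f t ω| ≤ H ω) {a b : ℝ} (hab : a ≤ b) :
    Integrable (fun ω => ∫ t in a..b, f t ω) Q ∧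
      ∫ t in a..b, ∫ ω, f t ω ∂Q = ∫ ω, (∫ t in a..b, f t ω) ∂Q := by
  have hprod : Integrable (Function.uncurry f) ((volume.restrict (Ioc a b)).prod Q) := by
    have h1 : Integrable (fun x : ℝ × Ω => (1 : ℝ) * H x.2)
        ((volume.restrict (Ioc a b)).prod Q) :=
      Integrable.mul_prod (integrable_const _) hH
    refine h1.mono' hf.aestronglyMeasurable (ae_of_all _ fun x => ?_)
    rw [one_mul]
    exact hb x.1 x.2
  simp_rw [intervalIntegral.integral_of_le hab]
  exact ⟨hprod.integral_prod_right, integral_integral_swap hprod⟩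

namespace LocalLaw

variable {V : Type*} [Fintype V] [DecidableEq V] {G : SimpleGraph V} [DecidableRel G.Adj]
  {μ : Measure (V → ℝ)} [IsProbabilityMeasure μ] {q θ : ℝ}

lemma one_le_maxDegree_real (h : LocalLaw G μ q θ) : (1 : ℝ) ≤ G.maxDegree := by
  exact_mod_cast h.one_le_maxDegree

lemma memLp_coord (h : LocalLaw G μ q θ) (i : V) :
    MemLp (fun x : V → ℝ => x i) (ENNReal.ofReal (2 + q)) μ := by
  have hp : 0 < 2 + q := by linarith [h.q_pos]
  rw [← integrable_norm_rpow_iff (measurable_pi_apply i).aestronglyMeasurable (by simpa using hp)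
    ENNReal.ofReal_ne_top,
    ENNReal.toReal_ofReal hp.le]
  exact h.integrable_moment i

lemma memLp_two_coord (h : LocalLaw G μ q θ) (i : V) : MemLp (fun x : V → ℝ => x i) 2 μ := by
  refine (h.memLp_coord i).mono_exponent ?_
  rw [← ENNReal.ofReal_ofNat]
  exact ENNReal.ofReal_le_ofReal (by linarith [h.q_pos])

lemma memLp_two_coordSum (h : LocalLaw G μ q θ) (S : Finset V) : MemLp (coordSum S) 2 μ :=
  memLp_finsetSum S fun i _ => h.memLp_two_coord i

lemma integrable_coord (h : LocalLaw G μ q θ) (i : V) : Integrable (fun x : V → ℝ => x i) μ :=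
  (h.memLp_two_coord i).integrable one_le_two

lemma integrable_coordSum (h : LocalLaw G μ q θ) (S : Finset V) : Integrable (coordSum S) μ :=
  (h.memLp_two_coordSum S).integrable one_le_two

lemma integrable_coord_mul_coord (h : LocalLaw G μ q θ) (i j : V) :
    Integrable (fun x : V → ℝ => x i * x j) μ :=
  (h.memLp_two_coord i).integrable_mul (h.memLp_two_coord j)

lemma integrable_coord_mul_coordSum (h : LocalLaw G μ q θ) (i : V) (S : Finset V) :
    Integrable (fun x : V → ℝ => x i * coordSum S x) μ :=
  (h.memLp_two_coord i).integrable_mul (h.memLp_two_coordSum S)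

lemma integral_abs_coord_mul_abs_coord_le (h : LocalLaw G μ q θ) (i j : V) :
    ∫ x, |x i| * |x j| ∂μ ≤ θ ^ 2 := by
  have := (h.moment_mul (a := 1) (b := 1) (c := 0) zero_le_one zero_le_one le_rfl
    (by linarith [h.q_pos]) i j i).2
  norm_num at this
  exact this

lemma moment_rpow (h : LocalLaw G μ q θ) (i : V) :
    Integrable (fun x : V → ℝ => |x i| ^ q) μ ∧ ∫ x, |x i| ^ q ∂μ ≤ θ ^ q := by
  simpa using h.moment_mul (a := q) (b := 0) (c := 0) h.q_pos.le le_rfl le_rfl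
    (by linarith [h.q_pos]) i i i

lemma moment_sum_rpow (h : LocalLaw G μ q θ) (B : Finset V) :
    Integrable (fun x : V → ℝ => ∑ l ∈ B, |x l| ^ q) μ ∧
      ∫ x, ∑ l ∈ B, |x l| ^ q ∂μ ≤ B.card * θ ^ q := by
  refine ⟨integrable_finsetSum _ fun l _ => (h.moment_rpow l).1, ?_⟩
  rw [integral_finsetSum _ fun l _ => (h.moment_rpow l).1, ← nsmul_eq_mul]
  exact Finset.sum_le_card_nsmul _ _ _ fun l _ => (h.moment_rpow l).2

lemma moment_mul_mul_sum (h : LocalLaw G μ q θ) (i k : V) (B : Finset V) :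
    Integrable (fun x : V → ℝ => |x i| * |x k| * ∑ l ∈ B, |x l| ^ q) μ ∧
      ∫ x, |x i| * |x k| * ∑ l ∈ B, |x l| ^ q ∂μ ≤ B.card * θ ^ (2 + q) := by
  have h1 : ∀ l, Integrable (fun x : V → ℝ => |x i| * |x k| * |x l| ^ q) μ ∧
      ∫ x, |x i| * |x k| * |x l| ^ q ∂μ ≤ θ ^ (2 + q) := fun l => by
    have := h.moment_mul (a := 1) (b := 1) (c := q) zero_le_one zero_le_one h.q_pos.le
      (by linarith) i k l
    norm_num at this
    exact this
  simp_rw [Finset.mul_sum]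
  refine ⟨integrable_finsetSum _ fun l _ => (h1 l).1, ?_⟩
  rw [integral_finsetSum _ fun l _ => (h1 l).1, ← nsmul_eq_mul]
  exact Finset.sum_le_card_nsmul _ _ _ fun l _ => (h1 l).2

lemma moment_mul_sum_mul_sum (h : LocalLaw G μ q θ) (i : V) (A B : Finset V) :
    Integrable (fun x : V → ℝ => |x i| * (∑ k ∈ A, |x k|) * ∑ l ∈ B, |x l| ^ q) μ ∧
      ∫ x, |x i| * (∑ k ∈ A, |x k|) * ∑ l ∈ B, |x l| ^ q ∂μ
        ≤ A.card * (B.card * θ ^ (2 + q)) := by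
  have h1 := fun k => h.moment_mul_mul_sum i k B
  simp_rw [Finset.mul_sum (s := A), Finset.sum_mul (s := A)]
  refine ⟨integrable_finsetSum _ fun k _ => (h1 k).1, ?_⟩
  rw [integral_finsetSum _ fun k _ => (h1 k).1]
  refine (Finset.sum_le_card_nsmul _ _ _ fun k _ => (h1 k).2).trans_eq ?_
  rw [nsmul_eq_mul]

end LocalLaw

lemma abs_coordSum_rpow_le {V : Type*} (S : Finset V) (x : V → ℝ) {q : ℝ} (hq : 0 < q)
    (hq1 : q ≤ 1) : |coordSum S x| ^ q ≤ ∑ k ∈ S, |x k| ^ q := by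
  simpa [coordSum] using abs_sum_mul_rpow_le S (fun _ => 1) x hq hq1 (by simp)

lemma min_one_le_rpow {y q : ℝ} (hy : 0 ≤ y) (hq : 0 < q) (hq1 : q ≤ 1) : min y 1 ≤ y ^ q := by
  rcases le_total y 1 with h | h
  · exact (min_le_left _ _).trans (Real.self_le_rpow_of_le_one hy h hq1)
  · exact (min_le_right _ _).trans (Real.one_le_rpow h hq.le)

lemma max_sub_one_le {y q : ℝ} (hy : 0 ≤ y) (hq : 0 < q) : max (y - 1) 0 ≤ y * y ^ q := by
  rcases le_total y 1 with h | h
  · rw [max_eq_right (by linarith)]; positivity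
  · refine max_le ?_ (by positivity)
    nlinarith [Real.one_le_rpow h hq.le]

lemma min_one_sq_le {y q : ℝ} (hy : 0 ≤ y) (hq : 0 < q) (hq1 : q ≤ 1) :
    min y 1 ^ 2 ≤ y * y ^ q := by
  rw [sq]
  exact mul_le_mul (min_le_left _ _) (min_one_le_rpow hy hq hq1) (le_min hy zero_le_one) hy

/-- The sum of a vertex's coordinate and those of its neighbours. -/
noncomputable def localSum {V : Type*} [Fintype V] [DecidableEq V] (G : SimpleGraph V)
    [DecidableRel G.Adj] (i : V) (x : V → ℝ) : ℝ := coordSum (nbhdBall G 1 i) x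

namespace LocalLaw

variable {V : Type*} [Fintype V] [DecidableEq V] {G : SimpleGraph V} [DecidableRel G.Adj]
  {μ : Measure (V → ℝ)} [IsProbabilityMeasure μ] {q θ : ℝ}

@[fun_prop]
lemma measurable_localSum (i : V) : Measurable (localSum G i) := measurable_coordSum _

lemma card_ball_one_le (h : LocalLaw G μ q θ) (i : V) :
    ((nbhdBall G 1 i).card : ℝ) ≤ 2 * G.maxDegree := by
  simpa using card_nbhdBall_le_real h.one_le_maxDegree 0 i

/-- The local third-order moment `E |X i| |Y i|^(1 + q)`. -/
lemma moment_localSum (h : LocalLaw G μ q θ) (i : V) :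
    Integrable (fun x => |x i| * (|localSum G i x| * |localSum G i x| ^ q)) μ ∧
      ∫ x, |x i| * (|localSum G i x| * |localSum G i x| ^ q) ∂μ
        ≤ 4 * (G.maxDegree : ℝ) ^ 2 * θ ^ (2 + q) := by
  obtain ⟨h1, h2⟩ := h.moment_mul_sum_mul_sum i (nbhdBall G 1 i) (nbhdBall G 1 i)
  have hle : ∀ x : V → ℝ, |x i| * (|localSum G i x| * |localSum G i x| ^ q)
      ≤ |x i| * (∑ k ∈ nbhdBall G 1 i, |x k|) * ∑ l ∈ nbhdBall G 1 i, |x l| ^ q := by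
    intro x
    rw [mul_assoc]
    have := abs_coordSum_le (nbhdBall G 1 i) x
    have := abs_coordSum_rpow_le (nbhdBall G 1 i) x h.q_pos h.q_le_one
    unfold localSum
    gcongr
  have hθ : 0 < θ ^ (2 + q) := Real.rpow_pos_of_pos h.theta_pos _
  have hi : Integrable (fun x => |x i| * (|localSum G i x| * |localSum G i x| ^ q)) μ := by
    refine h1.mono' (Measurable.aestronglyMeasurable (by fun_prop)) (ae_of_all _ fun x => ?_)
    rw [Real.norm_of_nonneg (by positivity)]
    exact hle x
  refine ⟨hi, (integral_mono hi h1 hle).trans (h2.trans ?_)⟩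
  have := h.card_ball_one_le i
  calc _ ≤ 2 * (G.maxDegree : ℝ) * (2 * G.maxDegree * θ ^ (2 + q)) := by gcongr
    _ = _ := by ring

lemma moment_sq_localSum (h : LocalLaw G μ q θ) (i : V) :
    Integrable (fun x => x i ^ 2 * min |localSum G i x| 1) μ ∧
      ∫ x, x i ^ 2 * min |localSum G i x| 1 ∂μ ≤ 2 * (G.maxDegree : ℝ) * θ ^ (2 + q) := by
  obtain ⟨h1, h2⟩ := h.moment_mul_mul_sum i i (nbhdBall G 1 i)
  have hle : ∀ x : V → ℝ, x i ^ 2 * min |localSum G i x| 1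
      ≤ |x i| * |x i| * ∑ l ∈ nbhdBall G 1 i, |x l| ^ q := by
    intro x
    rw [← sq, sq_abs]
    have := (min_one_le_rpow (abs_nonneg (localSum G i x)) h.q_pos h.q_le_one).trans
      (abs_coordSum_rpow_le (nbhdBall G 1 i) x h.q_pos h.q_le_one)
    gcongr
  have hθ : 0 < θ ^ (2 + q) := Real.rpow_pos_of_pos h.theta_pos _
  have hi : Integrable (fun x => x i ^ 2 * min |localSum G i x| 1) μ := by
    refine h1.mono' (Measurable.aestronglyMeasurable (by fun_prop)) (ae_of_all _ fun x => ?_)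
    rw [Real.norm_of_nonneg (by positivity)]
    exact hle x
  refine ⟨hi, (integral_mono hi h1 hle).trans (h2.trans ?_)⟩
  have := h.card_ball_one_le i
  gcongr

/-- The variance of a sum of functions of the radius-one balls: functions attached to vertices at
distance more than three are uncorrelated. -/
lemma variance_sum_le (h : LocalLaw G μ q θ) (J : Finset V) {f : V → (V → ℝ) → ℝ}
    (hfm : ∀ j, Measurable (f j)) (hf2 : ∀ j, MemLp (f j) 2 μ)
    (hfd : ∀ j, DependsOn (f j) (nbhdBall G 1 j : Set V)) :
    Var[fun x => ∑ j ∈ J, f j x; μ]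
      ≤ 2 * (G.maxDegree : ℝ) ^ 3 * ∑ j ∈ J, ∫ x, f j x ^ 2 ∂μ := by
  have hcov : ∀ i j, cov[f i, f j; μ]
      ≤ if j ∈ nbhdBall G 3 i then (Var[f i; μ] + Var[f j; μ]) / 2 else 0 := by
    intro i j
    split_ifs with hij
    · have h1 := variance_nonneg (f i - f j) μ
      rw [variance_sub (hf2 i) (hf2 j)] at h1
      linarith
    · refine (IndepFun.covariance_eq_zero ?_ (hf2 i) (hf2 j)).le
      refine h.dep.indepFun ?_ (hfm i) (hfm j) (hfd i) (hfd j)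
      rw [← nbhdBall_succ]
      exact disjoint_nbhdBall (by norm_num) hij
  have hvar0 : ∀ j, 0 ≤ Var[f j; μ] := fun j => variance_nonneg _ _
  have e : Var[fun x => ∑ j ∈ J, f j x; μ] = ∑ i ∈ J, ∑ j ∈ J, cov[f i, f j; μ] :=
    variance_fun_sum' fun j _ => hf2 j
  have h1 : ∀ i, (∑ j ∈ J, if j ∈ nbhdBall G 3 i then Var[f i; μ] else 0)
      ≤ 2 * (G.maxDegree : ℝ) ^ 3 * Var[f i; μ] := by
    intro i
    rw [← Finset.sum_filter, Finset.sum_const, nsmul_eq_mul]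
    refine mul_le_mul_of_nonneg_right ?_ (hvar0 i)
    refine le_trans ?_ (card_nbhdBall_le_real h.one_le_maxDegree 2 i)
    exact_mod_cast Finset.card_le_card fun j hj => (Finset.mem_filter.1 hj).2
  calc _ ≤ ∑ i ∈ J, ∑ j ∈ J,
        if j ∈ nbhdBall G 3 i then (Var[f i; μ] + Var[f j; μ]) / 2 else 0 :=
        e.trans_le (Finset.sum_le_sum fun i _ => Finset.sum_le_sum fun j _ => hcov i j)
    _ = (∑ i ∈ J, ∑ j ∈ J, if j ∈ nbhdBall G 3 i then Var[f i; μ] else 0) / 2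
        + (∑ i ∈ J, ∑ j ∈ J, if j ∈ nbhdBall G 3 i then Var[f j; μ] else 0) / 2 := by
        simp_rw [Finset.sum_div, ← Finset.sum_add_distrib]
        refine Finset.sum_congr rfl fun i _ => Finset.sum_congr rfl fun j _ => ?_
        split_ifs <;> ring
    _ = ∑ i ∈ J, ∑ j ∈ J, if j ∈ nbhdBall G 3 i then Var[f i; μ] else 0 := by
        have : (∑ i ∈ J, ∑ j ∈ J, if j ∈ nbhdBall G 3 i then Var[f j; μ] else 0)
            = ∑ i ∈ J, ∑ j ∈ J, if j ∈ nbhdBall G 3 i then Var[f i; μ] else 0 := by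
          rw [Finset.sum_comm]
          refine Finset.sum_congr rfl fun i _ => Finset.sum_congr rfl fun j _ => ?_
          simp only [mem_nbhdBall_comm (i := j)]
        rw [this]; ring
    _ ≤ ∑ i ∈ J, 2 * (G.maxDegree : ℝ) ^ 3 * Var[f i; μ] := Finset.sum_le_sum fun i _ => h1 i
    _ ≤ _ := by
        rw [← Finset.mul_sum]
        gcongr with i _
        exact variance_le_expectation_sq (hfm i).aestronglyMeasurable

lemma sum_le_card_mul (J : Finset V) {f : V → ℝ} {c : ℝ} (hc : 0 ≤ c) (hf : ∀ j, f j ≤ c) :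
    ∑ j ∈ J, f j ≤ Fintype.card V * c := by
  refine (Finset.sum_le_card_nsmul J f c fun j _ => hf j).trans ?_
  rw [nsmul_eq_mul]
  gcongr
  exact Finset.card_le_univ J

/-- The integrated variance of the random kernel. -/
lemma integral_variance_randomKernel_le (h : LocalLaw G μ q θ) (J : Finset V) :
    ∫ t in (-1 : ℝ)..1, Var[randomKernel J (fun j x => x j) (localSum G) t; μ]
      ≤ 4 * (G.maxDegree : ℝ) ^ 4 * (Fintype.card V * θ ^ (2 + q)) := by
  have hD := h.one_le_maxDegree_real
  have hθ : 0 < θ ^ (2 + q) := Real.rpow_pos_of_pos h.theta_pos _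
  set f : ℝ → V → (V → ℝ) → ℝ := fun t j x => x j * steinKernel (localSum G j x) t with hf
  have hum : ∀ j, Measurable fun y : ℝ × (V → ℝ) => steinKernel (localSum G j y.2) y.1 := by
    intro j
    have h1 : Measurable fun y : ℝ × (V → ℝ) => (localSum G j y.2, y.1) := by fun_prop
    have h2 := measurable_uncurry_steinKernel.comp h1
    simpa only [Function.comp_def, Function.uncurry_apply_pair] using h2
  have hkm : ∀ t j, Measurable fun x : V → ℝ => steinKernel (localSum G j x) t :=
    fun t j => (hum j).comp (g := fun y : ℝ × (V → ℝ) => steinKernel (localSum G j y.2) y.1)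
      (f := fun x : V → ℝ => (t, x)) measurable_prodMk_left
  have hfm : ∀ t j, Measurable (f t j) := fun t j => (measurable_pi_apply j).mul (hkm t j)
  have hf2 : ∀ t j, MemLp (f t j) 2 μ := fun t j => by
    refine (h.memLp_two_coord j).mono (hfm t j).aestronglyMeasurable (ae_of_all _ fun x => ?_)
    rw [hf, norm_mul]
    exact mul_le_of_le_one_right (norm_nonneg _) (abs_steinKernel_le_one _ _)
  have hfd : ∀ t j, DependsOn (f t j) (nbhdBall G 1 j : Set V) := by
    intro t j x y hxy
    have h1 : localSum G j x = localSum G j y := dependsOn_coordSum subset_rfl hxy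
    simp only [hf, h1, hxy j (mem_nbhdBall_self 1 j)]
  have hsq : ∀ t j x, f t j x ^ 2 = x j ^ 2 * |steinKernel (localSum G j x) t| := fun t j x => by
    simp only [hf]; rw [mul_pow, steinKernel_sq]
  have hsqb : ∀ j t x, abs (x j ^ 2 * |steinKernel (localSum G j x) t|) ≤ x j ^ 2 := fun j t x => by
    rw [abs_of_nonneg (by positivity)]
    exact mul_le_of_le_one_right (sq_nonneg _) (abs_steinKernel_le_one _ _)
  have hmeas : ∀ j, Measurable (Function.uncurry
      fun t (x : V → ℝ) => x j ^ 2 * |steinKernel (localSum G j x) t|) := fun j =>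
    (((measurable_pi_apply j).comp measurable_snd).pow_const 2).mul (hum j).abs
  have hswap := fun j => intervalIntegral_integral_swap_of_bdd (hmeas j)
    (h.memLp_two_coord j).integrable_sq (hsqb j) (by norm_num : (-1 : ℝ) ≤ 1)
  have hii := fun j => intervalIntegrable_integral (hmeas j)
    (h.memLp_two_coord j).integrable_sq (hsqb j) (-1) 1
  have hone : ∀ j, ∫ t in (-1 : ℝ)..1, ∫ x, x j ^ 2 * |steinKernel (localSum G j x) t| ∂μ
      ≤ 2 * (G.maxDegree : ℝ) * θ ^ (2 + q) := by
    intro j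
    rw [(hswap j).2]
    refine (integral_mono (hswap j).1 (h.moment_sq_localSum j).1 fun x => ?_).trans
      (h.moment_sq_localSum j).2
    rw [intervalIntegral.integral_const_mul]
    exact mul_le_mul_of_nonneg_left (integral_abs_steinKernel _) (sq_nonneg _)
  have hii2 : IntervalIntegrable (fun t => 2 * (G.maxDegree : ℝ) ^ 3 * ∑ j ∈ J,
      ∫ x, x j ^ 2 * |steinKernel (localSum G j x) t| ∂μ) volume (-1) 1 := by
    have := (IntervalIntegrable.sum J fun j _ => hii j).const_mul (2 * (G.maxDegree : ℝ) ^ 3)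
    simpa only [Finset.sum_apply] using this
  calc _ ≤ ∫ t in (-1 : ℝ)..1, 2 * (G.maxDegree : ℝ) ^ 3 * ∑ j ∈ J,
        ∫ x, x j ^ 2 * |steinKernel (localSum G j x) t| ∂μ := by
        have hi := (intervalIntegrable_iff_integrableOn_Ioc_of_le
          (by norm_num : (-1 : ℝ) ≤ 1)).1 hii2
        rw [intervalIntegral.integral_of_le (by norm_num),
          intervalIntegral.integral_of_le (by norm_num)]
        refine integral_mono_of_nonneg (ae_of_all _ fun t => variance_nonneg _ _) hi
          (ae_of_all _ fun t => ?_)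
        have := h.variance_sum_le J (hfm t) (hf2 t) (hfd t)
        simp_rw [hsq] at this
        exact this
    _ = 2 * (G.maxDegree : ℝ) ^ 3 * ∑ j ∈ J,
        ∫ t in (-1 : ℝ)..1, ∫ x, x j ^ 2 * |steinKernel (localSum G j x) t| ∂μ := by
        rw [intervalIntegral.integral_const_mul,
          intervalIntegral.integral_finsetSum fun j _ => hii j]
    _ ≤ 2 * (G.maxDegree : ℝ) ^ 3 *
        (Fintype.card V * (2 * (G.maxDegree : ℝ) * θ ^ (2 + q))) := by
        gcongr
        exact sum_le_card_mul J (by positivity) hone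
    _ = _ := by ring

end LocalLaw

/-! ### Concentration under a local change of measure -/

section Tilt

variable {Ω : Type*} [MeasurableSpace Ω] {μ : Measure Ω}

/-- The probability measure with density proportional to `ζ` with respect to `μ`. -/
noncomputable def localTilt (μ : Measure Ω) (ζ : Ω → ℝ) : Measure Ω :=
  μ.withDensity fun x => ENNReal.ofReal (ζ x / ∫ y, ζ y ∂μ)

lemma integral_localTilt {ζ : Ω → ℝ} (hζ : Measurable ζ) (hζ0 : ∀ x, 0 ≤ ζ x) (f : Ω → ℝ) :
    ∫ x, f x ∂(localTilt μ ζ) = (∫ x, ζ x * f x ∂μ) / ∫ x, ζ x ∂μ := by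
  rw [localTilt, integral_withDensity_eq_integral_toReal_smul (by fun_prop)
    (ae_of_all _ fun x => ENNReal.ofReal_lt_top), ← integral_div]
  refine integral_congr_ae (ae_of_all _ fun x => ?_)
  dsimp only
  rw [ENNReal.toReal_ofReal (div_nonneg (hζ0 x) (integral_nonneg hζ0)), smul_eq_mul]
  ring

lemma isProbabilityMeasure_localTilt {ζ : Ω → ℝ} (hζ0 : ∀ x, 0 ≤ ζ x) (hi : Integrable ζ μ)
    (hpos : 0 < ∫ x, ζ x ∂μ) : IsProbabilityMeasure (localTilt μ ζ) := by
  refine ⟨?_⟩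
  rw [localTilt, withDensity_apply _ MeasurableSet.univ, setLIntegral_univ,
    ← ofReal_integral_eq_lintegral_ofReal (hi.div_const _)
      (ae_of_all _ fun x => div_nonneg (hζ0 x) hpos.le), integral_div, div_self hpos.ne',
    ENNReal.ofReal_one]

/-- A random variable independent of the density has the same law under the tilted measure. -/
lemma identDistrib_localTilt {ζ g : Ω → ℝ} (hζ : Measurable ζ) (hζ0 : ∀ x, 0 ≤ ζ x)
    (hi : Integrable ζ μ) (hpos : 0 < ∫ x, ζ x ∂μ) [IsProbabilityMeasure μ] (hg : Measurable g)
    (hind : IndepFun ζ g μ) : IdentDistrib g g (localTilt μ ζ) μ := by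
  have hP := isProbabilityMeasure_localTilt hζ0 hi hpos
  refine ⟨hg.aemeasurable, hg.aemeasurable, ?_⟩
  ext A hA
  rw [Measure.map_apply hg hA, Measure.map_apply hg hA,
    ← ENNReal.toReal_eq_toReal_iff' (measure_ne_top _ _) (measure_ne_top _ _)]
  change (localTilt μ ζ).real _ = μ.real _
  have hA1 : Measurable (A.indicator (fun _ => (1 : ℝ))) := measurable_const.indicator hA
  have h1 : ∀ ν : Measure Ω, ν.real (g ⁻¹' A) = ∫ x, A.indicator (fun _ => (1 : ℝ)) (g x) ∂ν := by
    intro ν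
    rw [← integral_indicator_one (hg hA)]
    rfl
  rw [h1, h1, integral_localTilt hζ hζ0]
  have h2 : IndepFun ζ (A.indicator (fun _ => (1 : ℝ)) ∘ g) μ := hind.comp measurable_id hA1
  have h3 := h2.integral_fun_mul_eq_mul_integral hζ.aestronglyMeasurable
    (hA1.comp hg).aestronglyMeasurable
  simp only [Function.comp_apply] at h3
  rw [h3, mul_div_cancel_left₀ _ hpos.ne']

end Tilt

namespace LocalLaw

variable {V : Type*} [Fintype V] [DecidableEq V] {G : SimpleGraph V} [DecidableRel G.Adj]
  {μ : Measure (V → ℝ)} [IsProbabilityMeasure μ] {q θ : ℝ}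

/-- The excess of a local sum over `1`, weighted by the coordinate. -/
lemma integral_coord_mul_excess_le (h : LocalLaw G μ q θ) (j : V) :
    Integrable (fun x => |x j| * max (|localSum G j x| - 1) 0) μ ∧
      ∫ x, |x j| * max (|localSum G j x| - 1) 0 ∂μ
        ≤ 4 * (G.maxDegree : ℝ) ^ 2 * θ ^ (2 + q) := by
  have hle : ∀ x : V → ℝ, |x j| * max (|localSum G j x| - 1) 0
      ≤ |x j| * (|localSum G j x| * |localSum G j x| ^ q) := fun x =>
    mul_le_mul_of_nonneg_left (max_sub_one_le (abs_nonneg _) h.q_pos) (abs_nonneg _)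
  obtain ⟨h1, h2⟩ := h.moment_localSum j
  have hi : Integrable (fun x => |x j| * max (|localSum G j x| - 1) 0) μ := by
    refine h1.mono' ((measurable_pi_apply j).abs.mul
      (((measurable_localSum j).abs.sub_const 1).max
        measurable_const)).aestronglyMeasurable (ae_of_all _ fun x => ?_)
    rw [Real.norm_of_nonneg (by positivity)]
    exact hle x
  exact ⟨hi, (integral_mono hi h1 hle).trans h2⟩

lemma measurable_steinKernel_localSum (j : V) :
    Measurable fun y : ℝ × (V → ℝ) => steinKernel (localSum G j y.2) y.1 := by
  have h1 : Measurable fun y : ℝ × (V → ℝ) => (localSum G j y.2, y.1) := by fun_prop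
  have h2 := measurable_uncurry_steinKernel.comp h1
  simpa only [Function.comp_def, Function.uncurry_apply_pair] using h2

lemma measurable_randomKernel_localSum (J : Finset V) (t : ℝ) :
    Measurable (randomKernel J (fun j (x : V → ℝ) => x j) (localSum G) t) :=
  (measurable_uncurry_randomKernel J (X := fun j (x : V → ℝ) => x j) (Y := localSum G)
    (fun j => measurable_pi_apply j) measurable_localSum).of_uncurry_left

lemma integrable_coord_mul_localSum (h : LocalLaw G μ q θ) (i j : V) :
    Integrable (fun x : V → ℝ => x i * localSum G j x) μ := h.integrable_coord_mul_coordSum i _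

lemma integral_randomKernel_ge (h : LocalLaw G μ q θ) (J : Finset V) :
    ∑ j ∈ J, ∫ x, x j * localSum G j x ∂μ
        - 4 * (G.maxDegree : ℝ) ^ 2 * (Fintype.card V * θ ^ (2 + q))
      ≤ ∫ t in (-1 : ℝ)..1, ∫ x, randomKernel J (fun j x => x j) (localSum G) t x ∂μ := by
  have hθ : 0 < θ ^ (2 + q) := Real.rpow_pos_of_pos h.theta_pos _
  have hI : Integrable (fun x : V → ℝ => ∑ j ∈ J, |x j|) μ :=
    integrable_finsetSum J fun j _ => (h.integrable_coord j).abs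
  obtain ⟨h1, h2⟩ := intervalIntegral_integral_swap_of_bdd
    (measurable_uncurry_randomKernel J (X := fun j x => x j) (Y := localSum G)
      (fun j => measurable_pi_apply j) measurable_localSum) hI
    (fun t x => abs_randomKernel_le J _ _ t x) (by norm_num : (-1 : ℝ) ≤ 1)
  rw [h2, ← integral_finsetSum J fun j _ => h.integrable_coord_mul_localSum j j]
  have h3 : ∫ x, (∑ j ∈ J, |x j| * max (|localSum G j x| - 1) 0) ∂μ
      ≤ 4 * (G.maxDegree : ℝ) ^ 2 * (Fintype.card V * θ ^ (2 + q)) := by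
    rw [integral_finsetSum J fun j _ => (h.integral_coord_mul_excess_le j).1]
    refine (sum_le_card_mul J (by positivity)
      fun j => (h.integral_coord_mul_excess_le j).2).trans_eq ?_
    ring
  have hi1 : Integrable (fun x => ∑ j ∈ J, x j * localSum G j x) μ :=
    integrable_finsetSum J fun j _ => h.integrable_coord_mul_localSum j j
  have hi2 : Integrable (fun x => ∑ j ∈ J, |x j| * max (|localSum G j x| - 1) 0) μ :=
    integrable_finsetSum J fun j _ => (h.integral_coord_mul_excess_le j).1
  have h4 : ∫ x, (∑ j ∈ J, x j * localSum G j x) ∂μ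
      - ∫ x, (∑ j ∈ J, |x j| * max (|localSum G j x| - 1) 0) ∂μ
      ≤ ∫ x, (∫ t in (-1 : ℝ)..1, randomKernel J (fun j x => x j) (localSum G) t x) ∂μ := by
    rw [← integral_sub hi1 hi2]
    refine integral_mono (hi1.sub hi2) h1 fun x => ?_
    simp only [randomKernel]
    rw [intervalIntegral.integral_finsetSum, ← Finset.sum_sub_distrib]
    · refine Finset.sum_le_sum fun j _ => ?_
      rw [intervalIntegral.integral_const_mul]
      have h5 := abs_sub_integral_steinKernel_le (localSum G j x)
      have h6 := (le_abs_self _).trans_eq (abs_mul (x j)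
        (localSum G j x - ∫ t in (-1 : ℝ)..1, steinKernel (localSum G j x) t))
      have h7 := mul_le_mul_of_nonneg_left h5 (abs_nonneg (x j))
      nlinarith
    · intro j _
      refine intervalIntegrable_of_bdd (C := |x j|) ?_ (fun t => ?_) _ _
      · exact ((measurable_steinKernel_localSum j).comp (g := fun y : ℝ × (V → ℝ) =>
          steinKernel (localSum G j y.2) y.1) (f := fun t : ℝ => (t, x))
          measurable_prodMk_right).const_mul _
      · rw [abs_mul]
        exact mul_le_of_le_one_right (abs_nonneg _) (abs_steinKernel_le_one _ _)
  linarith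

lemma integral_abs_randomKernel_mul_le (h : LocalLaw G μ q θ) (J : Finset V) :
    ∫ t in (-1 : ℝ)..1, |∫ x, randomKernel J (fun j x => x j) (localSum G) t x ∂μ| * |t|
      ≤ 2 * (G.maxDegree : ℝ) ^ 2 * (Fintype.card V * θ ^ (2 + q)) := by
  have hθ : 0 < θ ^ (2 + q) := Real.rpow_pos_of_pos h.theta_pos _
  set f : V → ℝ → (V → ℝ) → ℝ :=
    fun j t x => |x j| * (|steinKernel (localSum G j x) t| * min |t| 1) with hf
  have hm : ∀ j, Measurable (Function.uncurry (f j)) := fun j =>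
    ((measurable_pi_apply j).comp measurable_snd).abs.mul
      ((measurable_steinKernel_localSum j).abs.mul (measurable_fst.abs.min measurable_const))
  have h0 : ∀ j t x, 0 ≤ f j t x := fun j t x => by simp only [hf]; positivity
  have hb : ∀ j t x, |f j t x| ≤ |x j| := fun j t x => by
    rw [abs_of_nonneg (h0 j t x)]
    refine mul_le_of_le_one_right (abs_nonneg _) ?_
    exact mul_le_one₀ (abs_steinKernel_le_one _ _) (by positivity) (min_le_right _ _)
  have hswap := fun j => intervalIntegral_integral_swap_of_bdd (hm j)
    (h.integrable_coord j).abs (hb j) (by norm_num : (-1 : ℝ) ≤ 1)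
  have hii := fun j => intervalIntegrable_integral (hm j)
    (h.integrable_coord j).abs (hb j) (-1) 1
  have hone : ∀ j, ∫ t in (-1 : ℝ)..1, ∫ x, f j t x ∂μ
      ≤ 2 * (G.maxDegree : ℝ) ^ 2 * θ ^ (2 + q) := by
    intro j
    rw [(hswap j).2]
    have h3 := (h.moment_localSum j).1.const_mul (1 / 2)
    refine (integral_mono (hswap j).1 h3 fun x => ?_).trans ?_
    · simp only [hf]
      rw [intervalIntegral.integral_const_mul]
      have e : ∫ t in (-1 : ℝ)..1, |steinKernel (localSum G j x) t| * min |t| 1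
          = ∫ t in (-1 : ℝ)..1, |steinKernel (localSum G j x) t| * |t| := by
        refine intervalIntegral.integral_congr fun t ht => ?_
        rw [uIcc_of_le (by norm_num)] at ht
        rw [min_eq_left (abs_le.2 ht)]
      rw [e, mul_left_comm]
      refine mul_le_mul_of_nonneg_left ?_ (abs_nonneg _)
      refine (integral_abs_steinKernel_mul_abs _).trans ?_
      have := min_one_sq_le (abs_nonneg (localSum G j x)) h.q_pos h.q_le_one
      linarith
    · rw [integral_const_mul]
      linarith [(h.moment_localSum j).2]
  have hii2 : IntervalIntegrable (fun t => ∑ j ∈ J, ∫ x, f j t x ∂μ) volume (-1) 1 := by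
    simpa only [Finset.sum_fn] using IntervalIntegrable.sum J fun j _ => hii j
  calc _ ≤ ∫ t in (-1 : ℝ)..1, ∑ j ∈ J, ∫ x, f j t x ∂μ := by
        have hi := (intervalIntegrable_iff_integrableOn_Ioc_of_le
          (by norm_num : (-1 : ℝ) ≤ 1)).1 hii2
        rw [intervalIntegral.integral_of_le (by norm_num),
          intervalIntegral.integral_of_le (by norm_num)]
        refine integral_mono_of_nonneg (ae_of_all _ fun t => by positivity) hi
          ((ae_restrict_iff' measurableSet_Ioc).2 (ae_of_all _ fun t ht => ?_))
        have ht1 : |t| ≤ 1 := abs_le.2 ⟨ht.1.le, ht.2⟩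
        have hfi : ∀ j ∈ J, Integrable (f j t) μ := fun j _ =>
          (h.integrable_coord j).abs.mono'
            ((hm j).comp measurable_prodMk_left).aestronglyMeasurable
            (ae_of_all _ fun x => hb j t x)
        dsimp only
        rw [← integral_finsetSum J hfi, ← abs_of_nonneg (abs_nonneg t), ← abs_mul,
          ← integral_mul_const]
        rw [← Real.norm_eq_abs]
        refine norm_integral_le_of_norm_le (integrable_finsetSum J hfi) (ae_of_all _ fun x => ?_)
        rw [Real.norm_eq_abs, abs_mul, abs_abs, randomKernel]
        refine (mul_le_mul_of_nonneg_right (Finset.abs_sum_le_sum_abs _ _)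
          (abs_nonneg t)).trans_eq ?_
        rw [Finset.sum_mul]
        refine Finset.sum_congr rfl fun j _ => ?_
        simp only [hf]
        rw [abs_mul, min_eq_left ht1, mul_assoc]
    _ = ∑ j ∈ J, ∫ t in (-1 : ℝ)..1, ∫ x, f j t x ∂μ :=
        intervalIntegral.integral_finsetSum fun j _ => hii j
    _ ≤ Fintype.card V * (2 * (G.maxDegree : ℝ) ^ 2 * θ ^ (2 + q)) :=
        sum_le_card_mul J (by positivity) hone
    _ = _ := by ring

end LocalLaw

lemma DependsOn.mul_fun {V : Type*} {f g : (V → ℝ) → ℝ} {S : Set V} (hf : DependsOn f S)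
    (hg : DependsOn g S) : DependsOn (fun x => f x * g x) S := fun _ _ h => by
  simp only [hf h, hg h]

lemma DependsOn.mono_set {V : Type*} {f : (V → ℝ) → ℝ} {S T : Set V} (hf : DependsOn f S)
    (hST : S ⊆ T) : DependsOn f T := fun _ _ h => hf fun i hi => h i (hST hi)

namespace LocalLaw

variable {V : Type*} [Fintype V] [DecidableEq V] {G : SimpleGraph V} [DecidableRel G.Adj]
  {μ : Measure (V → ℝ)} [IsProbabilityMeasure μ] {q θ : ℝ}

lemma coordSum_univ_sub_localSum (j : V) (x : V → ℝ) :
    coordSum (Finset.univ \ nbhdBall G 1 j) x = coordSum Finset.univ x - localSum G j x :=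
  coordSum_sdiff (Finset.subset_univ _) x

/-- A coordinate is independent of the functions of the vertices outside its neighbourhood, under
any tilt that does not involve the neighbourhood. -/
lemma integral_localTilt_coord_mul (h : LocalLaw G μ q θ) {ζ u : (V → ℝ) → ℝ} (j : V)
    (hζ : Measurable ζ) (hζ0 : ∀ x, 0 ≤ ζ x) (hu : Measurable u)
    (hζd : DependsOn ζ ((Finset.univ \ nbhdBall G 1 j : Finset V) : Set V))
    (hud : DependsOn u ((Finset.univ \ nbhdBall G 1 j : Finset V) : Set V)) :
    ∫ x, x j * u x ∂(localTilt μ ζ) = (∫ x, x j ∂μ) * ∫ x, u x ∂(localTilt μ ζ) := by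
  rw [integral_localTilt hζ hζ0, integral_localTilt hζ hζ0, mul_div_assoc']
  congr 1
  have hind : IndepFun (fun x : V → ℝ => x j) (fun x => ζ x * u x) μ := by
    refine h.dep.indepFun (S := {j}) ?_ (measurable_pi_apply j) (hζ.mul hu)
      (dependsOn_coord (Finset.mem_singleton_self j)) (hζd.mul_fun hud)
    rw [← nbhdBall_zero (G := G), ← nbhdBall_succ]
    exact Finset.disjoint_sdiff
  rw [← hind.integral_fun_mul_eq_mul_integral (measurable_pi_apply j).aestronglyMeasurable
    (hζ.mul hu).aestronglyMeasurable]
  congr 1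
  ext x
  ring

/-- The concentration inequality for the windows whose position depends on the vertices of `S`
only, under a change of measure whose density depends on `S` only. -/
theorem concentration_localTilt (h : LocalLaw G μ q θ) {S J : Finset V}
    (hJ : Disjoint (closedNbhd G (closedNbhd G S)) J) {ζ : (V → ℝ) → ℝ} (hζ : Measurable ζ)
    (hζ0 : ∀ x, 0 ≤ ζ x) (hζS : DependsOn ζ (S : Set V)) (hζi : Integrable ζ μ)
    (hζpos : 0 < ∫ x, ζ x ∂μ) {lam α κ A B N M₂ β : ℝ} (hlam : 0 ≤ lam) (hα : 0 < α)
    (hα1 : α ≤ 1) (hY : lam = 0 ∨ ∀ j, ∀ᵐ x ∂μ, |localSum G j x| ≤ 1)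
    (hE : Integrable (fun x => Real.exp (2 * lam * coordSum Finset.univ x)) (localTilt μ ζ))
    (hM₂ : ∫ x, Real.exp (2 * lam * coordSum Finset.univ x) ∂(localTilt μ ζ) ≤ M₂)
    (hAi : Integrable (fun x => max (coordSum J x) 0 * Real.exp (lam * coordSum Finset.univ x))
      (localTilt μ ζ))
    (hA : ∫ x, max (coordSum J x) 0 * Real.exp (lam * coordSum Finset.univ x) ∂(localTilt μ ζ) ≤ A)
    (hB : ∑ j ∈ J, |∫ x, x j ∂μ| ≤ B)
    (hNi : Integrable (fun x => Real.exp (lam * coordSum Finset.univ x)) (localTilt μ ζ))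
    (hN : ∫ x, Real.exp (lam * coordSum Finset.univ x) ∂(localTilt μ ζ) ≤ N)
    (hβ : 4 * (G.maxDegree : ℝ) ^ 4 * (Fintype.card V * θ ^ (2 + q)) ≤ β)
    (hκ : κ ≤ ∑ j ∈ J, ∫ x, x j * localSum G j x ∂μ)
    (hpos : Real.exp (2 * lam) * β / α ≤ κ - β) {a : (V → ℝ) → ℝ} (ham : Measurable a)
    (haS : DependsOn a (S : Set V)) (hab : ∃ C, ∀ x, lam * a x ≤ C) :
    (κ - β - Real.exp (2 * lam) * β / α) *
      ∫ x, Real.exp (lam * a x) * window α (coordSum Finset.univ x - a x) ∂(localTilt μ ζ)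
      ≤ α * (2 * Real.exp lam * A + 2 * Real.exp (2 * lam) * (B * N))
        + 3 / 8 * α * Real.exp (4 * lam) * M₂ + 3 * β := by
  set Q := localTilt μ ζ with hQ
  set W : (V → ℝ) → ℝ := coordSum Finset.univ with hW
  have hP : IsProbabilityMeasure Q := isProbabilityMeasure_localTilt hζ0 hζi hζpos
  have hD := h.one_le_maxDegree_real
  have hθ : 0 < θ ^ (2 + q) := Real.rpow_pos_of_pos h.theta_pos _
  have hm0 : 0 ≤ (Fintype.card V : ℝ) * θ ^ (2 + q) := by positivity
  have hβ2 : 4 * (G.maxDegree : ℝ) ^ 2 * (Fintype.card V * θ ^ (2 + q)) ≤ β := by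
    refine le_trans ?_ hβ
    gcongr
    norm_num
  have hβ0 : 0 ≤ β := le_trans (by positivity) hβ
  have hac : Q ≪ μ := withDensity_absolutelyContinuous _ _
  have hWm : Measurable W := measurable_coordSum _
  have hJS : Disjoint (closedNbhd G S) (closedNbhd G J) := by
    rw [← disjoint_closedNbhd_comm]; exact hJ
  have hball1 : ∀ j ∈ J, nbhdBall G 1 j ⊆ closedNbhd G J := fun j hj => by
    rw [nbhdBall_succ, nbhdBall_zero]
    exact closedNbhd_mono (Finset.singleton_subset_iff.2 hj)
  have hSsub : ∀ j ∈ J, S ⊆ Finset.univ \ nbhdBall G 1 j := fun j hj => by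
    rw [Finset.subset_sdiff]
    exact ⟨Finset.subset_univ _, hJS.mono (subset_closedNbhd S) (hball1 j hj)⟩
  -- the functions of the neighbourhood of `J` keep their law
  have hid : ∀ g : (V → ℝ) → ℝ, Measurable g → DependsOn g (closedNbhd G J : Set V) →
      IdentDistrib g g Q μ := fun g hg hgd =>
    identDistrib_localTilt hζ hζ0 hζi hζpos hg (h.dep.indepFun hJS hζ hg hζS hgd)
  have hκd : ∀ t, DependsOn (randomKernel J (fun j (x : V → ℝ) => x j) (localSum G) t)
      (closedNbhd G J : Set V) := by
    intro t x y hxy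
    refine Finset.sum_congr rfl fun j hj => ?_
    have h1 : localSum G j x = localSum G j y := dependsOn_coordSum (hball1 j hj) hxy
    have h2 : x j = y j := hxy j (subset_closedNbhd _ hj)
    simp only [h1, h2]
  have hκid : ∀ t, IdentDistrib (randomKernel J (fun j (x : V → ℝ) => x j) (localSum G) t)
      (randomKernel J (fun j (x : V → ℝ) => x j) (localSum G) t) Q μ := fun t =>
    hid _ (measurable_randomKernel_localSum J t) (hκd t)
  have hXid : ∀ j ∈ J, IdentDistrib (fun x : V → ℝ => x j) (fun x : V → ℝ => x j) Q μ :=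
    fun j hj => hid _ (measurable_pi_apply j) (dependsOn_coord (subset_closedNbhd _ hj))
  have hYid : ∀ j ∈ J, IdentDistrib (localSum G j) (localSum G j) Q μ :=
    fun j hj => hid _ (measurable_localSum j) (dependsOn_coordSum (hball1 j hj))
  have hX2 : ∀ j ∈ J, MemLp (fun x : V → ℝ => x j) 2 Q := fun j hj =>
    (hXid j hj).symm.memLp_snd (h.memLp_two_coord j)
  have hY2 : ∀ j ∈ J, MemLp (localSum G j) 2 Q := fun j hj =>
    (hYid j hj).symm.memLp_snd (h.memLp_two_coordSum _)
  set 𝒜 : Set ((V → ℝ) → ℝ) :=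
    {a | Measurable a ∧ DependsOn a (S : Set V) ∧ ∃ C, ∀ x, lam * a x ≤ C} with h𝒜
  have hbdd_mul : ∀ a ∈ 𝒜, ∀ g : (V → ℝ) → ℝ, Integrable g Q →
      Integrable (fun x => Real.exp (lam * a x) * g x) Q := by
    rintro a ⟨ha1, -, C, hC⟩ g hg
    refine hg.bdd_mul (c := Real.exp C) (by fun_prop) (ae_of_all _ fun x => ?_)
    rw [Real.norm_of_nonneg (Real.exp_pos _).le]
    exact Real.exp_le_exp.2 (hC x)
  have hexp : ∀ v w : ℝ, v ≤ w → Real.exp (lam * v) ≤ Real.exp (lam * w) := fun v w hvw =>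
    Real.exp_le_exp.2 (mul_le_mul_of_nonneg_left hvw hlam)
  -- where `plateauInt` does not vanish, the weight at `a` is bounded by the weight at `W`
  have hφ : ∀ w b c : ℝ, lam * c ≤ lam → Real.exp (lam * b) * plateauInt α (w - b - -c)
      ≤ 2 * α * (Real.exp (2 * lam) * Real.exp (lam * w)) := by
    intro w b c hc
    by_cases hv : w - b - -c ≤ -α
    · rw [plateauInt_eq_zero hα hv, mul_zero]
      positivity
    · have h1 : lam * b ≤ 2 * lam + lam * w := by
        have := mul_le_mul_of_nonneg_left (by linarith : b ≤ w + c + α) hlam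
        nlinarith
      rw [← Real.exp_add, mul_comm]
      exact mul_le_mul (plateauInt_le hα _) (Real.exp_le_exp.2 h1) (Real.exp_pos _).le
        (by positivity)
  have hφ0 : ∀ w b : ℝ, Real.exp (lam * b) * plateauInt α (w - b)
      ≤ 2 * α * (Real.exp lam * Real.exp (lam * w)) := by
    intro w b
    by_cases hv : w - b ≤ -α
    · rw [plateauInt_eq_zero hα hv, mul_zero]
      positivity
    · have h1 : lam * b ≤ lam + lam * w := by
        have := mul_le_mul_of_nonneg_left (by linarith : b ≤ w + 1) hlam
        nlinarith
      rw [← Real.exp_add, mul_comm]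
      exact mul_le_mul (plateauInt_le hα _) (Real.exp_le_exp.2 h1) (Real.exp_pos _).le
        (by positivity)
  have hY' : ∀ j, ∀ᵐ x ∂Q, lam * -localSum G j x ≤ lam := by
    intro j
    rcases hY with h0 | hY
    · simp [h0]
    · filter_upwards [hac.ae_le (hY j)] with x hx
      exact mul_le_of_le_one_right hlam ((neg_le_abs _).trans hx)
  have hN0 : 0 ≤ N := (integral_nonneg fun x => (Real.exp_pos _).le).trans hN
  have hmain : ∀ a ∈ 𝒜, ∫ x, Real.exp (lam * a x) * (∑ j ∈ J, x j *
      (plateauInt α (W x - a x) - plateauInt α (W x - a x - localSum G j x))) ∂Q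
      ≤ α * (2 * Real.exp lam * A + 2 * Real.exp (2 * lam) * (B * N)) := by
    intro a ha
    have ham := ha.1
    have hpm : Measurable fun x => plateauInt α (W x - a x) :=
      (continuous_plateauInt α).measurable.comp (hWm.sub ham)
    have hum : ∀ j, Measurable fun x =>
        Real.exp (lam * a x) * plateauInt α (W x - a x - localSum G j x) := fun j =>
      (ham.const_mul lam).exp.mul ((continuous_plateauInt α).measurable.comp
        ((hWm.sub ham).sub (measurable_localSum j)))
    have hpb : ∀ v, ‖plateauInt α v‖ ≤ 2 * α := fun v => by
      rw [Real.norm_of_nonneg (plateauInt_nonneg hα v)]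
      exact plateauInt_le hα v
    have hWJ : Integrable (coordSum J) Q :=
      integrable_finsetSum _ fun j hj => (hX2 j hj).integrable one_le_two
    have i1 : Integrable (fun x =>
        Real.exp (lam * a x) * (plateauInt α (W x - a x) * coordSum J x)) Q :=
      hbdd_mul a ha _ (hWJ.bdd_mul hpm.aestronglyMeasurable (ae_of_all _ fun x => hpb _))
    have i2 : ∀ j ∈ J, Integrable (fun x =>
        x j * (Real.exp (lam * a x) * plateauInt α (W x - a x - localSum G j x))) Q := by
      intro j hj
      have := hbdd_mul a ha _ (((hX2 j hj).integrable one_le_two).bdd_mul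
        (f := fun x => plateauInt α (W x - a x - localSum G j x))
        ((continuous_plateauInt α).measurable.comp
        ((hWm.sub ham).sub (measurable_localSum j))).aestronglyMeasurable
        (ae_of_all _ fun x => hpb _))
      refine this.congr (ae_of_all _ fun x => ?_)
      ring
    have e1 : ∀ x, Real.exp (lam * a x) * (∑ j ∈ J, x j *
        (plateauInt α (W x - a x) - plateauInt α (W x - a x - localSum G j x)))
        = Real.exp (lam * a x) * (plateauInt α (W x - a x) * coordSum J x)
          - ∑ j ∈ J, x j *
            (Real.exp (lam * a x) * plateauInt α (W x - a x - localSum G j x)) := by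
      intro x
      simp only [coordSum, Finset.mul_sum, ← Finset.sum_sub_distrib]
      exact Finset.sum_congr rfl fun j _ => by ring
    simp_rw [e1]
    rw [integral_sub i1 (integrable_finsetSum _ i2), integral_finsetSum _ i2]
    have b1 : ∫ x, Real.exp (lam * a x) * (plateauInt α (W x - a x) * coordSum J x) ∂Q
        ≤ α * (2 * Real.exp lam * A) := by
      calc _ ≤ ∫ x, 2 * α * Real.exp lam * (max (coordSum J x) 0 * Real.exp (lam * W x)) ∂Q := by
            refine integral_mono i1 (hAi.const_mul _) fun x => ?_
            have h1 : coordSum J x ≤ max (coordSum J x) 0 := le_max_left _ _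
            have h2 := mul_nonneg (Real.exp_pos (lam * a x)).le (plateauInt_nonneg hα (W x - a x))
            have h3 := mul_le_mul_of_nonneg_left h1 h2
            have h4 := mul_le_mul_of_nonneg_right (hφ0 (W x) (a x))
              (le_max_right (coordSum J x) 0)
            dsimp only
            linarith
        _ ≤ 2 * α * Real.exp lam * A := by
            rw [integral_const_mul]
            gcongr
        _ = _ := by ring
    have b2 : ∀ j ∈ J, -(∫ x, x j *
        (Real.exp (lam * a x) * plateauInt α (W x - a x - localSum G j x)) ∂Q)
        ≤ |∫ x, x j ∂μ| * (2 * α * (Real.exp (2 * lam) * N)) := by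
      intro j hj
      have hud : DependsOn
          (fun x => Real.exp (lam * a x) * plateauInt α (W x - a x - localSum G j x))
          ((Finset.univ \ nbhdBall G 1 j : Finset V) : Set V) := by
        have h1 : ∀ x, W x - a x - localSum G j x
            = coordSum (Finset.univ \ nbhdBall G 1 j) x - a x := fun x => by
          rw [coordSum_univ_sub_localSum]; ring
        simp_rw [h1]
        intro x y hxy
        have h2 : a x = a y := ha.2.1 fun i hi => hxy i (hSsub j hj hi)
        have h3 : coordSum (Finset.univ \ nbhdBall G 1 j) x
            = coordSum (Finset.univ \ nbhdBall G 1 j) y := dependsOn_coordSum subset_rfl hxy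
        simp only [h2, h3]
      rw [hQ, h.integral_localTilt_coord_mul j hζ hζ0 (hum j)
        (hζS.mono_set (by exact_mod_cast hSsub j hj)) hud, ← hQ, ← neg_mul]
      have hu0 : 0 ≤ ∫ x, Real.exp (lam * a x) * plateauInt α (W x - a x - localSum G j x) ∂Q :=
        integral_nonneg fun x => mul_nonneg (Real.exp_pos _).le (plateauInt_nonneg hα _)
      refine mul_le_mul (neg_le_abs _) ?_ hu0 (abs_nonneg _)
      calc _ ≤ ∫ x, 2 * α * Real.exp (2 * lam) * Real.exp (lam * W x) ∂Q := by
            refine integral_mono_of_nonneg (ae_of_all _ fun x =>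
              mul_nonneg (Real.exp_pos _).le (plateauInt_nonneg hα _)) (hNi.const_mul _) ?_
            filter_upwards [hY' j] with x hx
            have := hφ (W x) (a x) (-localSum G j x) hx
            rw [neg_neg] at this
            linarith
        _ ≤ 2 * α * Real.exp (2 * lam) * N := by
            rw [integral_const_mul]
            gcongr
        _ = _ := by ring
    have b3 : -(∑ j ∈ J, ∫ x, x j *
        (Real.exp (lam * a x) * plateauInt α (W x - a x - localSum G j x)) ∂Q)
        ≤ B * (2 * α * (Real.exp (2 * lam) * N)) := by
      rw [← Finset.sum_neg_distrib]
      refine (Finset.sum_le_sum b2).trans ?_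
      rw [← Finset.sum_mul]
      gcongr
    linarith
  have hr₃ : ∀ a ∈ 𝒜, ∫ x, Real.exp (lam * a x) *
      (∑ j ∈ J, |x j| * max (|localSum G j x| - 1) 0) ∂Q ≤ β := by
    intro a ha
    rcases hY with h0 | hY
    · simp only [h0, zero_mul, Real.exp_zero, one_mul]
      have hgd : DependsOn (fun x : V → ℝ => ∑ j ∈ J, |x j| * max (|localSum G j x| - 1) 0)
          (closedNbhd G J : Set V) := by
        intro x y hxy
        refine Finset.sum_congr rfl fun j hj => ?_
        have h1 : localSum G j x = localSum G j y := dependsOn_coordSum (hball1 j hj) hxy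
        have h2 : x j = y j := hxy j (subset_closedNbhd _ hj)
        simp only [h1, h2]
      have hgm : Measurable (fun x : V → ℝ => ∑ j ∈ J, |x j| * max (|localSum G j x| - 1) 0) :=
        Finset.measurable_fun_sum _ fun j _ => (measurable_pi_apply j).abs.mul
          (((measurable_localSum j).abs.sub_const 1).max measurable_const)
      rw [(hid _ hgm hgd).integral_eq,
        integral_finsetSum _ fun j _ => (h.integral_coord_mul_excess_le j).1]
      refine (sum_le_card_mul J (by positivity)
        fun j => (h.integral_coord_mul_excess_le j).2).trans ?_
      linarith
    · have h1 : (fun x => Real.exp (lam * a x) *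
          (∑ j ∈ J, |x j| * max (|localSum G j x| - 1) 0)) =ᵐ[Q] fun _ => 0 := by
        have h2 : ∀ᵐ x ∂Q, ∀ j, |localSum G j x| ≤ 1 :=
          hac.ae_le (ae_all_iff.2 hY)
        filter_upwards [h2] with x hx
        rw [Finset.sum_eq_zero fun j _ => ?_, mul_zero]
        rw [max_eq_right (by linarith [hx j]), mul_zero]
      rw [integral_congr_ae h1, integral_zero]
      exact hβ0
  have hres := concentration_of_local Q J (fun j x => x j) (localSum G) W
    (fun j => measurable_pi_apply j) measurable_localSum hWm (lam := lam) (α := α)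
    (M₁ := 2 * Real.exp lam * A + 2 * Real.exp (2 * lam) * (B * N)) (M₂ := M₂) (v := β)
    (r₂ := β / 2) (r₃ := β) (k₀ := κ - β) hlam hα hα1 hX2 𝒜 (fun a ha => ha.1) ?_ ?_ ?_ ?_
    hmain hE hM₂ hr₃ ?_ ?_ ?_ ?_ ?_ (a := a) ⟨ham, haS, hab⟩
  · have e : 2 * Real.exp (2 * lam) * (β / 2) / α = Real.exp (2 * lam) * β / α := by ring
    rw [e] at hres
    linarith
  · rintro a ⟨ha1, ha2, C, hC⟩ c
    refine ⟨ha1.add_const c, fun x y hxy => by simp only [ha2 hxy], C + lam * c, fun x => ?_⟩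
    rw [mul_add]
    linarith [hC x]
  · intro a ha
    simpa using hbdd_mul a ha _ (integrable_const 1)
  · intro a ha j hj
    exact hbdd_mul a ha _ ((hX2 j hj).integrable one_le_two).abs
  · intro a ha j hj
    refine hbdd_mul a ha _ ?_
    simpa only [Pi.mul_apply, abs_mul] using ((hX2 j hj).integrable_mul (hY2 j hj)).abs
  · simp_rw [fun t => (hκid t).variance_eq]
    exact (h.integral_variance_randomKernel_le J).trans hβ
  · simp_rw [fun t => (hκid t).integral_eq]
    linarith [h.integral_randomKernel_ge J]
  · simp_rw [fun t => (hκid t).integral_eq]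
    linarith [h.integral_abs_randomKernel_mul_le J]
  · have e : 2 * Real.exp (2 * lam) * (β / 2) / α = Real.exp (2 * lam) * β / α := by ring
    rw [e]
    exact hpos
  · exact le_trans (by positivity) hpos

end LocalLaw

/-! ### Concentration for centred summands -/

namespace LocalLaw

variable {V : Type*} [Fintype V] [DecidableEq V] {G : SimpleGraph V} [DecidableRel G.Adj]
  {μ : Measure (V → ℝ)} [IsProbabilityMeasure μ] {q θ : ℝ}

/-- A coordinate is independent of the sums over sets of vertices off its neighbourhood. -/
lemma integral_coord_mul_of_disjoint (h : LocalLaw G μ q θ) (j : V) {A : Finset V}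
    {f : (V → ℝ) → ℝ} (hf : Measurable f) (hfA : DependsOn f (A : Set V))
    (hA : Disjoint (nbhdBall G 1 j) A) :
    ∫ x, x j * f x ∂μ = (∫ x, x j ∂μ) * ∫ x, f x ∂μ := by
  have hind : IndepFun (fun x : V → ℝ => x j) f μ := by
    refine h.dep.indepFun (S := {j}) (T := A) ?_ (measurable_pi_apply j) hf
      (dependsOn_coord (Finset.mem_singleton_self j)) hfA
    rwa [← nbhdBall_zero (G := G), ← nbhdBall_succ]
  exact hind.integral_fun_mul_eq_mul_integral (measurable_pi_apply j).aestronglyMeasurable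
    hf.aestronglyMeasurable

lemma abs_integral_coord_mul_coordSum_le (h : LocalLaw G μ q θ) (j : V) (A : Finset V) :
    ∫ x, |x j| * |coordSum A x| ∂μ ≤ A.card * θ ^ 2 := by
  have hi : ∀ k, Integrable (fun x : V → ℝ => |x j| * |x k|) μ := fun k => by
    simpa only [abs_mul] using (h.integrable_coord_mul_coord j k).abs
  have hiA : Integrable (fun x : V → ℝ => |x j| * |coordSum A x|) μ := by
    simpa only [abs_mul] using (h.integrable_coord_mul_coordSum j A).abs
  calc _ ≤ ∫ x : V → ℝ, ∑ k ∈ A, |x j| * |x k| ∂μ := by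
        refine integral_mono hiA (integrable_finsetSum _ fun k _ => hi k) fun x => ?_
        dsimp only
        rw [← Finset.mul_sum]
        exact mul_le_mul_of_nonneg_left (abs_coordSum_le A x) (abs_nonneg _)
    _ ≤ _ := by
        rw [integral_finsetSum _ fun k _ => hi k, ← nsmul_eq_mul]
        exact Finset.sum_le_card_nsmul _ _ _ fun k _ => h.integral_abs_coord_mul_abs_coord_le j k

/-- The covariance of a coordinate and a sum of coordinates comes from the neighbourhood. -/
lemma integral_coord_mul_coordSum (h : LocalLaw G μ q θ) (j : V) (A : Finset V) :
    ∫ x, x j * coordSum A x ∂μ = ∫ x, x j * coordSum (A ∩ nbhdBall G 1 j) x ∂μ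
      + (∫ x, x j ∂μ) * ∫ x, coordSum (A \ nbhdBall G 1 j) x ∂μ := by
  rw [← h.integral_coord_mul_of_disjoint j (measurable_coordSum _) (dependsOn_coordSum subset_rfl)
    Finset.disjoint_sdiff, ← integral_add (h.integrable_coord_mul_coordSum j _)
      (h.integrable_coord_mul_coordSum j _)]
  refine integral_congr_ae (ae_of_all _ fun x => ?_)
  simp only [coordSum]
  have := Finset.sum_sdiff (f := x) (Finset.inter_subset_left (s₁ := A) (s₂ := nbhdBall G 1 j))
  rw [Finset.sdiff_inter_self_left] at this
  rw [← mul_add, add_comm, this]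

lemma integral_coordSum_sq_eq (h : LocalLaw G μ q θ) (A : Finset V) :
    ∫ x, coordSum A x ^ 2 ∂μ = ∑ j ∈ A, ∫ x, x j * coordSum A x ∂μ := by
  rw [← integral_finsetSum _ fun j _ => h.integrable_coord_mul_coordSum j A]
  refine integral_congr_ae (ae_of_all _ fun x => ?_)
  dsimp only
  rw [← Finset.sum_mul, sq]
  rfl

lemma integral_coord_mul_localSum (h : LocalLaw G μ q θ) (hmean : ∀ i, ∫ x, x i ∂μ = 0) (j : V) :
    ∫ x, x j * localSum G j x ∂μ = ∫ x, x j * coordSum Finset.univ x ∂μ := by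
  rw [h.integral_coord_mul_coordSum j Finset.univ, hmean, zero_mul, add_zero, Finset.univ_inter]
  rfl

lemma integral_coordSum_sq_le (h : LocalLaw G μ q θ) (hmean : ∀ i, ∫ x, x i ∂μ = 0)
    (A : Finset V) : ∫ x, coordSum A x ^ 2 ∂μ ≤ A.card * (2 * G.maxDegree * θ ^ 2) := by
  rw [h.integral_coordSum_sq_eq, ← nsmul_eq_mul]
  refine Finset.sum_le_card_nsmul _ _ _ fun j _ => ?_
  rw [h.integral_coord_mul_coordSum, hmean, zero_mul, add_zero]
  have h1 : ∫ x, x j * coordSum (A ∩ nbhdBall G 1 j) x ∂μ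
      ≤ ∫ x, |x j| * |coordSum (A ∩ nbhdBall G 1 j) x| ∂μ := by
    refine integral_mono (h.integrable_coord_mul_coordSum j _) ?_ fun x => ?_
    · simpa only [abs_mul] using (h.integrable_coord_mul_coordSum j _).abs
    · dsimp only
      rw [← abs_mul]
      exact le_abs_self _
  refine h1.trans ((h.abs_integral_coord_mul_coordSum_le j _).trans ?_)
  gcongr
  refine le_trans ?_ (h.card_ball_one_le j)
  exact_mod_cast Finset.card_le_card Finset.inter_subset_right

lemma integral_abs_coordSum_compl_le (h : LocalLaw G μ q θ) (hmean : ∀ i, ∫ x, x i ∂μ = 0)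
    (hvar : ∫ x, coordSum Finset.univ x ^ 2 ∂μ = 1)
    (hε : 4 * (G.maxDegree : ℝ) ^ 5 * θ ^ 2 ≤ 1 / 7) {A : Finset V}
    (hA : (A.card : ℝ) ≤ 2 * (G.maxDegree : ℝ) ^ 4) :
    ∫ x, |coordSum (Finset.univ \ A) x| ∂μ ≤ 3 / 2 := by
  have h1 : ∫ x, coordSum A x ^ 2 ∂μ ≤ 1 / 7 := by
    refine (h.integral_coordSum_sq_le hmean A).trans (le_trans ?_ hε)
    calc _ ≤ 2 * (G.maxDegree : ℝ) ^ 4 * (2 * G.maxDegree * θ ^ 2) := by gcongr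
      _ = _ := by ring
  have i1 := (h.memLp_two_coordSum A).integrable_sq
  have i2 := (h.memLp_two_coordSum Finset.univ).integrable_sq
  have h2 : ∫ x, |coordSum (Finset.univ \ A) x| ∂μ
      ≤ ∫ x, ((1 / 2 * coordSum Finset.univ x ^ 2 + coordSum A x ^ 2) + 3 / 4) ∂μ := by
    refine integral_mono (h.integrable_coordSum _).abs
      (((i2.const_mul _).add i1).add (integrable_const _)) fun x => ?_
    dsimp only
    rw [coordSum_sdiff (Finset.subset_univ A)]
    rw [abs_le]
    set u := coordSum Finset.univ x
    set v := coordSum A x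
    constructor <;> nlinarith [sq_nonneg (u + 2 * v), sq_nonneg (u - v - 3 / 2),
      sq_nonneg (u - v + 3 / 2)]
  have i3 : Integrable (fun x : V → ℝ => 1 / 2 * coordSum Finset.univ x ^ 2 + coordSum A x ^ 2) μ :=
    (i2.const_mul _).add i1
  rw [integral_add i3 (integrable_const _), integral_add (i2.const_mul _) i1,
    integral_const_mul, hvar] at h2
  simp only [integral_const, probReal_univ, smul_eq_mul] at h2
  linarith

/-- The concentration inequality for centred summands with `E W ^ 2 = 1`, under any weight that
depends on the ball that determines the position of the window. The width `6 * β` is chosen so that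
the self-referring term `β / α` of `concentration_localTilt` is `1 / 6`, well below the local
variance `6 / 7`. -/
theorem concentration_centred (h : LocalLaw G μ q θ) (hmean : ∀ i, ∫ x, x i ∂μ = 0)
    (hvar : ∫ x, coordSum Finset.univ x ^ 2 ∂μ = 1)
    (hε : 4 * (G.maxDegree : ℝ) ^ 5 * θ ^ 2 ≤ 1 / 7) {β : ℝ}
    (hβ : β = 4 * (G.maxDegree : ℝ) ^ 5 * (Fintype.card V * θ ^ (2 + q))) (hβ1 : β ≤ 4 / 75)
    (i : V) {ζ : (V → ℝ) → ℝ} (hζ : Measurable ζ) (hζ0 : ∀ x, 0 ≤ ζ x)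
    (hζS : DependsOn ζ (nbhdBall G 2 i : Set V)) (hζi : Integrable ζ μ) {a : (V → ℝ) → ℝ}
    (ham : Measurable a) (haS : DependsOn a (nbhdBall G 2 i : Set V)) :
    ∫ x, ζ x * window (6 * β) (coordSum Finset.univ x - a x) ∂μ
      ≤ 45 / 2 * β * ∫ x, ζ x ∂μ := by
  have hD := h.one_le_maxDegree_real
  have hθ : 0 < θ ^ (2 + q) := Real.rpow_pos_of_pos h.theta_pos _
  have hV : (0 : ℝ) < Fintype.card V := by
    exact_mod_cast (Nat.zero_lt_two.trans_le (two_le_card_of_maxDegree h.one_le_maxDegree))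
  have hβ0 : 0 < β := by rw [hβ]; positivity
  rcases (integral_nonneg hζ0 : 0 ≤ ∫ x, ζ x ∂μ).eq_or_lt with h0 | hpos
  · have hz := (integral_eq_zero_iff_of_nonneg hζ0 hζi).1 h0.symm
    rw [← h0, mul_zero]
    refine (integral_eq_zero_of_ae ?_).le
    filter_upwards [hz] with x hx
    simp [hx]
  set S := nbhdBall G 2 i with hS
  set J := Finset.univ \ closedNbhd G (closedNbhd G S) with hJ
  have hS4 : closedNbhd G (closedNbhd G S) = nbhdBall G 4 i := by
    rw [hS, ← nbhdBall_succ, ← nbhdBall_succ]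
  have hcard : ((nbhdBall G 4 i).card : ℝ) ≤ 2 * (G.maxDegree : ℝ) ^ 4 :=
    card_nbhdBall_le_real h.one_le_maxDegree 3 i
  have hJd : Disjoint (closedNbhd G S) J :=
    Disjoint.mono_left (subset_closedNbhd _) Finset.disjoint_sdiff
  have hid : IdentDistrib (coordSum J) (coordSum J) (localTilt μ ζ) μ :=
    identDistrib_localTilt hζ hζ0 hζi hpos (measurable_coordSum J)
      (h.dep.indepFun hJd hζ (measurable_coordSum J) hζS (dependsOn_coordSum subset_rfl))
  have hP := isProbabilityMeasure_localTilt hζ0 hζi hpos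
  have hidm := hid.comp (u := fun t : ℝ => max t 0) (by fun_prop)
  have hmJ : ∫ x, max (coordSum J x) 0 ∂μ ≤ 3 / 4 := by
    have e : ∀ x : V → ℝ, max (coordSum J x) 0
        = 1 / 2 * coordSum J x + 1 / 2 * |coordSum J x| := fun x => by
      rcases le_total (coordSum J x) 0 with hx | hx
      · rw [max_eq_right hx, abs_of_nonpos hx]; ring
      · rw [max_eq_left hx, abs_of_nonneg hx]; ring
    have hJ0 : ∫ x, coordSum J x ∂μ = 0 := by
      simp only [coordSum]
      rw [integral_finsetSum _ fun j _ => h.integrable_coord j]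
      exact Finset.sum_eq_zero fun j _ => hmean j
    simp_rw [e]
    rw [integral_add ((h.integrable_coordSum J).const_mul _)
      ((h.integrable_coordSum J).abs.const_mul _), integral_const_mul, integral_const_mul, hJ0]
    have := h.integral_abs_coordSum_compl_le hmean hvar hε hcard
    rw [← hS4, ← hJ] at this
    linarith
  have hκ : 6 / 7 ≤ ∑ j ∈ J, ∫ x, x j * localSum G j x ∂μ := by
    have h1 : ∑ j, ∫ x, x j * localSum G j x ∂μ = 1 := by
      rw [← hvar, h.integral_coordSum_sq_eq]
      exact Finset.sum_congr rfl fun j _ => h.integral_coord_mul_localSum hmean j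
    have h2 : ∑ j ∈ nbhdBall G 4 i, ∫ x, x j * localSum G j x ∂μ ≤ 1 / 7 := by
      refine (Finset.sum_le_card_nsmul _ _ (2 * G.maxDegree * θ ^ 2) fun j _ => ?_).trans ?_
      · refine (integral_mono (h.integrable_coord_mul_localSum j j) ?_ fun x => ?_).trans
          ((h.abs_integral_coord_mul_coordSum_le j (nbhdBall G 1 j)).trans ?_)
        · simpa only [abs_mul] using (h.integrable_coord_mul_coordSum j _).abs
        · dsimp only
          rw [← abs_mul]
          exact le_abs_self _
        · gcongr
          exact h.card_ball_one_le j
      · rw [nsmul_eq_mul]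
        refine le_trans ?_ hε
        calc _ ≤ 2 * (G.maxDegree : ℝ) ^ 4 * (2 * G.maxDegree * θ ^ 2) := by gcongr
          _ = _ := by ring
    have h3 := Finset.sum_sdiff (f := fun j => ∫ x, x j * localSum G j x ∂μ)
      (Finset.subset_univ (nbhdBall G 4 i))
    rw [hJ, hS4]
    linarith
  have hres := h.concentration_localTilt (S := S) (J := J) Finset.disjoint_sdiff hζ hζ0 hζS hζi
    hpos (lam := 0) (α := 6 * β) (κ := 6 / 7) (A := 3 / 4) (B := 0) (N := 1) (M₂ := 1) (β := β)
    le_rfl (by linarith) (by linarith) (Or.inl rfl) (by simp) (by simp) ?_ ?_ ?_ (by simp)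
    (by simp) ?_ hκ ?_ ham haS ⟨0, fun x => by simp⟩
  · rw [integral_localTilt hζ hζ0] at hres
    simp only [mul_zero, zero_mul, Real.exp_zero, one_mul] at hres
    rw [mul_div_assoc', div_le_iff₀ hpos] at hres
    have e : β / (6 * β) = 1 / 6 := by field_simp
    rw [e] at hres
    have hw0 : 0 ≤ ∫ x, ζ x * window (6 * β) (coordSum Finset.univ x - a x) ∂μ :=
      integral_nonneg fun x => mul_nonneg (hζ0 x) (window_nonneg _ _)
    have h4 : 669 / 1050 * ∫ x, ζ x * window (6 * β) (coordSum Finset.univ x - a x) ∂μ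
        ≤ (6 / 7 - β - 1 / 6) * ∫ x, ζ x * window (6 * β) (coordSum Finset.univ x - a x) ∂μ :=
      mul_le_mul_of_nonneg_right (by linarith) hw0
    have h5 : 0 ≤ β * ∫ x, ζ x ∂μ := by positivity
    linarith
  · simpa [Function.comp_def] using
      hidm.symm.integrable_snd (((h.integrable_coordSum J).pos_part))
  · simp only [zero_mul, Real.exp_zero, mul_one]
    exact hidm.integral_eq.trans_le hmJ
  · simp [hmean]
  · rw [hβ]
    have h1 := pow_le_pow_right₀ hD (by norm_num : 4 ≤ 5)
    gcongr
  · have e : β / (6 * β) = 1 / 6 := by field_simp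
    rw [mul_zero, Real.exp_zero, one_mul, e]
    linarith

end LocalLaw

/-! ### The expansion of the Stein equation -/

namespace LocalLaw

variable {V : Type*} [Fintype V] [DecidableEq V] {G : SimpleGraph V} [DecidableRel G.Adj]
  {μ : Measure (V → ℝ)} [IsProbabilityMeasure μ] {q θ : ℝ}

/-- The linear combination of the coordinates in `S` with coefficients `c`. -/
def linSum (S : Finset V) (c : V → ℝ) (x : V → ℝ) : ℝ := ∑ l ∈ S, c l * x l

@[fun_prop]
lemma measurable_linSum (S : Finset V) (c : V → ℝ) : Measurable (linSum S c) :=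
  Finset.measurable_fun_sum S fun i _ => (measurable_pi_apply i).const_mul _

lemma dependsOn_linSum (S : Finset V) (c : V → ℝ) : DependsOn (linSum S c) (S : Set V) :=
  fun _ _ hxy => Finset.sum_congr rfl fun i hi => by rw [hxy i hi]

lemma linSum_one (S : Finset V) (x : V → ℝ) : linSum S (fun _ => 1) x = coordSum S x := by
  simp [linSum, coordSum]

lemma coordSum_compl_add (S : Finset V) (x : V → ℝ) :
    coordSum (Finset.univ \ S) x + coordSum S x = coordSum Finset.univ x := by
  rw [coordSum_sdiff (Finset.subset_univ S)]; ring

/-- The coefficients expressing `W - u * Y i` through the ball of radius two. -/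
lemma coordSum_compl_add_linSum (i : V) (u : ℝ) (x : V → ℝ) :
    coordSum (Finset.univ \ nbhdBall G 2 i) x
      + linSum (nbhdBall G 2 i) (fun l => if l ∈ nbhdBall G 1 i then 1 - u else 1) x
      = coordSum Finset.univ x - u * localSum G i x := by
  have h1 : linSum (nbhdBall G 2 i) (fun l => if l ∈ nbhdBall G 1 i then 1 - u else 1) x
      = coordSum (nbhdBall G 2 i) x - u * localSum G i x := by
    have h2 : localSum G i x = ∑ l ∈ nbhdBall G 2 i, if l ∈ nbhdBall G 1 i then x l else 0 := by
      rw [← Finset.sum_filter, Finset.filter_mem_eq_inter,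
        Finset.inter_eq_right.2 (nbhdBall_mono (by norm_num) i)]
      rfl
    rw [h2, Finset.mul_sum, coordSum, ← Finset.sum_sub_distrib]
    refine Finset.sum_congr rfl fun l _ => ?_
    dsimp only
    split_ifs <;> ring
  rw [h1, ← coordSum_compl_add (nbhdBall G 2 i) x]
  ring

lemma moment_localSum_mul_sum (h : LocalLaw G μ q θ) (i : V) :
    Integrable (fun x => |x i * localSum G i x| * ∑ l ∈ nbhdBall G 3 i, |x l| ^ q) μ ∧
      ∫ x, |x i * localSum G i x| * ∑ l ∈ nbhdBall G 3 i, |x l| ^ q ∂μ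
        ≤ 4 * (G.maxDegree : ℝ) ^ 4 * θ ^ (2 + q) := by
  obtain ⟨h1, h2⟩ := h.moment_mul_sum_mul_sum i (nbhdBall G 1 i) (nbhdBall G 3 i)
  have hle : ∀ x : V → ℝ, |x i * localSum G i x| * ∑ l ∈ nbhdBall G 3 i, |x l| ^ q
      ≤ |x i| * (∑ k ∈ nbhdBall G 1 i, |x k|) * ∑ l ∈ nbhdBall G 3 i, |x l| ^ q := by
    intro x
    rw [abs_mul]
    have := abs_coordSum_le (nbhdBall G 1 i) x
    unfold localSum
    gcongr
  have hθ : 0 < θ ^ (2 + q) := Real.rpow_pos_of_pos h.theta_pos _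
  have hi : Integrable (fun x => |x i * localSum G i x| * ∑ l ∈ nbhdBall G 3 i, |x l| ^ q) μ := by
    refine h1.mono' (Measurable.aestronglyMeasurable (by fun_prop)) (ae_of_all _ fun x => ?_)
    rw [Real.norm_of_nonneg (by positivity)]
    exact hle x
  refine ⟨hi, (integral_mono hi h1 hle).trans (h2.trans ?_)⟩
  have h3 := h.card_ball_one_le i
  have h4 := card_nbhdBall_le_real h.one_le_maxDegree 2 i
  calc _ ≤ 2 * (G.maxDegree : ℝ) * (2 * (G.maxDegree : ℝ) ^ (2 + 1) * θ ^ (2 + q)) := by gcongr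
    _ = _ := by ring

lemma abs_integral_coord_mul_localSum_le (h : LocalLaw G μ q θ) (i : V) :
    |∫ x, x i * localSum G i x ∂μ| ≤ 2 * G.maxDegree * θ ^ 2 := by
  refine (abs_integral_le_integral_abs).trans ?_
  simp_rw [abs_mul]
  refine (h.abs_integral_coord_mul_coordSum_le i (nbhdBall G 1 i)).trans ?_
  gcongr
  exact h.card_ball_one_le i

/-- The test function `F'`, evaluated at the sum of the coordinates off the ball of radius two about
`i`, changes little in the mean when a combination of the coordinates in the ball is added to its
argument: under any weight depending on the ball, the change is at most `K` times the sum of the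
`|x l| ^ q` over the ball of radius three. -/
def SmoothAt (G : SimpleGraph V) [DecidableRel G.Adj] (μ : Measure (V → ℝ)) (q : ℝ) (F' : ℝ → ℝ)
    (K : ℝ) (i : V) : Prop :=
  ∀ (ζ : (V → ℝ) → ℝ) (c : V → ℝ), Measurable ζ → (∀ x, 0 ≤ ζ x) →
    DependsOn ζ (nbhdBall G 2 i : Set V) → Integrable ζ μ →
    Integrable (fun x => ζ x * ∑ l ∈ nbhdBall G 3 i, |x l| ^ q) μ → (∀ l, |c l| ≤ 1) →
    ∫ x, ζ x * |F' (coordSum (Finset.univ \ nbhdBall G 2 i) x + linSum (nbhdBall G 2 i) c x)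
        - F' (coordSum (Finset.univ \ nbhdBall G 2 i) x)| ∂μ
      ≤ K * ∫ x, ζ x * ∑ l ∈ nbhdBall G 3 i, |x l| ^ q ∂μ

/-- A pair of functions, the second the derivative of the first in integrated form, to which the
local Stein expansion applies. The growth condition is imposed only on the arguments that the law
`μ` allows, so that exponential functions are admitted for laws of bounded support. -/
structure SteinTest (μ : Measure (V → ℝ)) (q : ℝ) (F F' : ℝ → ℝ) : Prop where
  continuous_fun : Continuous F
  continuous_deriv : Continuous F'
  sub_eq : ∀ w y, F w - F (w - y) = y * ∫ u in (0 : ℝ)..1, F' (w - u * y)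
  growth : ∃ C, ∀ᵐ x ∂μ, ∀ w, |w| ≤ ∑ i, |x i| →
    |F w| ≤ C * (1 + ∑ i, |x i|) ^ (1 + q) ∧ |F' w| ≤ C * (1 + ∑ i, |x i|) ^ q

lemma integrable_one_add_sum_rpow (h : LocalLaw G μ q θ) :
    Integrable (fun x : V → ℝ => (1 + ∑ i, |x i|) ^ (2 + q)) μ := by
  have hp : 0 < 2 + q := by linarith [h.q_pos]
  have h0 : ∀ i, MemLp (fun x : V → ℝ => |x i|) (ENNReal.ofReal (2 + q)) μ := fun i =>
    (h.memLp_coord i).abs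
  have h1 : MemLp (fun x : V → ℝ => ∑ i, |x i|) (ENNReal.ofReal (2 + q)) μ :=
    memLp_finsetSum Finset.univ fun i _ => h0 i
  have hc : MemLp (fun _ : V → ℝ => (1 : ℝ)) (ENNReal.ofReal (2 + q)) μ := memLp_const 1
  have h2 := hc.add h1
  have h3 := h2.integrable_norm_rpow (by simpa using hp) ENNReal.ofReal_ne_top
  rw [ENNReal.toReal_ofReal hp.le] at h3
  refine h3.congr (ae_of_all _ fun x => ?_)
  simp only [Pi.add_apply]
  rw [Real.norm_of_nonneg]
  have : 0 ≤ ∑ i, |x i| := Finset.sum_nonneg fun i _ => abs_nonneg _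
  linarith

lemma abs_coordSum_le_sum (S : Finset V) (x : V → ℝ) : |coordSum S x| ≤ ∑ i, |x i| :=
  (abs_coordSum_le S x).trans
    (Finset.sum_le_sum_of_subset_of_nonneg (Finset.subset_univ S) fun _ _ _ => abs_nonneg _)

lemma abs_coordSum_sub_le {u : ℝ} (hu : u ∈ Icc (0 : ℝ) 1) (i : V) (x : V → ℝ) :
    |coordSum Finset.univ x - u * localSum G i x| ≤ ∑ i, |x i| := by
  have e : coordSum Finset.univ x - u * localSum G i x = (1 - u) * coordSum Finset.univ x
      + u * coordSum (Finset.univ \ nbhdBall G 1 i) x := by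
    rw [coordSum_univ_sub_localSum]; ring
  rw [e]
  refine (abs_add_le _ _).trans ?_
  rw [abs_mul, abs_mul, abs_of_nonneg hu.1, abs_of_nonneg (sub_nonneg.2 hu.2)]
  have h1 := abs_coordSum_le_sum Finset.univ x
  have h2 := abs_coordSum_le_sum (Finset.univ \ nbhdBall G 1 i) x
  nlinarith [hu.1, hu.2]

/-- The products of a coordinate or of two sums of coordinates with the test functions are
integrable. -/
lemma SteinTest.integrable_of_bound (h : LocalLaw G μ q θ) {F F' : ℝ → ℝ}
    (hF : SteinTest μ q F F') :
    (∀ i (f : (V → ℝ) → ℝ), Measurable f → (∀ x, |f x| ≤ ∑ i, |x i|) →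
      Integrable (fun x => x i * F (f x)) μ) ∧
    (∀ g f : (V → ℝ) → ℝ, Measurable g → Measurable f →
      (∀ x, |g x| ≤ (1 + ∑ i, |x i|) ^ 2) → (∀ x, |f x| ≤ ∑ i, |x i|) →
      Integrable (fun x => g x * F' (f x)) μ) := by
  obtain ⟨C, hC⟩ := hF.growth
  have hN := h.integrable_one_add_sum_rpow.const_mul C
  have hpos : ∀ x : V → ℝ, 0 < 1 + ∑ i, |x i| := fun x => by positivity
  constructor
  · intro i f hf hfb
    refine hN.mono' ((measurable_pi_apply i).mul
      (hF.continuous_fun.measurable.comp hf)).aestronglyMeasurable ?_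
    filter_upwards [hC] with x hx
    have h1 := (hx (f x) (hfb x)).1
    have h2 : |x i| ≤ 1 + ∑ i, |x i| := by
      have := Finset.single_le_sum (f := fun i => |x i|) (fun i _ => abs_nonneg _)
        (Finset.mem_univ i)
      linarith
    rw [Real.norm_eq_abs, abs_mul, (by ring : 2 + q = 1 + (1 + q)), Real.rpow_add (hpos x),
      Real.rpow_one, mul_left_comm]
    exact mul_le_mul h2 h1 (abs_nonneg _) (hpos x).le
  · intro g f hg hf hgb hfb
    refine hN.mono' (hg.mul (hF.continuous_deriv.measurable.comp hf)).aestronglyMeasurable ?_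
    filter_upwards [hC] with x hx
    have h1 := (hx (f x) (hfb x)).2
    rw [Real.norm_eq_abs, abs_mul, Real.rpow_add (hpos x), Real.rpow_two, mul_left_comm]
    exact mul_le_mul (hgb x) h1 (abs_nonneg _) (by positivity)

/-- The contribution of one summand to the expansion of `E W F(W)`. -/
lemma abs_stein_term_le (h : LocalLaw G μ q θ) {F F' : ℝ → ℝ} (hF : SteinTest μ q F F') {K : ℝ}
    (hK0 : 0 ≤ K) {i : V} (hK : SmoothAt G μ q F' K i) :
    |∫ x, x i * F (coordSum Finset.univ x) ∂μ
      - (∫ x, x i ∂μ) * ∫ x, F (coordSum Finset.univ x - localSum G i x) ∂μ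
      - (∫ x, x i * localSum G i x ∂μ) * ∫ x, F' (coordSum Finset.univ x) ∂μ|
      ≤ 2 * K * (4 * (G.maxDegree : ℝ) ^ 4 * θ ^ (2 + q)) := by
  set W : (V → ℝ) → ℝ := coordSum Finset.univ with hW
  set W₂ : (V → ℝ) → ℝ := coordSum (Finset.univ \ nbhdBall G 2 i) with hW₂
  set Y : (V → ℝ) → ℝ := localSum G i with hY
  have hWm : Measurable W := measurable_coordSum _
  have hWm₂ : Measurable W₂ := measurable_coordSum _
  have hYm : Measurable Y := measurable_localSum i
  have hFm : Measurable F := hF.continuous_fun.measurable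
  have hF'm : Measurable F' := hF.continuous_deriv.measurable
  obtain ⟨hI, hI'⟩ := hF.integrable_of_bound h
  have hXY : Integrable (fun x => x i * Y x) μ := h.integrable_coord_mul_localSum i i
  have hN1 : ∀ x : V → ℝ, 1 ≤ 1 + ∑ i, |x i| := fun x => by
    have : 0 ≤ ∑ i, |x i| := Finset.sum_nonneg fun i _ => abs_nonneg _
    linarith
  have hXYb : ∀ x : V → ℝ, |x i * Y x| ≤ (1 + ∑ i, |x i|) ^ 2 := by
    intro x
    rw [abs_mul, sq]
    have h1 := Finset.single_le_sum (f := fun i => |x i|) (fun i _ => abs_nonneg _)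
      (Finset.mem_univ i)
    have h2 : |Y x| ≤ ∑ i, |x i| := abs_coordSum_le_sum _ x
    exact mul_le_mul (by linarith) (by linarith) (abs_nonneg _) (by linarith [hN1 x])
  have hone : ∀ x : V → ℝ, |(1 : ℝ)| ≤ (1 + ∑ i, |x i|) ^ 2 := fun x => by
    rw [abs_one]; exact one_le_pow₀ (hN1 x)
  have hWb : ∀ x, |W x| ≤ ∑ i, |x i| := fun x => abs_coordSum_le_sum _ x
  have hW₂b : ∀ x, |W₂ x| ≤ ∑ i, |x i| := fun x => abs_coordSum_le_sum _ x
  have hWYb : ∀ x, |W x - Y x| ≤ ∑ i, |x i| := fun x => by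
    simpa using abs_coordSum_sub_le (G := G) (u := 1) ⟨zero_le_one, le_rfl⟩ i x
  have hxY : Measurable fun x : V → ℝ => x i * Y x := (measurable_pi_apply i).mul hYm
  have i0 : Integrable (fun x => x i * F (W x)) μ := hI i W hWm hWb
  have i1 : Integrable (fun x => x i * F (W x - Y x)) μ := hI i _ (hWm.sub hYm) hWYb
  have i2 : Integrable (fun x => (x i * Y x) * F' (W₂ x)) μ := hI' _ _ hxY hWm₂ hXYb hW₂b
  have i3 : Integrable (fun x => F' (W₂ x)) μ := by
    simpa using hI' (fun _ => 1) W₂ measurable_const hWm₂ hone hW₂b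
  have i4 : Integrable (fun x => F' (W x)) μ := by
    simpa using hI' (fun _ => 1) W measurable_const hWm hone hWb
  -- the first term of the expansion factorizes
  have e1 : ∫ x, x i * F (W x - Y x) ∂μ = (∫ x, x i ∂μ) * ∫ x, F (W x - Y x) ∂μ := by
    refine h.integral_coord_mul_of_disjoint i (A := Finset.univ \ nbhdBall G 1 i)
      (hFm.comp (hWm.sub hYm)) ?_ Finset.disjoint_sdiff
    intro x y hxy
    simp only [hW, hY, ← coordSum_univ_sub_localSum]
    rw [dependsOn_coordSum subset_rfl hxy]
  have e2 : ∫ x, (x i * Y x) * F' (W₂ x) ∂μ = (∫ x, x i * Y x ∂μ) * ∫ x, F' (W₂ x) ∂μ := by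
    have hind : IndepFun (fun x => x i * Y x) (fun x => F' (W₂ x)) μ := by
      refine h.dep.indepFun (S := nbhdBall G 1 i) (T := Finset.univ \ nbhdBall G 2 i) ?_
        hxY (hF'm.comp hWm₂) ?_ ?_
      · rw [← nbhdBall_succ]
        exact Finset.disjoint_sdiff
      · exact DependsOn.mul_fun (dependsOn_coord (mem_nbhdBall_self 1 i))
          (dependsOn_coordSum subset_rfl)
      · intro x y hxy
        simp only [hW₂]
        rw [dependsOn_coordSum subset_rfl hxy]
    exact hind.integral_fun_mul_eq_mul_integral hxY.aestronglyMeasurable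
      (hF'm.comp hWm₂).aestronglyMeasurable
  -- the remainder of the second term
  set c : ℝ → V → ℝ := fun u l => if l ∈ nbhdBall G 1 i then 1 - u else 1 with hc
  have hc1 : ∀ u ∈ Icc (0 : ℝ) 1, ∀ l, |c u l| ≤ 1 := by
    intro u hu l
    simp only [hc]
    split_ifs
    · rw [abs_le]; constructor <;> linarith [hu.1, hu.2]
    · simp
  have hζT := h.moment_localSum_mul_sum i
  have hζd : DependsOn (fun x => |x i * Y x|) (nbhdBall G 2 i : Set V) := by
    intro x y hxy
    have h1 : Y x = Y y := dependsOn_coordSum (nbhdBall_mono (by norm_num) i) hxy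
    simp only [h1, hxy i (mem_nbhdBall_self 2 i)]
  have hWu : ∀ u x, W₂ x + linSum (nbhdBall G 2 i) (c u) x = W x - u * Y x := fun u x =>
    coordSum_compl_add_linSum i u x
  have hrem : Integrable (fun x => ∫ u in (0 : ℝ)..1, |x i * Y x| *
        |F' (W x - u * Y x) - F' (W₂ x)|) μ ∧
      ∫ x, (∫ u in (0 : ℝ)..1, |x i * Y x| * |F' (W x - u * Y x) - F' (W₂ x)|) ∂μ
      ≤ ∫ u in (0 : ℝ)..1, K * (4 * (G.maxDegree : ℝ) ^ 4 * θ ^ (2 + q)) := by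
    refine integral_intervalIntegral_le zero_le_one ?_ (fun u x => by positivity) ?_
      intervalIntegrable_const ?_
    · have h1 : Measurable fun p : ℝ × (V → ℝ) => F' (W p.2 - p.1 * Y p.2) :=
        hF'm.comp (by fun_prop)
      have h2 : Measurable fun p : ℝ × (V → ℝ) => F' (W₂ p.2) := hF'm.comp (by fun_prop)
      have h3 : Measurable fun p : ℝ × (V → ℝ) => |p.2 i * Y p.2| := by fun_prop
      exact h3.mul (h1.sub h2).abs
    · intro u hu
      have h1 := (hI' _ (fun x => W x - u * Y x) hxY (by fun_prop) hXYb
        fun x => abs_coordSum_sub_le hu i x).sub i2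
      refine h1.abs.congr (ae_of_all _ fun x => ?_)
      simp only [Pi.sub_apply]
      rw [← mul_sub, abs_mul]
    · intro u hu
      have h1 := hK (fun x => |x i * Y x|) (c u) (by fun_prop) (fun x => abs_nonneg _) hζd
        hXY.abs hζT.1 (hc1 u hu)
      simp only [← hW₂, hWu] at h1
      exact h1.trans (mul_le_mul_of_nonneg_left hζT.2 hK0)
  rw [intervalIntegral.integral_const, sub_zero, one_smul] at hrem
  -- the change of the mean of the derivative
  have hmeanT := h.moment_sum_rpow (nbhdBall G 3 i)
  have hd : |∫ x, F' (W₂ x) ∂μ - ∫ x, F' (W x) ∂μ|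
      ≤ K * (2 * (G.maxDegree : ℝ) ^ 3 * θ ^ q) := by
    have h1 := hK (fun _ => 1) (fun _ => 1) measurable_const (fun _ => zero_le_one)
      (fun _ _ _ => rfl) (integrable_const _) (by simpa using hmeanT.1) (by simp)
    simp only [one_mul, linSum_one, coordSum_compl_add] at h1
    rw [abs_sub_comm, ← integral_sub i4 i3]
    refine abs_integral_le_integral_abs.trans (h1.trans (mul_le_mul_of_nonneg_left ?_ hK0))
    refine hmeanT.2.trans ?_
    have := Real.rpow_nonneg h.theta_pos.le q
    gcongr
    exact card_nbhdBall_le_real h.one_le_maxDegree 2 i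
  -- assembling
  have hii : ∀ x, IntervalIntegrable (fun u => F' (W x - u * Y x)) volume 0 1 := fun x =>
    (hF.continuous_deriv.comp (by fun_prop)).intervalIntegrable _ _
  set r : (V → ℝ) → ℝ := fun x => x i * F (W x) - x i * F (W x - Y x)
    - (x i * Y x) * F' (W₂ x) with hr
  have hri : ∫ x, r x ∂μ = ∫ x, x i * F (W x) ∂μ
      - (∫ x, x i ∂μ) * ∫ x, F (W x - Y x) ∂μ
      - (∫ x, x i * Y x ∂μ) * ∫ x, F' (W₂ x) ∂μ := by
    have i01 : Integrable (fun x => x i * F (W x) - x i * F (W x - Y x)) μ := i0.sub i1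
    rw [← e1, ← e2, ← integral_sub i0 i1, ← integral_sub i01 i2]
  have hrb : |∫ x, r x ∂μ| ≤ K * (4 * (G.maxDegree : ℝ) ^ 4 * θ ^ (2 + q)) := by
    refine le_trans ?_ hrem.2
    rw [← Real.norm_eq_abs]
    refine norm_integral_le_of_norm_le hrem.1 (ae_of_all _ fun x => ?_)
    have e : r x = (x i * Y x) * ∫ u in (0 : ℝ)..1, (F' (W x - u * Y x) - F' (W₂ x)) := by
      rw [intervalIntegral.integral_sub (hii x) intervalIntegrable_const,
        intervalIntegral.integral_const, sub_zero, one_smul]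
      simp only [hr]
      rw [← mul_sub, hF.sub_eq]
      ring
    rw [e, norm_mul, intervalIntegral.integral_const_mul, Real.norm_eq_abs]
    refine mul_le_mul_of_nonneg_left ?_ (abs_nonneg _)
    exact intervalIntegral.norm_integral_le_integral_norm zero_le_one
  have hXYe := h.abs_integral_coord_mul_localSum_le i
  have e3 : ∫ x, x i * F (W x) ∂μ - (∫ x, x i ∂μ) * ∫ x, F (W x - Y x) ∂μ
      - (∫ x, x i * Y x ∂μ) * ∫ x, F' (W x) ∂μ
      = ∫ x, r x ∂μ + (∫ x, x i * Y x ∂μ) * (∫ x, F' (W₂ x) ∂μ - ∫ x, F' (W x) ∂μ) := by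
    rw [hri]; ring
  rw [e3]
  refine (abs_add_le _ _).trans ?_
  rw [abs_mul]
  have h2 := mul_le_mul hXYe hd (abs_nonneg _) ((abs_nonneg _).trans hXYe)
  have hθ2 : θ ^ (2 + q) = θ ^ 2 * θ ^ q := by
    rw [Real.rpow_add h.theta_pos, Real.rpow_two]
  have e4 : 2 * (G.maxDegree : ℝ) * θ ^ 2 * (K * (2 * (G.maxDegree : ℝ) ^ 3 * θ ^ q))
      = K * (4 * (G.maxDegree : ℝ) ^ 4 * θ ^ (2 + q)) := by
    rw [hθ2]; ring
  rw [e4] at h2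
  linarith

/-- The local Stein identity: `E W F(W)` is the sum of the local covariances times `E F'(W)`, up to
the contributions of the means of the summands and an error of third order. -/
theorem stein_identity (h : LocalLaw G μ q θ) {F F' : ℝ → ℝ} (hF : SteinTest μ q F F') {K : ℝ}
    (hK0 : 0 ≤ K) (hK : ∀ i, SmoothAt G μ q F' K i) :
    Integrable (fun x => coordSum Finset.univ x * F (coordSum Finset.univ x)) μ ∧
    Integrable (fun x => F' (coordSum Finset.univ x)) μ ∧
    |∫ x, coordSum Finset.univ x * F (coordSum Finset.univ x) ∂μ
      - ∑ i, (∫ x, x i ∂μ) * ∫ x, F (coordSum Finset.univ x - localSum G i x) ∂μ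
      - (∑ i, ∫ x, x i * localSum G i x ∂μ) * ∫ x, F' (coordSum Finset.univ x) ∂μ|
      ≤ 2 * K * (4 * (G.maxDegree : ℝ) ^ 4 * (Fintype.card V * θ ^ (2 + q))) := by
  obtain ⟨hI, hI'⟩ := hF.integrable_of_bound h
  have iF : ∀ i, Integrable (fun x : V → ℝ => x i * F (coordSum Finset.univ x)) μ := fun i =>
    hI i _ (measurable_coordSum _) fun x => abs_coordSum_le_sum _ x
  have e : ∀ x : V → ℝ, coordSum Finset.univ x * F (coordSum Finset.univ x)
      = ∑ i, x i * F (coordSum Finset.univ x) := fun x => by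
    rw [← Finset.sum_mul]; rfl
  refine ⟨?_, ?_, ?_⟩
  · simp_rw [e]
    exact integrable_finsetSum _ fun i _ => iF i
  · have := hI' (fun _ => 1) (coordSum Finset.univ) measurable_const (measurable_coordSum _)
      (fun x => ?_) fun x => abs_coordSum_le_sum _ x
    · simpa using this
    · have : 0 ≤ ∑ i, |x i| := Finset.sum_nonneg fun i _ => abs_nonneg _
      rw [abs_one]
      exact one_le_pow₀ (by linarith)
  · simp_rw [e]
    rw [integral_finsetSum _ fun i _ => iF i, Finset.sum_mul, ← Finset.sum_sub_distrib,
      ← Finset.sum_sub_distrib]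
    have hθ : 0 < θ ^ (2 + q) := Real.rpow_pos_of_pos h.theta_pos _
    refine (Finset.abs_sum_le_sum_abs _ _).trans ((sum_le_card_mul _ (by positivity)
      fun i => h.abs_stein_term_le hF hK0 (hK i)).trans_eq ?_)
    ring

lemma steinTest_avgSol (h : LocalLaw G μ q θ) {α : ℝ} (hα : 0 < α) (z : ℝ) :
    SteinTest μ q (avgSol α z) (avgDeriv α z) where
  continuous_fun := continuous_avgSol α z
  continuous_deriv := continuous_avgDeriv hα z
  sub_eq := avgSol_sub_eq_mul_integral α z
  growth := by
    refine ⟨13 / 10, ae_of_all _ fun x w _ => ?_⟩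
    have h0 : 0 ≤ ∑ i, |x i| := Finset.sum_nonneg fun i _ => abs_nonneg _
    have hq := h.q_pos
    have h1 := Real.one_le_rpow (by linarith : 1 ≤ 1 + ∑ i, |x i|) (by linarith : 0 ≤ 1 + q)
    have h2 := Real.one_le_rpow (by linarith : 1 ≤ 1 + ∑ i, |x i|) hq.le
    exact ⟨by linarith [abs_avgSol_le α z w], by linarith [abs_avgDeriv_le_one α z w]⟩

/-- The error of the normal approximation for a ramp, up to the contributions of the means of the
summands and of the local covariances. -/
theorem stein_expansion (h : LocalLaw G μ q θ) {α z K : ℝ} (hα : 0 < α) (hK0 : 0 ≤ K)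
    (hK : ∀ i, SmoothAt G μ q (avgDeriv α z) K i) :
    |∫ x, (1 - ramp α (coordSum Finset.univ x - z)) ∂μ - avgCDF α z
      - (1 - ∑ i, ∫ x, x i * localSum G i x ∂μ) * ∫ x, avgDeriv α z (coordSum Finset.univ x) ∂μ
      + ∑ i, (∫ x, x i ∂μ) * ∫ x, avgSol α z (coordSum Finset.univ x - localSum G i x) ∂μ|
      ≤ 2 * K * (4 * (G.maxDegree : ℝ) ^ 4 * (Fintype.card V * θ ^ (2 + q))) := by
  obtain ⟨i1, i2, hb⟩ := h.stein_identity (h.steinTest_avgSol hα z) hK0 hK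
  have e1 : ∫ x, (1 - ramp α (coordSum Finset.univ x - z)) ∂μ - avgCDF α z
      = ∫ x, avgDeriv α z (coordSum Finset.univ x) ∂μ
        - ∫ x, coordSum Finset.univ x * avgSol α z (coordSum Finset.univ x) ∂μ := by
    rw [← integral_sub i2 i1, sub_eq_iff_eq_add]
    have : ∀ x : V → ℝ, 1 - ramp α (coordSum Finset.univ x - z)
        = (avgDeriv α z (coordSum Finset.univ x)
          - coordSum Finset.univ x * avgSol α z (coordSum Finset.univ x)) + avgCDF α z := by
      intro x
      rw [avgDeriv_eq hα]
      ring
    simp_rw [this]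
    have i3 : Integrable (fun x : V → ℝ => avgDeriv α z (coordSum Finset.univ x)
          - coordSum Finset.univ x * avgSol α z (coordSum Finset.univ x)) μ := i2.sub i1
    rw [integral_add i3 (integrable_const _), integral_const, probReal_univ, one_smul]
  rw [← abs_neg] at hb
  convert hb using 2
  rw [e1]
  ring

end LocalLaw

/-! ### The uniform bound -/

lemma measureReal_le_integral_ramp {Ω : Type*} [MeasurableSpace Ω] {μ : Measure Ω}
    [IsProbabilityMeasure μ] {W : Ω → ℝ} (hW : Measurable W) {α : ℝ} (hα : 0 < α) (z : ℝ) :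
    μ.real {x | W x ≤ z} ≤ ∫ x, (1 - ramp α (W x - z)) ∂μ := by
  have hm : MeasurableSet {x | W x ≤ z} := hW measurableSet_Iic
  rw [← integral_indicator_one hm]
  have hr : Measurable fun x => 1 - ramp α (W x - z) :=
    measurable_const.sub ((continuous_ramp α).measurable.comp (hW.sub_const z))
  refine integral_mono ((integrable_const (1 : ℝ)).indicator hm)
    ((integrable_const (1 : ℝ)).mono' hr.aestronglyMeasurable (ae_of_all _ fun x => ?_)) fun x => ?_
  · rw [Real.norm_eq_abs, abs_le]
    constructor <;> linarith [ramp_nonneg α (W x - z), ramp_le_one α (W x - z)]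
  · by_cases hx : W x ≤ z
    · rw [indicator_of_mem (by exact hx), ramp_of_nonpos hα (by linarith)]
      simp
    · rw [indicator_of_notMem (by exact hx)]
      linarith [ramp_le_one α (W x - z)]

lemma integral_ramp_le_measureReal {Ω : Type*} [MeasurableSpace Ω] {μ : Measure Ω}
    [IsProbabilityMeasure μ] {W : Ω → ℝ} (hW : Measurable W) {α : ℝ} (hα : 0 < α) (z : ℝ) :
    ∫ x, (1 - ramp α (W x - (z - α))) ∂μ ≤ μ.real {x | W x < z} := by
  have hm : MeasurableSet {x | W x < z} := hW measurableSet_Iio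
  rw [← integral_indicator_one hm]
  have hr : Measurable fun x => 1 - ramp α (W x - (z - α)) :=
    measurable_const.sub ((continuous_ramp α).measurable.comp (hW.sub_const _))
  refine integral_mono ((integrable_const (1 : ℝ)).mono' hr.aestronglyMeasurable
    (ae_of_all _ fun x => ?_)) ((integrable_const (1 : ℝ)).indicator hm) fun x => ?_
  · rw [Real.norm_eq_abs, abs_le]
    constructor <;> linarith [ramp_nonneg α (W x - (z - α)), ramp_le_one α (W x - (z - α))]
  · by_cases hx : W x < z
    · rw [indicator_of_mem (by exact hx)]
      simp only [Pi.one_apply]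
      linarith [ramp_nonneg α (W x - (z - α))]
    · rw [indicator_of_notMem (by exact hx), ramp_of_ge hα (by linarith [not_lt.1 hx])]
      simp

namespace LocalLaw

variable {V : Type*} [Fintype V] [DecidableEq V] {G : SimpleGraph V} [DecidableRel G.Adj]
  {μ : Measure (V → ℝ)} [IsProbabilityMeasure μ] {q θ : ℝ}

lemma abs_linSum_rpow_le (h : LocalLaw G μ q θ) (S : Finset V) {c : V → ℝ} (hc : ∀ l, |c l| ≤ 1)
    (x : V → ℝ) : |linSum S c x| ^ q ≤ ∑ l ∈ S, |x l| ^ q :=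
  abs_sum_mul_rpow_le S c x h.q_pos h.q_le_one fun l _ => hc l

/-- The sum of the coordinates over the ring between the balls of radii two and three. -/
lemma coordSum_compl_two_eq (i : V) (x : V → ℝ) :
    coordSum (Finset.univ \ nbhdBall G 2 i) x
      = coordSum (Finset.univ \ nbhdBall G 3 i) x
        + coordSum (nbhdBall G 3 i \ nbhdBall G 2 i) x := by
  rw [coordSum_sdiff (Finset.subset_univ _), coordSum_sdiff (Finset.subset_univ _),
    coordSum_sdiff (nbhdBall_mono (by norm_num) i)]
  ring

lemma sum_ball_two_add_ring (i : V) (f : V → ℝ) :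
    ∑ l ∈ nbhdBall G 2 i, f l + ∑ l ∈ nbhdBall G 3 i \ nbhdBall G 2 i, f l
      = ∑ l ∈ nbhdBall G 3 i, f l := by
  rw [add_comm]
  exact Finset.sum_sdiff (nbhdBall_mono (by norm_num) i)

/-- A function of the ball of radius two is independent of the functions of the complement of the
ball of radius three. -/
lemma integral_mul_compl_three (h : LocalLaw G μ q θ) (i : V) {f g : (V → ℝ) → ℝ}
    (hf : Measurable f) (hg : Measurable g) (hfd : DependsOn f (nbhdBall G 2 i : Set V))
    (hgd : DependsOn g ((Finset.univ \ nbhdBall G 3 i : Finset V) : Set V)) :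
    IndepFun f g μ := by
  refine h.dep.indepFun ?_ hf hg hfd hgd
  rw [← nbhdBall_succ]
  exact Finset.disjoint_sdiff

/-- The average of the weighted windows met along a segment. -/
lemma integral_ramp_sub_le {α z c₀ : ℝ} (hα : 0 < α) (i : V)
    {χ R : (V → ℝ) → ℝ} (hχ : Measurable χ) (hχ0 : ∀ x, 0 ≤ χ x) (hχi : Integrable χ μ)
    (hR : Measurable R)
    (hc : ∀ a : (V → ℝ) → ℝ, (∃ r ∈ Icc (0 : ℝ) 1, a =
        fun x => coordSum (nbhdBall G 2 i) x - r * R x + z) →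
      ∫ x, χ x * window α (coordSum Finset.univ x - a x) ∂μ ≤ c₀) :
    Integrable (fun x => 1 / α * ∫ r in (0 : ℝ)..1, χ x *
        window α (coordSum (Finset.univ \ nbhdBall G 2 i) x - z + r * R x)) μ ∧
      ∫ x, 1 / α * (∫ r in (0 : ℝ)..1, χ x *
        window α (coordSum (Finset.univ \ nbhdBall G 2 i) x - z + r * R x)) ∂μ
      ≤ 1 / α * c₀ := by
  have hmain := integral_intervalIntegral_le (Q := μ) (f := fun r x => χ x *
      window α (coordSum (Finset.univ \ nbhdBall G 2 i) x - z + r * R x)) (g := fun _ => c₀)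
      (zero_le_one (α := ℝ)) ?_ ?_ ?_ intervalIntegrable_const ?_
  · rw [intervalIntegral.integral_const, sub_zero, one_smul] at hmain
    refine ⟨hmain.1.const_mul _, ?_⟩
    rw [integral_const_mul]
    exact mul_le_mul_of_nonneg_left hmain.2 (by positivity)
  · have h1 : Measurable fun p : ℝ × (V → ℝ) =>
        coordSum (Finset.univ \ nbhdBall G 2 i) p.2 - z + p.1 * R p.2 := by fun_prop
    exact (hχ.comp measurable_snd).mul ((measurable_window α).comp h1)
  · exact fun r x => mul_nonneg (hχ0 x) (window_nonneg _ _)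
  · intro r _
    have h1 : Measurable fun x =>
        coordSum (Finset.univ \ nbhdBall G 2 i) x - z + r * R x := by fun_prop
    refine hχi.mul_bdd (c := 1) ((measurable_window α).comp h1).aestronglyMeasurable
      (ae_of_all _ fun x => ?_)
    rw [Real.norm_of_nonneg (window_nonneg _ _)]
    exact window_le_one _ _
  · intro r hr
    have := hc _ ⟨r, hr, rfl⟩
    refine le_trans (le_of_eq ?_) this
    refine integral_congr_ae (ae_of_all _ fun x => ?_)
    dsimp only
    rw [← coordSum_compl_add (nbhdBall G 2 i) x]
    ring_nf

/-- The smoothness of the derivative of the Stein solution for centred summands. A large increment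
`R` is met by the trivial bound `1`; for a small one the change consists of a Lipschitz part and of
the jump of the ramp, which is a multiple of a window probability and is controlled by
concentration. -/
lemma smoothAt_centred (h : LocalLaw G μ q θ) (hmean : ∀ i, ∫ x, x i ∂μ = 0)
    (hvar : ∫ x, coordSum Finset.univ x ^ 2 ∂μ = 1)
    (hε : 4 * (G.maxDegree : ℝ) ^ 5 * θ ^ 2 ≤ 1 / 7) {β : ℝ}
    (hβ : β = 4 * (G.maxDegree : ℝ) ^ 5 * (Fintype.card V * θ ^ (2 + q))) (hβ0 : 0 < β)
    (hβ1 : β ≤ 4 / 75) (z : ℝ) (i : V) : SmoothAt G μ q (avgDeriv (6 * β) z) (131 / 20) i := by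
  intro ζ c hζ hζ0 hζd hζi hζT hc
  have hα : 0 < 6 * β := by linarith
  set W₂ : (V → ℝ) → ℝ := coordSum (Finset.univ \ nbhdBall G 2 i) with hW₂
  set W₃ : (V → ℝ) → ℝ := coordSum (Finset.univ \ nbhdBall G 3 i) with hW₃
  set U : (V → ℝ) → ℝ := coordSum (nbhdBall G 3 i \ nbhdBall G 2 i) with hU
  set R : (V → ℝ) → ℝ := linSum (nbhdBall G 2 i) c with hR
  set T₂ : (V → ℝ) → ℝ := fun x => ∑ l ∈ nbhdBall G 2 i, |x l| ^ q with hT₂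
  set T₃ : (V → ℝ) → ℝ := fun x => ∑ l ∈ nbhdBall G 3 i \ nbhdBall G 2 i, |x l| ^ q with hT₃
  have hT : ∀ x, ∑ l ∈ nbhdBall G 3 i, |x l| ^ q = T₂ x + T₃ x := fun x =>
    (sum_ball_two_add_ring i _).symm
  have hRm : Measurable R := measurable_linSum _ _
  have hRT : ∀ x, |R x| ^ q ≤ T₂ x := h.abs_linSum_rpow_le _ hc
  have hUT : ∀ x, |U x| ^ q ≤ T₃ x := fun x => abs_coordSum_rpow_le _ x h.q_pos h.q_le_one
  have hT₂0 : ∀ x, 0 ≤ T₂ x := fun x => Finset.sum_nonneg fun l _ => by positivity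
  have hT₃0 : ∀ x, 0 ≤ T₃ x := fun x => Finset.sum_nonneg fun l _ => by positivity
  have hT₂m : Measurable T₂ := by fun_prop
  have hT₃m : Measurable T₃ := by fun_prop
  simp_rw [hT] at hζT ⊢
  -- the small and the large values of `R`
  set χ : (V → ℝ) → ℝ := fun x => ({y : ℝ | |y| ≤ 1}.indicator (fun y => |y|)) (R x) with hχ
  set ψ : (V → ℝ) → ℝ := fun x => ({y : ℝ | 1 < |y|}.indicator (fun _ => (1 : ℝ))) (R x) with hψ
  have hsm : MeasurableSet {y : ℝ | |y| ≤ 1} := measurableSet_le (by fun_prop) (by fun_prop)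
  have hlm : MeasurableSet {y : ℝ | 1 < |y|} := measurableSet_lt (by fun_prop) (by fun_prop)
  have hχm : Measurable χ := ((continuous_abs.measurable).indicator hsm).comp hRm
  have hψm : Measurable ψ := (measurable_const.indicator hlm).comp hRm
  have hχ0 : ∀ x, 0 ≤ χ x := fun x => indicator_nonneg (fun y _ => abs_nonneg y) _
  have hψ0 : ∀ x, 0 ≤ ψ x := fun x => indicator_nonneg (fun y _ => zero_le_one) _
  have hχψ : ∀ x, χ x + ψ x ≤ T₂ x := by
    intro x
    refine le_trans ?_ (hRT x)
    rcases le_or_gt |R x| 1 with h1 | h1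
    · simp only [hχ, hψ]
      rw [indicator_of_mem (by exact h1), indicator_of_notMem (by exact not_lt.2 h1), add_zero]
      exact Real.self_le_rpow_of_le_one (abs_nonneg _) h1 h.q_le_one
    · simp only [hχ, hψ]
      rw [indicator_of_notMem (by exact not_le.2 h1), indicator_of_mem (by exact h1), zero_add]
      exact Real.one_le_rpow h1.le h.q_pos.le
  have hpt : ∀ x, |avgDeriv (6 * β) z (W₂ x + R x) - avgDeriv (6 * β) z (W₂ x)|
      ≤ ψ x + χ x * (13 / 10 + |W₃ x|) + T₃ x
        + 1 / (6 * β) * ∫ r in (0 : ℝ)..1, χ x * window (6 * β) (W₂ x - z + r * R x) := by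
    intro x
    have hw : 0 ≤ ∫ r in (0 : ℝ)..1, window (6 * β) (W₂ x - z + r * R x) :=
      intervalIntegral.integral_nonneg zero_le_one fun r _ => window_nonneg _ _
    have hb := abs_avgDeriv_sub_le_one (6 * β) z (W₂ x + R x) (W₂ x)
    rw [intervalIntegral.integral_const_mul]
    rcases le_or_gt |R x| 1 with h1 | h1
    · have hχx : χ x = |R x| := indicator_of_mem (by exact h1) _
      have hψx : ψ x = 0 := indicator_of_notMem (by exact not_lt.2 h1) _
      rw [hχx, hψx]
      have h2 := abs_avgDeriv_sub_le hα z (W₂ x + R x) (W₂ x)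
      have e : W₂ x + R x - z = W₂ x - z + R x := by ring
      rw [e, abs_ramp_add_sub hα, add_sub_cancel_left] at h2
      have h3 : |W₂ x| ≤ |W₃ x| + |U x| := by
        rw [hW₂, coordSum_compl_two_eq]; exact abs_add_le _ _
      have h4 := mul_le_mul_of_nonneg_left h3 (abs_nonneg (R x))
      have e2 : |R x| / (6 * β) * ∫ r in (0 : ℝ)..1, window (6 * β) (W₂ x - z + r * R x)
          = 1 / (6 * β) * (|R x| * ∫ r in (0 : ℝ)..1, window (6 * β) (W₂ x - z + r * R x)) := by
        ring
      rw [e2] at h2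
      have h5 : 0 ≤ 1 / (6 * β) *
          (|R x| * ∫ r in (0 : ℝ)..1, window (6 * β) (W₂ x - z + r * R x)) := by positivity
      have h6 : 0 ≤ |R x| * (13 / 10 + |W₃ x|) := by positivity
      rcases le_or_gt |U x| 1 with h7 | h7
      · have h8 : |U x| ≤ T₃ x :=
          (Real.self_le_rpow_of_le_one (abs_nonneg _) h7 h.q_le_one).trans (hUT x)
        have h9 : |R x| * |U x| ≤ |U x| := mul_le_of_le_one_left (abs_nonneg _) h1
        nlinarith
      · have h8 : 1 ≤ T₃ x := (Real.one_le_rpow h7.le h.q_pos.le).trans (hUT x)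
        linarith
    · have hχx : χ x = 0 := indicator_of_notMem (by exact not_le.2 h1) _
      have hψx : ψ x = 1 := indicator_of_mem (by exact h1) _
      rw [hχx, hψx]
      linarith [hT₃0 x]
  -- integrate
  have iT₂ : Integrable (fun x => ζ x * T₂ x) μ :=
    hζT.mono' (hζ.mul hT₂m).aestronglyMeasurable (ae_of_all _ fun x => by
      rw [Real.norm_of_nonneg (mul_nonneg (hζ0 x) (hT₂0 x))]
      exact mul_le_mul_of_nonneg_left (by linarith [hT₃0 x]) (hζ0 x))
  have iT₃ : Integrable (fun x => ζ x * T₃ x) μ :=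
    hζT.mono' (hζ.mul hT₃m).aestronglyMeasurable (ae_of_all _ fun x => by
      rw [Real.norm_of_nonneg (mul_nonneg (hζ0 x) (hT₃0 x))]
      exact mul_le_mul_of_nonneg_left (by linarith [hT₂0 x]) (hζ0 x))
  have iχ : Integrable (fun x => ζ x * χ x) μ :=
    iT₂.mono' (hζ.mul hχm).aestronglyMeasurable (ae_of_all _ fun x => by
      rw [Real.norm_of_nonneg (mul_nonneg (hζ0 x) (hχ0 x))]
      exact mul_le_mul_of_nonneg_left (by linarith [hψ0 x, hχψ x]) (hζ0 x))
  have iψ : Integrable (fun x => ζ x * ψ x) μ :=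
    iT₂.mono' (hζ.mul hψm).aestronglyMeasurable (ae_of_all _ fun x => by
      rw [Real.norm_of_nonneg (mul_nonneg (hζ0 x) (hψ0 x))]
      exact mul_le_mul_of_nonneg_left (by linarith [hχ0 x, hχψ x]) (hζ0 x))
  have hRd : DependsOn R (nbhdBall G 2 i : Set V) := dependsOn_linSum _ _
  have hχd : DependsOn (fun x => ζ x * χ x) (nbhdBall G 2 i : Set V) :=
    hζd.mul_fun fun x y hxy => by simp only [hχ, hRd hxy]
  have hind := h.integral_mul_compl_three i (f := fun x => ζ x * χ x) (hζ.mul hχm)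
    (measurable_coordSum _).abs hχd (g := fun x => |W₃ x|) (fun x y hxy => by
      simp only [hW₃]; rw [dependsOn_coordSum subset_rfl hxy])
  have iW : Integrable (fun x => |W₃ x|) μ := (h.integrable_coordSum _).abs
  have iχW : Integrable (fun x => ζ x * χ x * |W₃ x|) μ := hind.integrable_mul iχ iW
  have eχW : ∫ x, ζ x * χ x * |W₃ x| ∂μ ≤ 3 / 2 * ∫ x, ζ x * χ x ∂μ := by
    rw [hind.integral_fun_mul_eq_mul_integral (hζ.mul hχm).aestronglyMeasurable
      iW.aestronglyMeasurable, mul_comm]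
    refine mul_le_mul_of_nonneg_right ?_ (integral_nonneg fun x => mul_nonneg (hζ0 x) (hχ0 x))
    refine h.integral_abs_coordSum_compl_le hmean hvar hε ?_
    refine (card_nbhdBall_le_real h.one_le_maxDegree 2 i).trans ?_
    gcongr
    · exact h.one_le_maxDegree_real
    · norm_num
  have hseg := integral_ramp_sub_le (G := G) (α := 6 * β) (z := z)
    (c₀ := 45 / 2 * β * ∫ x, ζ x * χ x ∂μ) hα i (χ := fun x => ζ x * χ x) (R := R)
    (hζ.mul hχm) (fun x => mul_nonneg (hζ0 x) (hχ0 x)) iχ hRm ?_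
  · have hbound := integral_le_integral_add_add_of_le (Q := μ)
      (f := fun x => ζ x * |avgDeriv (6 * β) z (W₂ x + R x) - avgDeriv (6 * β) z (W₂ x)|)
      (g₁ := fun x => ζ x * ψ x) (g₂ := fun x => 13 / 10 * (ζ x * χ x))
      (g₃ := fun x => ζ x * χ x * |W₃ x|) (g₄ := fun x => ζ x * T₃ x)
      (g₅ := fun x => 1 / (6 * β) * ∫ r in (0 : ℝ)..1, ζ x * χ x *
        window (6 * β) (W₂ x - z + r * R x)) ?_ iψ (iχ.const_mul _) iχW iT₃ hseg.1 ?_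
    · rw [integral_const_mul] at hbound
      have h1 : ∫ x, ζ x * χ x ∂μ + ∫ x, ζ x * ψ x ∂μ ≤ ∫ x, ζ x * T₂ x ∂μ := by
        rw [← integral_add iχ iψ]
        refine integral_mono (iχ.add iψ) iT₂ fun x => ?_
        dsimp only
        rw [← mul_add]
        exact mul_le_mul_of_nonneg_left (hχψ x) (hζ0 x)
      have h2 : ∫ x, ζ x * (T₂ x + T₃ x) ∂μ = ∫ x, ζ x * T₂ x ∂μ + ∫ x, ζ x * T₃ x ∂μ := by
        rw [← integral_add iT₂ iT₃]
        simp_rw [mul_add]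
      have h3 : 0 ≤ ∫ x, ζ x * ψ x ∂μ := integral_nonneg fun x => mul_nonneg (hζ0 x) (hψ0 x)
      have h4 : 0 ≤ ∫ x, ζ x * T₃ x ∂μ := integral_nonneg fun x => mul_nonneg (hζ0 x) (hT₃0 x)
      have h5 := hseg.2
      have e : 1 / (6 * β) * (45 / 2 * β * ∫ x, ζ x * χ x ∂μ)
          = 15 / 4 * ∫ x, ζ x * χ x ∂μ := by
        field_simp
        ring
      rw [e] at h5
      rw [h2]
      linarith
    · have h1 := (continuous_avgDeriv hα z).measurable
      refine hζi.mul_bdd (c := 1) ((h1.comp (by fun_prop)).sub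
        (h1.comp (by fun_prop))).abs.aestronglyMeasurable (ae_of_all _ fun x => ?_)
      rw [norm_abs_eq_norm]
      exact abs_avgDeriv_sub_le_one _ _ _ _
    · intro x
      have h1 := mul_le_mul_of_nonneg_left (hpt x) (hζ0 x)
      have e : ∫ r in (0 : ℝ)..1, ζ x * χ x * window (6 * β) (W₂ x - z + r * R x)
          = ζ x * ∫ r in (0 : ℝ)..1, χ x * window (6 * β) (W₂ x - z + r * R x) := by
        simp_rw [mul_assoc]
        rw [intervalIntegral.integral_const_mul]
      rw [e]
      linarith
  · rintro a ⟨r, -, rfl⟩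
    refine h.concentration_centred hmean hvar hε hβ hβ1 i (hζ.mul hχm)
      (fun x => mul_nonneg (hζ0 x) (hχ0 x)) hχd iχ (by fun_prop) ?_
    intro x y hxy
    have h1 : coordSum (nbhdBall G 2 i) x = coordSum (nbhdBall G 2 i) y :=
      dependsOn_coordSum subset_rfl hxy
    simp only [h1, hRd hxy]

/-- The uniform normal approximation for centred summands with `E W ^ 2 = 1`, under smallness
conditions. The expansion of the Stein equation contributes `131 / 10 * β` to the constant and the
replacement of the indicator function by a ramp of width `6 * β` contributes `12 / 5 * β`. -/
theorem uniform_bound_of_small (h : LocalLaw G μ q θ) (hmean : ∀ i, ∫ x, x i ∂μ = 0)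
    (hvar : ∫ x, coordSum Finset.univ x ^ 2 ∂μ = 1)
    (hε : 4 * (G.maxDegree : ℝ) ^ 5 * θ ^ 2 ≤ 1 / 7) {β : ℝ}
    (hβ : β = 4 * (G.maxDegree : ℝ) ^ 5 * (Fintype.card V * θ ^ (2 + q))) (hβ0 : 0 < β)
    (hβ1 : β ≤ 4 / 75) (z : ℝ) :
    |μ.real {x | coordSum Finset.univ x ≤ z} - stdNormalCDF z| ≤ 31 / 2 * β := by
  have hD := h.one_le_maxDegree_real
  have hα : 0 < 6 * β := by linarith
  have hθ : 0 < θ ^ (2 + q) := Real.rpow_pos_of_pos h.theta_pos _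
  have hs : ∑ j, ∫ x, x j * localSum G j x ∂μ = 1 := by
    rw [← hvar, h.integral_coordSum_sq_eq]
    exact Finset.sum_congr rfl fun j _ => h.integral_coord_mul_localSum hmean j
  have hexp : ∀ y, |∫ x, (1 - ramp (6 * β) (coordSum Finset.univ x - y)) ∂μ
      - avgCDF (6 * β) y| ≤ 131 / 10 * β := by
    intro y
    have h1 := h.stein_expansion (z := y) hα (K := 131 / 20) (by norm_num)
      (h.smoothAt_centred hmean hvar hε hβ hβ0 hβ1 y)
    simp only [hs, hmean, sub_self, zero_mul, Finset.sum_const_zero, sub_zero, add_zero] at h1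
    refine h1.trans ?_
    have h2 : 4 * (G.maxDegree : ℝ) ^ 4 * (Fintype.card V * θ ^ (2 + q)) ≤ β := by
      rw [hβ]
      have h1 := pow_le_pow_right₀ hD (by norm_num : 4 ≤ 5)
      gcongr
    linarith
  have hΦ : ∀ y, stdNormalCDF (y + 6 * β) - stdNormalCDF y ≤ 12 / 5 * β := by
    intro y
    have := stdNormalCDF_sub_le (by linarith : y ≤ y + 6 * β) (c := 2 / 5)
      fun t _ => normalDensity_le t
    linarith
  have hWm : Measurable (coordSum (Finset.univ : Finset V)) := measurable_coordSum _
  have hup := measureReal_le_integral_ramp (μ := μ) hWm hα z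
  have hlow := (integral_ramp_le_measureReal (μ := μ) hWm hα z).trans
    (measureReal_mono (fun x (hx : _ < z) => hx.le) :
      μ.real {x | coordSum Finset.univ x < z} ≤ μ.real {x | coordSum Finset.univ x ≤ z})
  have h1 := abs_le.1 (hexp z)
  have h2 := abs_le.1 (hexp (z - 6 * β))
  have h3 := avgCDF_mem hα z
  have h4 := avgCDF_mem hα (z - 6 * β)
  have h5 := hΦ z
  have h6 := hΦ (z - 6 * β)
  rw [sub_add_cancel] at h6
  rw [abs_le]
  constructor <;> linarith [h1.1, h1.2, h2.1, h2.2, h3.1, h3.2, h4.1, h4.2]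

end LocalLaw

/-! ### A moment inequality of Rosenthal type -/

lemma sub_eq_mul_integral_of_hasDerivAt {F F' : ℝ → ℝ} (hF : ∀ w, HasDerivAt F (F' w) w)
    (hF' : Continuous F') (w y : ℝ) :
    F w - F (w - y) = y * ∫ u in (0 : ℝ)..1, F' (w - u * y) := by
  have h1 : ∀ u : ℝ, HasDerivAt (fun u => -F (w - u * y)) (y * F' (w - u * y)) u := by
    intro u
    have h2 : HasDerivAt (fun u : ℝ => w - u * y) (-y) u := by
      simpa using ((hasDerivAt_id u).mul_const y).const_sub w
    have h3 := ((hF (w - u * y)).comp u h2).neg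
    have e : y * F' (w - u * y) = -(F' (w - u * y) * -y) := by ring
    rw [e]
    exact h3
  have h4 := intervalIntegral.integral_eq_sub_of_hasDerivAt (a := 0) (b := 1) (fun u _ => h1 u)
    (Continuous.intervalIntegrable (by fun_prop) _ _)
  rw [intervalIntegral.integral_const_mul] at h4
  rw [h4]
  simp
  ring

lemma hasDerivAt_mul_abs_rpow {q : ℝ} (hq : 0 < q) (w : ℝ) :
    HasDerivAt (fun w : ℝ => w * |w| ^ q) ((1 + q) * |w| ^ q) w := by
  have hc : Continuous fun w : ℝ => |w| ^ q := continuous_abs.rpow_const fun _ => Or.inr hq.le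
  refine hasDerivAt_of_hasDerivAt_of_ne' (x := 0) (f := fun w : ℝ => w * |w| ^ q)
    (g := fun w => (1 + q) * |w| ^ q) ?_ (continuous_id.mul hc).continuousAt
    (hc.const_mul _).continuousAt w
  intro y hy
  have h1 := (hasDerivAt_id y).mul
    ((hasDerivAt_abs hy).rpow_const (p := q) (Or.inl (abs_ne_zero.2 hy)))
  have h2 : y * (SignType.sign y : ℝ) = |y| := by
    rw [mul_comm]; exact sign_mul_self y
  have h3 : |y| ^ q = |y| * |y| ^ (q - 1) := by
    rw [Real.rpow_sub_one (abs_ne_zero.2 hy)]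
    field_simp
  refine h1.congr_deriv ?_
  calc 1 * |y| ^ q + y * ((SignType.sign y : ℝ) * q * |y| ^ (q - 1))
      = |y| ^ q + q * (y * (SignType.sign y : ℝ) * |y| ^ (q - 1)) := by ring
    _ = _ := by rw [h2, ← h3]; ring

lemma abs_abs_rpow_sub_le {q : ℝ} (hq : 0 < q) (hq1 : q ≤ 1) (a b : ℝ) :
    |(|a| ^ q - |b| ^ q)| ≤ |a - b| ^ q := by
  have h : ∀ a b : ℝ, |a| ^ q - |b| ^ q ≤ |a - b| ^ q := fun a b => by
    have h1 : |a| ≤ |a - b| + |b| := by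
      have := abs_add_le (a - b) b
      rwa [sub_add_cancel] at this
    have h2 := Real.rpow_le_rpow (abs_nonneg a) h1 hq.le
    have h3 := Real.rpow_add_le_add_rpow (abs_nonneg (a - b)) (abs_nonneg b) hq.le hq1
    linarith
  rw [abs_le]
  have h1 := h b a
  rw [abs_sub_comm] at h1
  exact ⟨by linarith, h a b⟩

namespace LocalLaw

variable {V : Type*} [Fintype V] [DecidableEq V] {G : SimpleGraph V} [DecidableRel G.Adj]
  {μ : Measure (V → ℝ)} [IsProbabilityMeasure μ] {q θ : ℝ}

lemma steinTest_mul_abs_rpow (h : LocalLaw G μ q θ) :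
    SteinTest μ q (fun w : ℝ => w * |w| ^ q) (fun w => (1 + q) * |w| ^ q) where
  continuous_fun := continuous_id.mul (continuous_abs.rpow_const fun _ => Or.inr h.q_pos.le)
  continuous_deriv := (continuous_abs.rpow_const fun _ => Or.inr h.q_pos.le).const_mul _
  sub_eq := sub_eq_mul_integral_of_hasDerivAt (hasDerivAt_mul_abs_rpow h.q_pos)
    ((continuous_abs.rpow_const fun _ => Or.inr h.q_pos.le).const_mul _)
  growth := by
    refine ⟨2, ae_of_all _ fun x w hw => ?_⟩
    have hq := h.q_pos
    have h0 : |w| ≤ 1 + ∑ i, |x i| := by linarith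
    have hpos : 0 < 1 + ∑ i, |x i| := by positivity
    have h1 := Real.rpow_le_rpow (abs_nonneg w) h0 hq.le
    have h2 : 0 ≤ |w| ^ q := by positivity
    constructor
    · rw [abs_mul, abs_of_nonneg h2, Real.rpow_add hpos, Real.rpow_one]
      have h3 := mul_le_mul h0 h1 h2 hpos.le
      have h4 : 0 ≤ |w| * |w| ^ q := by positivity
      linarith
    · rw [abs_of_nonneg (by positivity)]
      exact mul_le_mul (by linarith [h.q_le_one]) h1 h2 zero_le_two

lemma smoothAt_abs_rpow (h : LocalLaw G μ q θ) (i : V) :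
    SmoothAt G μ q (fun w => (1 + q) * |w| ^ q) 2 i := by
  intro ζ c hζ hζ0 hζd hζi hζT hc
  rw [← integral_const_mul]
  refine integral_mono_of_nonneg (ae_of_all _ fun x => mul_nonneg (hζ0 x) (abs_nonneg _))
    (hζT.const_mul 2) (ae_of_all _ fun x => ?_)
  dsimp only
  rw [← mul_sub, abs_mul, abs_of_nonneg (by linarith [h.q_pos]), mul_left_comm 2]
  refine mul_le_mul_of_nonneg_left ?_ (hζ0 x)
  have h1 := abs_abs_rpow_sub_le h.q_pos h.q_le_one
    (coordSum (Finset.univ \ nbhdBall G 2 i) x + linSum (nbhdBall G 2 i) c x)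
    (coordSum (Finset.univ \ nbhdBall G 2 i) x)
  rw [add_sub_cancel_left] at h1
  have h2 := h1.trans (h.abs_linSum_rpow_le _ hc x)
  have h3 : ∑ l ∈ nbhdBall G 2 i, |x l| ^ q ≤ ∑ l ∈ nbhdBall G 3 i, |x l| ^ q :=
    Finset.sum_le_sum_of_subset_of_nonneg (nbhdBall_mono (by norm_num) i)
      fun _ _ _ => by positivity
  exact mul_le_mul (by linarith [h.q_le_one]) (h2.trans h3) (abs_nonneg _) zero_le_two

/-- The absolute moment of order `2 + q` of a sum with variance one, from the local Stein identity
for the function `w ↦ w * |w| ^ q`. -/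
theorem moment_coordSum_le (h : LocalLaw G μ q θ) (hmean : ∀ i, ∫ x, x i ∂μ = 0)
    (hvar : ∫ x, coordSum Finset.univ x ^ 2 ∂μ = 1) :
    Integrable (fun x => |coordSum Finset.univ x| ^ (2 + q)) μ ∧
    ∫ x, |coordSum Finset.univ x| ^ (2 + q) ∂μ
      ≤ 4 + 16 * ((G.maxDegree : ℝ) ^ 4 * (Fintype.card V * θ ^ (2 + q))) := by
  obtain ⟨i1, i2, hb⟩ := h.stein_identity h.steinTest_mul_abs_rpow zero_le_two h.smoothAt_abs_rpow
  have hs : ∑ j, ∫ x, x j * localSum G j x ∂μ = 1 := by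
    rw [← hvar, h.integral_coordSum_sq_eq]
    exact Finset.sum_congr rfl fun j _ => h.integral_coord_mul_localSum hmean j
  simp only [hs, hmean, zero_mul, Finset.sum_const_zero, sub_zero, one_mul] at hb
  have e : ∀ x : V → ℝ, coordSum Finset.univ x * (coordSum Finset.univ x *
      |coordSum Finset.univ x| ^ q) = |coordSum Finset.univ x| ^ (2 + q) := by
    intro x
    rw [Real.rpow_add_of_nonneg (abs_nonneg _) zero_le_two h.q_pos.le, Real.rpow_two, sq_abs]
    ring
  simp_rw [e] at i1 hb
  refine ⟨i1, ?_⟩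
  have i3 := (h.memLp_two_coordSum Finset.univ).integrable_sq
  have h1 : ∫ x, (1 + q) * |coordSum Finset.univ x| ^ q ∂μ
      ≤ ∫ x, (2 + 2 * coordSum Finset.univ x ^ 2) ∂μ := by
    refine integral_mono i2 ((integrable_const _).add (i3.const_mul 2)) fun x => ?_
    set w := coordSum Finset.univ x
    have h2 : |w| ^ q ≤ 1 + w ^ 2 := by
      rcases le_total |w| 1 with h3 | h3
      · have := Real.rpow_le_one (abs_nonneg w) h3 h.q_pos.le
        nlinarith [sq_nonneg w]
      · have h4 := Real.rpow_le_rpow_of_exponent_le h3 (by linarith [h.q_le_one] : q ≤ 2)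
        rw [Real.rpow_two, sq_abs] at h4
        linarith
    have h5 : 0 ≤ |w| ^ q := by positivity
    have := mul_le_mul (by linarith [h.q_le_one] : 1 + q ≤ 2) h2 h5 zero_le_two
    dsimp only
    linarith
  rw [integral_add (integrable_const _) (i3.const_mul 2), integral_const_mul (2 : ℝ), hvar,
    integral_const, probReal_univ, one_smul] at h1
  linarith [(abs_le.1 hb).2]

end LocalLaw

/-! ### Images of a law under coordinate maps -/

section Image

variable {V : Type*} [Fintype V] [DecidableEq V] {G : SimpleGraph V} [DecidableRel G.Adj]

lemma IsDependencyGraph.map {Ω : Type*} [MeasurableSpace Ω] {P : Measure Ω} {X : V → Ω → ℝ}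
    (h : IsDependencyGraph G X P) (hX : ∀ i, Measurable (X i)) :
    IsDependencyGraph G (fun i (x : V → ℝ) => x i) (P.map fun ω i => X i ω) := by
  intro A B hAB hadj
  have hT : Measurable fun ω i => X i ω := measurable_pi_lambda _ hX
  have h1 := h A B hAB hadj
  rw [indepFun_iff_measure_inter_preimage_eq_mul] at h1 ⊢
  intro s t hs ht
  have hA : Measurable fun (x : V → ℝ) (i : A) => x i :=
    measurable_pi_lambda _ fun i => measurable_pi_apply _
  have hB : Measurable fun (x : V → ℝ) (i : B) => x i :=
    measurable_pi_lambda _ fun i => measurable_pi_apply _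
  rw [Measure.map_apply hT ((hA hs).inter (hB ht)), Measure.map_apply hT (hA hs),
    Measure.map_apply hT (hB ht)]
  exact h1 s t hs ht

lemma IsDependencyGraph.comp {Ω : Type*} [MeasurableSpace Ω] {P : Measure Ω} {X : V → Ω → ℝ}
    (h : IsDependencyGraph G X P) {φ : ℝ → ℝ} (hφ : Measurable φ) :
    IsDependencyGraph G (fun i ω => φ (X i ω)) P := by
  intro A B hAB hadj
  exact (h A B hAB hadj).comp (φ := fun y i => φ (y i)) (ψ := fun y i => φ (y i))
    (by fun_prop) (by fun_prop)

/-- The law obtained by applying the same function to every coordinate. -/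
noncomputable def mapLaw (μ : Measure (V → ℝ)) (φ : ℝ → ℝ) : Measure (V → ℝ) :=
  μ.map fun x i => φ (x i)

lemma measurable_coordMap {φ : ℝ → ℝ} (hφ : Measurable φ) :
    Measurable fun (x : V → ℝ) i => φ (x i) :=
  measurable_pi_lambda _ fun i => hφ.comp (measurable_pi_apply i)

lemma integral_mapLaw {μ : Measure (V → ℝ)} {φ : ℝ → ℝ} (hφ : Measurable φ) {f : (V → ℝ) → ℝ}
    (hf : Measurable f) : ∫ x, f x ∂(mapLaw μ φ) = ∫ x, f (fun i => φ (x i)) ∂μ :=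
  integral_map (measurable_coordMap hφ).aemeasurable hf.aestronglyMeasurable

lemma isProbabilityMeasure_mapLaw {μ : Measure (V → ℝ)} [IsProbabilityMeasure μ] {φ : ℝ → ℝ}
    (hφ : Measurable φ) : IsProbabilityMeasure (mapLaw μ φ) :=
  Measure.isProbabilityMeasure_map (measurable_coordMap hφ).aemeasurable

lemma LocalLaw.mapLaw {μ : Measure (V → ℝ)} {q θ : ℝ} (h : LocalLaw G μ q θ) {φ : ℝ → ℝ}
    (hφ : Measurable φ) (hle : ∀ t, |φ t| ≤ |t|) : LocalLaw G (mapLaw μ φ) q θ where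
  dep := (h.dep.comp hφ).map fun i => hφ.comp (measurable_pi_apply i)
  one_le_maxDegree := h.one_le_maxDegree
  q_pos := h.q_pos
  q_le_one := h.q_le_one
  theta_pos := h.theta_pos
  integrable_moment i := by
    have hm : Measurable fun x : V → ℝ => |x i| ^ (2 + q) := by fun_prop
    refine (integrable_map_measure hm.aestronglyMeasurable
      (measurable_coordMap hφ).aemeasurable).2 ?_
    refine (h.integrable_moment i).mono'
      (hm.comp (measurable_coordMap hφ)).aestronglyMeasurable (ae_of_all _ fun x => ?_)
    have hq := h.q_pos
    rw [Function.comp_apply, Real.norm_of_nonneg (by positivity)]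
    exact Real.rpow_le_rpow (abs_nonneg _) (hle _) (by linarith)
  moment_le i := by
    have hm : Measurable fun x : V → ℝ => |x i| ^ (2 + q) := by fun_prop
    have hq := h.q_pos
    rw [integral_mapLaw hφ hm]
    refine le_trans (integral_mono_of_nonneg (ae_of_all _ fun x => by positivity)
      (h.integrable_moment i) (ae_of_all _ fun x => ?_)) (h.moment_le i)
    exact Real.rpow_le_rpow (abs_nonneg _) (hle _) (by linarith)

end Image

/-! ### Exponential moments of bounded local sums -/

/-- The properties of the truncated summands: a local law with bounded coordinates, whose means and
whose total local covariance differ little from those of a centred law with variance one. The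
number `b` measures the size of the third-order moments. -/
structure BoundedLaw {V : Type*} [Fintype V] [DecidableEq V] (G : SimpleGraph V)
    [DecidableRel G.Adj] (μ : Measure (V → ℝ)) (q θ b : ℝ) : Prop extends
    LocalLaw G μ q θ where
  bdd : ∀ i, ∀ᵐ x ∂μ, 2 * (G.maxDegree : ℝ) ^ 5 * |x i| ≤ 1
  card_moment : (G.maxDegree : ℝ) ^ 5 * (Fintype.card V * θ ^ (2 + q)) ≤ b
  sum_mean : ∑ i, |∫ x, x i ∂μ| ≤ 4 * b
  cov_sum : |∑ i, ∫ x, x i * localSum G i x ∂μ - 1| ≤ 8 * b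
  b_pos : 0 < b
  b_le : b ≤ 1 / 1000000
  theta_le : (G.maxDegree : ℝ) ^ 5 * θ ^ 2 ≤ 1 / 10000

namespace BoundedLaw

variable {V : Type*} [Fintype V] [DecidableEq V] {G : SimpleGraph V} [DecidableRel G.Adj]
  {μ : Measure (V → ℝ)} [IsProbabilityMeasure μ] {q θ b : ℝ}

lemma ae_sum_ball_le (h : BoundedLaw G μ q θ b) :
    ∀ᵐ x ∂μ, ∀ i, ∑ l ∈ nbhdBall G 4 i, |x l| ≤ 1 := by
  filter_upwards [ae_all_iff.2 h.bdd] with x hx i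
  have hD := h.one_le_maxDegree_real
  have hD5 : 0 < 2 * (G.maxDegree : ℝ) ^ 5 := by positivity
  have h1 : ∀ l ∈ nbhdBall G 4 i, |x l| ≤ 1 / (2 * (G.maxDegree : ℝ) ^ 5) := fun l _ => by
    rw [le_div_iff₀ hD5, mul_comm]
    exact hx l
  refine (Finset.sum_le_card_nsmul _ _ _ h1).trans ?_
  rw [nsmul_eq_mul, mul_one_div, div_le_one hD5]
  refine (card_nbhdBall_le_real h.one_le_maxDegree 3 i).trans ?_
  have := pow_le_pow_right₀ hD (by norm_num : 4 ≤ 5)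
  simpa using this

lemma ae_abs_coordSum_le (h : BoundedLaw G μ q θ b) :
    ∀ᵐ x ∂μ, ∀ i, ∀ S ⊆ nbhdBall G 4 i, |coordSum S x| ≤ 1 := by
  filter_upwards [h.ae_sum_ball_le] with x hx i S hS
  refine (abs_coordSum_le S x).trans (le_trans ?_ (hx i))
  exact Finset.sum_le_sum_of_subset_of_nonneg hS fun _ _ _ => abs_nonneg _

lemma ae_abs_linSum_le (h : BoundedLaw G μ q θ b) {c : V → ℝ} (hc : ∀ l, |c l| ≤ 1) :
    ∀ᵐ x ∂μ, ∀ i, |LocalLaw.linSum (nbhdBall G 2 i) c x| ≤ 1 := by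
  filter_upwards [h.ae_sum_ball_le] with x hx i
  refine (Finset.abs_sum_le_sum_abs _ _).trans (le_trans ?_ (hx i))
  refine (Finset.sum_le_sum fun l _ => ?_).trans (Finset.sum_le_sum_of_subset_of_nonneg
    (nbhdBall_mono (by norm_num : 2 ≤ 4) i) fun _ _ _ => abs_nonneg _)
  rw [abs_mul]
  exact mul_le_of_le_one_left (abs_nonneg _) (hc l)

lemma ae_sum_le_card (h : BoundedLaw G μ q θ b) :
    ∀ᵐ x ∂μ, ∑ i, |x i| ≤ (Fintype.card V : ℝ) := by
  filter_upwards [ae_all_iff.2 h.bdd] with x hx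
  have hD := one_le_pow₀ (n := 5) h.one_le_maxDegree_real
  refine (Finset.sum_le_card_nsmul _ _ 1 fun i _ => ?_).trans_eq ?_
  · nlinarith [hx i, abs_nonneg (x i)]
  · simp

lemma integrable_exp (h : BoundedLaw G μ q θ b) (t : ℝ) (S : Finset V) :
    Integrable (fun x => Real.exp (t * coordSum S x)) μ := by
  refine (integrable_const (Real.exp (|t| * Fintype.card V))).mono'
    (by fun_prop : Measurable _).aestronglyMeasurable ?_
  filter_upwards [h.ae_sum_le_card] with x hx
  rw [Real.norm_of_nonneg (Real.exp_pos _).le]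
  refine Real.exp_le_exp.2 ((le_abs_self _).trans ?_)
  rw [abs_mul]
  exact mul_le_mul_of_nonneg_left ((LocalLaw.abs_coordSum_le_sum S x).trans hx) (abs_nonneg t)

lemma exp_le_three {t : ℝ} (ht : t ≤ 1) : Real.exp t ≤ 3 :=
  (Real.exp_le_exp.2 ht).trans (Real.exp_one_lt_d9.le.trans (by norm_num))

lemma exp_mul_le_three_mul {t v w : ℝ} (ht : |t| ≤ 1) (hvw : |v - w| ≤ 1) :
    Real.exp (t * v) ≤ 3 * Real.exp (t * w) := by
  have e : t * v = t * (v - w) + t * w := by ring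
  rw [e, Real.exp_add]
  refine mul_le_mul_of_nonneg_right (exp_le_three ?_) (Real.exp_pos _).le
  refine (le_abs_self _).trans ?_
  rw [abs_mul]
  exact mul_le_one₀ ht (abs_nonneg _) hvw

/-- Removing part of a ball changes the exponential moment by a bounded factor. -/
lemma integral_exp_compl_le (h : BoundedLaw G μ q θ b) {t : ℝ} (ht : |t| ≤ 1) {i : V}
    {S : Finset V} (hS : S ⊆ nbhdBall G 4 i) :
    ∫ x, Real.exp (t * coordSum (Finset.univ \ S) x) ∂μ
      ≤ 3 * ∫ x, Real.exp (t * coordSum Finset.univ x) ∂μ := by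
  rw [← integral_const_mul]
  refine integral_mono_ae (h.integrable_exp t _) ((h.integrable_exp t _).const_mul 3) ?_
  filter_upwards [h.ae_abs_coordSum_le] with x hx
  refine exp_mul_le_three_mul ht ?_
  rw [coordSum_sdiff (Finset.subset_univ S), sub_sub_cancel_left, abs_neg]
  exact hx i S hS

/-- A nonnegative function of the ball of radius two decouples from the exponential of the sum over
the complement of the ball. -/
lemma integral_mul_exp_le (h : BoundedLaw G μ q θ b) {t : ℝ} (ht : |t| ≤ 1) (i : V)
    {f : (V → ℝ) → ℝ} (hf : Measurable f) (hf0 : ∀ x, 0 ≤ f x)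
    (hfd : DependsOn f (nbhdBall G 2 i : Set V)) (hfi : Integrable f μ) :
    Integrable (fun x => f x * Real.exp (t * coordSum (Finset.univ \ nbhdBall G 2 i) x)) μ ∧
    ∫ x, f x * Real.exp (t * coordSum (Finset.univ \ nbhdBall G 2 i) x) ∂μ
      ≤ 9 * (∫ x, Real.exp (t * coordSum Finset.univ x) ∂μ) * ∫ x, f x ∂μ := by
  have hgm : Measurable fun x : V → ℝ =>
      Real.exp (t * coordSum (Finset.univ \ nbhdBall G 3 i) x) := by fun_prop
  have hind := h.integral_mul_compl_three i (f := f)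
    (g := fun x => Real.exp (t * coordSum (Finset.univ \ nbhdBall G 3 i) x)) hf hgm hfd
    (fun x y hxy => by dsimp only; rw [dependsOn_coordSum subset_rfl hxy])
  have hi3 : Integrable (fun x => f x * Real.exp (t * coordSum (Finset.univ \ nbhdBall G 3 i) x))
      μ := hind.integrable_mul hfi (h.integrable_exp t _)
  have hle : ∀ᵐ x ∂μ, f x * Real.exp (t * coordSum (Finset.univ \ nbhdBall G 2 i) x)
      ≤ 3 * (f x * Real.exp (t * coordSum (Finset.univ \ nbhdBall G 3 i) x)) := by
    filter_upwards [h.ae_abs_coordSum_le] with x hx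
    rw [mul_left_comm]
    refine mul_le_mul_of_nonneg_left (exp_mul_le_three_mul ht ?_) (hf0 x)
    rw [LocalLaw.coordSum_compl_two_eq, add_sub_cancel_left]
    exact hx i _ (Finset.sdiff_subset.trans (nbhdBall_mono (by norm_num) i))
  have hi2 : Integrable (fun x => f x * Real.exp
      (t * coordSum (Finset.univ \ nbhdBall G 2 i) x)) μ := by
    refine (hi3.const_mul 3).mono' (Measurable.aestronglyMeasurable (by fun_prop)) ?_
    filter_upwards [hle] with x hx
    rwa [Real.norm_of_nonneg (mul_nonneg (hf0 x) (Real.exp_pos _).le)]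
  refine ⟨hi2, (integral_mono_ae hi2 (hi3.const_mul 3) hle).trans ?_⟩
  rw [integral_const_mul, hind.integral_fun_mul_eq_mul_integral hf.aestronglyMeasurable
    hgm.aestronglyMeasurable]
  have h1 := mul_le_mul_of_nonneg_left (h.integral_exp_compl_le ht
    (nbhdBall_mono (by norm_num : 3 ≤ 4) i)) (integral_nonneg hf0 : 0 ≤ ∫ x, f x ∂μ)
  linarith

lemma steinTest_exp (h : BoundedLaw G μ q θ b) (t : ℝ) :
    LocalLaw.SteinTest μ q (fun w => Real.exp (t * w)) (fun w => t * Real.exp (t * w)) where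
  continuous_fun := by fun_prop
  continuous_deriv := by fun_prop
  sub_eq := by
    refine sub_eq_mul_integral_of_hasDerivAt (fun w => ?_)
      (F' := fun w => t * Real.exp (t * w)) (by fun_prop)
    have h1 : HasDerivAt (fun w : ℝ => t * w) t w := by
      simpa using (hasDerivAt_id w).const_mul t
    exact (h1.exp).congr_deriv (mul_comm _ _)
  growth := by
    refine ⟨(1 + |t|) * Real.exp (|t| * Fintype.card V), ?_⟩
    filter_upwards [h.ae_sum_le_card] with x hx w hw
    have h0 : 0 ≤ ∑ i, |x i| := Finset.sum_nonneg fun i _ => abs_nonneg _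
    have hq := h.q_pos
    have h1 := Real.one_le_rpow (by linarith : 1 ≤ 1 + ∑ i, |x i|) (by linarith : 0 ≤ 1 + q)
    have h2 := Real.one_le_rpow (by linarith : 1 ≤ 1 + ∑ i, |x i|) hq.le
    have h3 : Real.exp (t * w) ≤ Real.exp (|t| * Fintype.card V) := by
      refine Real.exp_le_exp.2 ((le_abs_self _).trans ?_)
      rw [abs_mul]
      exact mul_le_mul_of_nonneg_left (hw.trans hx) (abs_nonneg t)
    have ht := abs_nonneg t
    have hE := Real.exp_pos (|t| * Fintype.card V)
    have hE0 := Real.exp_pos (t * w)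
    rw [abs_mul, Real.abs_exp]
    constructor
    · refine le_trans ?_ (le_mul_of_one_le_right (by positivity) h1)
      nlinarith
    · refine le_trans ?_ (le_mul_of_one_le_right (by positivity) h2)
      nlinarith

/-- Exponential functions are smooth test functions under a bounded law, with the moment generating
function itself in the constant. -/
lemma smoothAt_exp (h : BoundedLaw G μ q θ b) {t : ℝ} (ht : t ∈ Icc (0 : ℝ) 1) (i : V) :
    LocalLaw.SmoothAt G μ q (fun w => t * Real.exp (t * w))
      (18 * ∫ x, Real.exp (t * coordSum Finset.univ x) ∂μ) i := by
  intro ζ c hζ hζ0 hζd hζi hζT hc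
  have ht1 : |t| ≤ 1 := by rw [abs_of_nonneg ht.1]; exact ht.2
  have hTm : Measurable fun x : V → ℝ => ζ x * |LocalLaw.linSum (nbhdBall G 2 i) c x| := by
    fun_prop
  have hd : DependsOn (fun x => ζ x * |LocalLaw.linSum (nbhdBall G 2 i) c x|)
      (nbhdBall G 2 i : Set V) := hζd.mul_fun fun x y hxy => by
    simp only [LocalLaw.dependsOn_linSum _ _ hxy]
  have hle : ∀ᵐ x ∂μ, ζ x * |LocalLaw.linSum (nbhdBall G 2 i) c x|
      ≤ ζ x * ∑ l ∈ nbhdBall G 3 i, |x l| ^ q := by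
    filter_upwards [h.ae_abs_linSum_le hc] with x hx
    refine mul_le_mul_of_nonneg_left ?_ (hζ0 x)
    refine (Real.self_le_rpow_of_le_one (abs_nonneg _) (hx i) h.q_le_one).trans
      ((h.abs_linSum_rpow_le _ hc x).trans ?_)
    exact Finset.sum_le_sum_of_subset_of_nonneg (nbhdBall_mono (by norm_num) i)
      fun _ _ _ => by positivity
  have hi : Integrable (fun x => ζ x * |LocalLaw.linSum (nbhdBall G 2 i) c x|) μ := by
    refine hζT.mono' hTm.aestronglyMeasurable ?_
    filter_upwards [hle] with x hx
    rwa [Real.norm_of_nonneg (mul_nonneg (hζ0 x) (abs_nonneg _))]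
  obtain ⟨h1, h2⟩ := h.integral_mul_exp_le ht1 i hTm
    (fun x => mul_nonneg (hζ0 x) (abs_nonneg _)) hd hi
  have h3 : ∫ x, ζ x * |t * Real.exp (t * (coordSum (Finset.univ \ nbhdBall G 2 i) x
        + LocalLaw.linSum (nbhdBall G 2 i) c x))
        - t * Real.exp (t * coordSum (Finset.univ \ nbhdBall G 2 i) x)| ∂μ
      ≤ ∫ x, 2 * (ζ x * |LocalLaw.linSum (nbhdBall G 2 i) c x|
        * Real.exp (t * coordSum (Finset.univ \ nbhdBall G 2 i) x)) ∂μ := by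
    refine integral_mono_of_nonneg (ae_of_all _ fun x => mul_nonneg (hζ0 x) (abs_nonneg _))
      (h1.const_mul 2) ?_
    filter_upwards [h.ae_abs_linSum_le hc] with x hx
    set R := LocalLaw.linSum (nbhdBall G 2 i) c x with hR
    set w := coordSum (Finset.univ \ nbhdBall G 2 i) x with hw
    have h4 : |t * R| ≤ 1 := by
      rw [abs_mul]; exact mul_le_one₀ ht1 (abs_nonneg _) (hx i)
    have h5 := Real.abs_exp_sub_one_le h4
    have e : t * Real.exp (t * (w + R)) - t * Real.exp (t * w)
        = t * (Real.exp (t * R) - 1) * Real.exp (t * w) := by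
      rw [mul_add, Real.exp_add]; ring
    rw [e, abs_mul, abs_mul, Real.abs_exp]
    have h6 : |t| * |Real.exp (t * R) - 1| ≤ 2 * |R| := by
      rw [abs_mul] at h5
      have h7 : |t| * |R| ≤ |R| := mul_le_of_le_one_left (abs_nonneg _) ht1
      have h8 := mul_le_mul ht1 h5 (abs_nonneg _) zero_le_one
      linarith
    have h9 := mul_le_mul_of_nonneg_left (mul_le_mul_of_nonneg_right h6
      (Real.exp_pos (t * w)).le) (hζ0 x)
    linarith
  refine h3.trans ?_
  rw [integral_const_mul]
  have h4 := integral_mono_ae hi hζT hle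
  have h5 : 0 ≤ ∫ x, Real.exp (t * coordSum Finset.univ x) ∂μ :=
    integral_nonneg fun x => (Real.exp_pos _).le
  have h6 := mul_le_mul_of_nonneg_left h4 h5
  linarith

lemma four_mul_card_moment_le (h : BoundedLaw G μ q θ b) :
    4 * (G.maxDegree : ℝ) ^ 4 * (Fintype.card V * θ ^ (2 + q)) ≤ 4 * b := by
  have h5 := pow_le_pow_right₀ h.one_le_maxDegree_real (by norm_num : 4 ≤ 5)
  have h6 : 0 ≤ Fintype.card V * θ ^ (2 + q) := by
    have := Real.rpow_nonneg h.theta_pos.le (2 + q)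
    positivity
  have h7 := mul_le_mul_of_nonneg_right h5 h6
  linarith [h.card_moment]

/-- The exponential moment of the sum: the local Stein identity for `w ↦ exp (t * w)` gives the
differential inequality `m' ≤ 2 * m` for the moment generating function `m` on `[0, 1]`. -/
theorem integral_exp_le (h : BoundedLaw G μ q θ b) :
    ∫ x, Real.exp (coordSum Finset.univ x) ∂μ ≤ 9 := by
  set W : (V → ℝ) → ℝ := coordSum Finset.univ with hW
  have hset : integrableExpSet W μ = univ := eq_univ_of_forall fun t => h.integrable_exp t _
  have hder : ∀ t, HasDerivAt (mgf W μ) (μ[fun x => W x * Real.exp (t * W x)]) t := fun t =>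
    hasDerivAt_mgf (by rw [hset, interior_univ]; trivial)
  have hb := h.b_pos
  have hb1 := h.b_le
  have hbound : ∀ t ∈ Icc (0 : ℝ) 1, (μ[fun x => W x * Real.exp (t * W x)]) ≤ 2 * mgf W μ t := by
    intro t ht
    have ht1 : |t| ≤ 1 := by rw [abs_of_nonneg ht.1]; exact ht.2
    set g := mgf W μ t with hg
    have hg0 : 0 ≤ g := mgf_nonneg
    have hge : ∫ x, Real.exp (t * coordSum Finset.univ x) ∂μ = g := rfl
    obtain ⟨-, -, h1⟩ := h.stein_identity (h.steinTest_exp t) (by rw [hge]; positivity)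
      (fun i => h.smoothAt_exp ht i)
    rw [integral_const_mul, hge] at h1
    have h2 : ∑ i, (∫ x, x i ∂μ) * ∫ x, Real.exp (t * (coordSum Finset.univ x - localSum G i x)) ∂μ
        ≤ 4 * b * (3 * g) := by
      calc _ ≤ ∑ i, |∫ x, x i ∂μ| * (3 * g) := by
            refine Finset.sum_le_sum fun i _ => ?_
            have h3 := h.integral_exp_compl_le ht1 (i := i) (S := nbhdBall G 1 i)
              (nbhdBall_mono (by norm_num) i)
            simp_rw [LocalLaw.coordSum_univ_sub_localSum] at h3
            exact mul_le_mul (le_abs_self _) h3 (integral_nonneg fun x => (Real.exp_pos _).le)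
              (abs_nonneg _)
        _ = (∑ i, |∫ x, x i ∂μ|) * (3 * g) := by rw [Finset.sum_mul]
        _ ≤ _ := mul_le_mul_of_nonneg_right h.sum_mean (by positivity)
    have h3 : (∑ i, ∫ x, x i * localSum G i x ∂μ) * (t * g) ≤ (1 + 8 * b) * g := by
      have h4 := (abs_le.1 h.cov_sum).2
      have h5 : t * g ≤ g := mul_le_of_le_one_left hg0 ht.2
      have h6 : 0 ≤ t * g := mul_nonneg ht.1 hg0
      nlinarith
    have h5 := mul_le_mul_of_nonneg_left h.four_mul_card_moment_le
      (by positivity : 0 ≤ 2 * (18 * g))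
    have h6 := (abs_le.1 h1).2
    have h7 : b * g ≤ 1 / 1000000 * g := mul_le_mul_of_nonneg_right hb1 hg0
    change ∫ x, W x * Real.exp (t * W x) ∂μ ≤ 2 * g
    linarith
  have hanti : AntitoneOn (fun t => Real.exp (-2 * t) * mgf W μ t) (Icc 0 1) := by
    have hd : ∀ t, HasDerivAt (fun t => Real.exp (-2 * t) * mgf W μ t)
        (Real.exp (-2 * t) * -2 * mgf W μ t
          + Real.exp (-2 * t) * μ[fun x => W x * Real.exp (t * W x)]) t := by
      intro t
      have h1 : HasDerivAt (fun t : ℝ => -2 * t) (-2) t := by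
        simpa using (hasDerivAt_id t).const_mul (-2)
      exact h1.exp.mul (hder t)
    refine antitoneOn_of_deriv_nonpos (convex_Icc 0 1)
      (fun t _ => (hd t).continuousAt.continuousWithinAt)
      (fun t _ => (hd t).differentiableAt.differentiableWithinAt) fun t ht => ?_
    rw [interior_Icc] at ht
    rw [(hd t).deriv]
    have h1 := mul_le_mul_of_nonneg_left (hbound t (Ioo_subset_Icc_self ht))
      (Real.exp_pos (-2 * t)).le
    linarith
  have h1 := hanti (left_mem_Icc.2 zero_le_one) (right_mem_Icc.2 zero_le_one) zero_le_one
  simp only [mul_one, mul_zero, Real.exp_zero, mgf_zero] at h1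
  have h2 : mgf W μ 1 ≤ Real.exp 2 := by
    have h3 := mul_le_mul_of_nonneg_left h1 (Real.exp_pos 2).le
    rw [← mul_assoc, ← Real.exp_add] at h3
    norm_num at h3
    exact h3
  have h3 : Real.exp 2 ≤ 9 := by
    have h4 := exp_le_three (le_refl (1 : ℝ))
    have h5 : Real.exp 2 = Real.exp 1 * Real.exp 1 := by rw [← Real.exp_add]; norm_num
    rw [h5]
    nlinarith [Real.exp_pos 1]
  have h4 : mgf W μ 1 = ∫ x, Real.exp (W x) ∂μ := by simp [mgf]
  linarith

/-- Negating the coordinates preserves all hypotheses; this turns bounds for `exp W` into bounds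
for `exp (-W)`. -/
lemma neg (h : BoundedLaw G μ q θ b) : BoundedLaw G (mapLaw μ fun t => -t) q θ b where
  toLocalLaw := h.toLocalLaw.mapLaw measurable_neg fun t => (abs_neg t).le
  bdd i := by
    have hs : MeasurableSet {x : V → ℝ | 2 * (G.maxDegree : ℝ) ^ 5 * |x i| ≤ 1} :=
      measurableSet_le (by fun_prop) measurable_const
    rw [mapLaw, ae_map_iff (measurable_coordMap measurable_neg).aemeasurable hs]
    simpa only [abs_neg] using h.bdd i
  card_moment := h.card_moment
  sum_mean := by
    have e : ∀ i, ∫ x, x i ∂(mapLaw μ fun t => -t) = -∫ x, x i ∂μ := fun i => by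
      rw [integral_mapLaw measurable_neg (measurable_pi_apply i), integral_neg]
    simp only [e, abs_neg]
    exact h.sum_mean
  cov_sum := by
    have e : ∀ i, ∫ x, x i * localSum G i x ∂(mapLaw μ fun t => -t)
        = ∫ x, x i * localSum G i x ∂μ := fun i => by
      rw [integral_mapLaw (f := fun x => x i * localSum G i x) measurable_neg
        ((measurable_pi_apply i).mul (LocalLaw.measurable_localSum i))]
      simp [localSum, coordSum]
    simp only [e]
    exact h.cov_sum
  b_pos := h.b_pos
  b_le := h.b_le
  theta_le := h.theta_le

lemma integral_exp_neg_le (h : BoundedLaw G μ q θ b) :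
    ∫ x, Real.exp (-coordSum Finset.univ x) ∂μ ≤ 9 := by
  have := isProbabilityMeasure_mapLaw (μ := μ) measurable_neg
  have h1 := h.neg.integral_exp_le
  rw [integral_mapLaw measurable_neg (by fun_prop)] at h1
  simpa [coordSum] using h1

end BoundedLaw

/-! ### The normal approximation of bounded local sums in the tail -/

lemma exp_half_mul_le (w : ℝ) : Real.exp (1 / 2 * w) ≤ 1 + Real.exp w := by
  have h1 : Real.exp w = Real.exp (1 / 2 * w) ^ 2 := by
    rw [← Real.exp_nat_mul]; congr 1; push_cast; ring
  rw [h1]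
  nlinarith [sq_nonneg (Real.exp (1 / 2 * w) - 1), Real.exp_pos (1 / 2 * w)]

lemma max_mul_exp_half_le (w : ℝ) : max w 0 * Real.exp (1 / 2 * w) ≤ 2 * Real.exp w := by
  have h1 : Real.exp w = Real.exp (1 / 2 * w) * Real.exp (1 / 2 * w) := by
    rw [← Real.exp_add]; congr 1; ring
  have h2 : max w 0 ≤ 2 * Real.exp (1 / 2 * w) :=
    max_le (by linarith [Real.add_one_le_exp (1 / 2 * w)]) (by positivity)
  rw [h1, ← mul_assoc]
  exact mul_le_mul_of_nonneg_right h2 (Real.exp_pos _).le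

namespace BoundedLaw

variable {V : Type*} [Fintype V] [DecidableEq V] {G : SimpleGraph V} [DecidableRel G.Adj]
  {μ : Measure (V → ℝ)} [IsProbabilityMeasure μ] {q θ b : ℝ}

lemma sum_cov_ge (h : BoundedLaw G μ q θ b) (i : V) :
    6 / 7 ≤ ∑ j ∈ Finset.univ \ nbhdBall G 4 i, ∫ x, x j * localSum G j x ∂μ := by
  have h1 := (abs_le.1 h.cov_sum).1
  have h2 : ∑ j ∈ nbhdBall G 4 i, ∫ x, x j * localSum G j x ∂μ ≤ 4 / 10000 := by
    refine (Finset.sum_le_card_nsmul _ _ _ fun j _ =>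
      (le_abs_self _).trans (h.abs_integral_coord_mul_localSum_le j)).trans ?_
    rw [nsmul_eq_mul]
    have h3 := card_nbhdBall_le_real h.one_le_maxDegree 3 i
    have h4 : 0 ≤ 2 * (G.maxDegree : ℝ) * θ ^ 2 := by positivity
    have h5 := mul_le_mul_of_nonneg_right h3 h4
    have h6 := h.theta_le
    have e : 2 * (G.maxDegree : ℝ) ^ (3 + 1) * (2 * (G.maxDegree : ℝ) * θ ^ 2)
        = 4 * ((G.maxDegree : ℝ) ^ 5 * θ ^ 2) := by ring
    linarith
  have h3 := Finset.sum_sdiff (f := fun j => ∫ x, x j * localSum G j x ∂μ)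
    (Finset.subset_univ (nbhdBall G 4 i))
  have := h.b_le
  linarith

/-- The concentration inequality with exponential weights. For the width `α = 48 * b` the
self-referring term `exp 1 * (4 * b) / α` of `concentration_localTilt` is `exp 1 / 12`, well below
the local variance `6 / 7`. -/
theorem concentration_exp (h : BoundedLaw G μ q θ b) (i : V) {ζ : (V → ℝ) → ℝ}
    (hζ : Measurable ζ) (hζ0 : ∀ x, 0 ≤ ζ x) (hζS : DependsOn ζ (nbhdBall G 2 i : Set V))
    (hζi : Integrable ζ μ) {a : (V → ℝ) → ℝ} (ham : Measurable a)
    (haS : DependsOn a (nbhdBall G 2 i : Set V)) {C : ℝ} (hab : ∀ x, a x ≤ C) :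
    ∫ x, ζ x * (Real.exp (1 / 2 * a x) * window (48 * b) (coordSum Finset.univ x - a x)) ∂μ
      ≤ 2500 * (48 * b) * ∫ x, ζ x ∂μ := by
  have hb := h.b_pos
  have hb1 := h.b_le
  rcases (integral_nonneg hζ0 : 0 ≤ ∫ x, ζ x ∂μ).eq_or_lt with h0 | hpos
  · have hz := (integral_eq_zero_iff_of_nonneg hζ0 hζi).1 h0.symm
    rw [← h0, mul_zero]
    refine (integral_eq_zero_of_ae ?_).le
    filter_upwards [hz] with x hx
    simp [hx]
  set S := nbhdBall G 2 i with hS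
  set J := Finset.univ \ closedNbhd G (closedNbhd G S) with hJ
  have hS4 : closedNbhd G (closedNbhd G S) = nbhdBall G 4 i := by
    rw [hS, ← nbhdBall_succ, ← nbhdBall_succ]
  have hJd : Disjoint (closedNbhd G S) J :=
    Disjoint.mono_left (subset_closedNbhd _) Finset.disjoint_sdiff
  have hid : IdentDistrib (coordSum J) (coordSum J) (localTilt μ ζ) μ :=
    identDistrib_localTilt hζ hζ0 hζi hpos (measurable_coordSum J)
      (h.dep.indepFun hJd hζ (measurable_coordSum J) hζS (dependsOn_coordSum subset_rfl))
  have hP := isProbabilityMeasure_localTilt hζ0 hζi hpos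
  have hac : localTilt μ ζ ≪ μ := withDensity_absolutelyContinuous _ _
  set W : (V → ℝ) → ℝ := coordSum Finset.univ with hW
  have hWJ : ∀ᵐ x ∂(localTilt μ ζ), |W x - coordSum J x| ≤ 1 := by
    filter_upwards [hac.ae_le h.ae_abs_coordSum_le] with x hx
    rw [hJ, hS4, coordSum_sdiff (Finset.subset_univ _), sub_sub_cancel]
    exact hx i _ subset_rfl
  -- the exponential moments under the tilted law
  have hidm := hid.comp (u := fun t : ℝ => Real.exp (1 * t)) (by fun_prop)
  have iJ : Integrable (fun x => Real.exp (1 * coordSum J x)) (localTilt μ ζ) :=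
    hidm.symm.integrable_snd (h.integrable_exp 1 J)
  have eJ : ∫ x, Real.exp (1 * coordSum J x) ∂(localTilt μ ζ) ≤ 27 := by
    refine hidm.integral_eq.trans_le ?_
    have h1 := h.integral_exp_compl_le (t := 1) (by simp) (i := i) (S := nbhdBall G 4 i) subset_rfl
    rw [← hS4] at h1
    have h2 := h.integral_exp_le
    simp only [one_mul] at h1 ⊢
    change ∫ x, Real.exp (coordSum J x) ∂μ ≤ 27
    linarith
  have i1 : Integrable (fun x => Real.exp (1 * W x)) (localTilt μ ζ) := by
    refine (iJ.const_mul 3).mono' (by fun_prop : Measurable _).aestronglyMeasurable ?_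
    filter_upwards [hWJ] with x hx
    rw [Real.norm_of_nonneg (Real.exp_pos _).le]
    exact exp_mul_le_three_mul (by simp) hx
  have e1 : ∫ x, Real.exp (1 * W x) ∂(localTilt μ ζ) ≤ 81 := by
    have h1 := integral_mono_ae i1 (iJ.const_mul 3) (by
      filter_upwards [hWJ] with x hx
      exact exp_mul_le_three_mul (by simp) hx)
    rw [integral_const_mul] at h1
    linarith
  have i2 : Integrable (fun x => Real.exp (1 / 2 * W x)) (localTilt μ ζ) := by
    refine ((integrable_const 1).add i1).mono' (by fun_prop : Measurable _).aestronglyMeasurable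
      (ae_of_all _ fun x => ?_)
    rw [Real.norm_of_nonneg (Real.exp_pos _).le]
    have := exp_half_mul_le (W x)
    simpa using this
  have e2 : ∫ x, Real.exp (1 / 2 * W x) ∂(localTilt μ ζ) ≤ 82 := by
    have h1 := integral_mono i2 ((integrable_const 1).add i1) fun x => by
      have := exp_half_mul_le (W x)
      simpa using this
    simp only [Pi.add_apply] at h1
    rw [integral_add (integrable_const _) i1, integral_const, probReal_univ, one_smul] at h1
    linarith
  have hle3 : ∀ᵐ x ∂(localTilt μ ζ), max (coordSum J x) 0 * Real.exp (1 / 2 * W x)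
      ≤ 6 * Real.exp (1 * coordSum J x) := by
    filter_upwards [hWJ] with x hx
    have h1 : Real.exp (1 / 2 * W x) ≤ 3 * Real.exp (1 / 2 * coordSum J x) :=
      exp_mul_le_three_mul (by rw [abs_le]; norm_num) hx
    have h2 := max_mul_exp_half_le (coordSum J x)
    have h3 := mul_le_mul_of_nonneg_left h1 (le_max_right (coordSum J x) 0)
    rw [one_mul]
    linarith
  have i3 : Integrable (fun x => max (coordSum J x) 0 * Real.exp (1 / 2 * W x))
      (localTilt μ ζ) := by
    refine (iJ.const_mul 6).mono' (Measurable.aestronglyMeasurable (by fun_prop)) ?_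
    filter_upwards [hle3] with x hx
    rwa [Real.norm_of_nonneg (mul_nonneg (le_max_right _ _) (Real.exp_pos _).le)]
  have e3 : ∫ x, max (coordSum J x) 0 * Real.exp (1 / 2 * W x) ∂(localTilt μ ζ) ≤ 162 := by
    have h1 := integral_mono_ae i3 (iJ.const_mul 6) hle3
    rw [integral_const_mul] at h1
    linarith
  have hκ := h.sum_cov_ge i
  rw [← hS4, ← hJ] at hκ
  have hB : ∑ j ∈ J, |∫ x, x j ∂μ| ≤ 4 * b :=
    (Finset.sum_le_sum_of_subset_of_nonneg (Finset.subset_univ J)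
      fun _ _ _ => abs_nonneg _).trans h.sum_mean
  have e12 : (2 : ℝ) * (1 / 2) = 1 := by norm_num
  have hx1 := exp_le_three (le_refl (1 : ℝ))
  have hx2 := exp_le_three (by norm_num : (1 / 2 : ℝ) ≤ 1)
  have hx3 : Real.exp (4 * (1 / 2)) ≤ 9 := by
    have h5 : Real.exp (4 * (1 / 2)) = Real.exp 1 * Real.exp 1 := by
      rw [← Real.exp_add]; norm_num
    rw [h5]
    nlinarith [Real.exp_pos 1]
  have eα : Real.exp 1 * (4 * b) / (48 * b) = Real.exp 1 / 12 := by
    field_simp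
    norm_num
  have hres := h.concentration_localTilt (S := S) (J := J) Finset.disjoint_sdiff hζ hζ0 hζS hζi
    hpos (lam := 1 / 2) (α := 48 * b) (κ := 6 / 7) (A := 162) (B := 4 * b) (N := 82) (M₂ := 81)
    (β := 4 * b) (by norm_num) (by linarith) (by linarith) (Or.inr fun j => ?_)
    (by rw [e12]; exact i1) (by rw [e12]; exact e1) i3 e3 hB i2 e2 h.four_mul_card_moment_le hκ
    (by rw [e12, eα]; linarith) ham haS ⟨1 / 2 * C, fun x => by linarith [hab x]⟩
  · rw [integral_localTilt hζ hζ0, e12, eα, mul_div_assoc', div_le_iff₀ hpos] at hres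
    set I := ∫ x, ζ x * (Real.exp (1 / 2 * a x) * window (48 * b) (coordSum Finset.univ x - a x)) ∂μ
      with hI
    have hI0 : 0 ≤ I := integral_nonneg fun x =>
      mul_nonneg (hζ0 x) (mul_nonneg (Real.exp_pos _).le (window_nonneg _ _))
    have h1 : 1 / 2 * I ≤ (6 / 7 - 4 * b - Real.exp 1 / 12) * I :=
      mul_le_mul_of_nonneg_right (by linarith) hI0
    have h2 : 48 * b * (2 * Real.exp (1 / 2) * 162 + 2 * Real.exp 1 * (4 * b * 82))
        + 3 / 8 * (48 * b) * Real.exp (4 * (1 / 2)) * 81 + 3 * (4 * b) ≤ 1250 * (48 * b) := by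
      have h3 : 2 * Real.exp (1 / 2) * 162 + 2 * Real.exp 1 * (4 * b * 82) ≤ 973 := by
        have h4 : Real.exp 1 * b ≤ 3 * (1 / 1000000) :=
          mul_le_mul hx1 hb1 hb.le (by norm_num)
        linarith
      have h5 := mul_le_mul_of_nonneg_left h3 (by linarith : 0 ≤ 48 * b)
      have h6 := mul_le_mul_of_nonneg_left hx3 (by linarith : 0 ≤ 3 / 8 * (48 * b) * 81)
      linarith
    have h3 := mul_le_mul_of_nonneg_right h2 hpos.le
    linarith
  · filter_upwards [h.ae_abs_coordSum_le] with x hx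
    exact hx j _ (nbhdBall_mono (by norm_num) j)

/-- The smoothness of the derivative of the Stein solution at a level `z ≥ 2`, with a constant
exponentially small in `z`: the window near `z` is reweighted by `exp (W / 2)`. -/
lemma smoothAt_avgDeriv (h : BoundedLaw G μ q θ b) {z : ℝ} (hz : 2 ≤ z) (i : V) :
    LocalLaw.SmoothAt G μ q (avgDeriv (48 * b) z) (10100 * Real.exp (-z / 4)) i := by
  intro ζ c hζ hζ0 hζd hζi hζT hc
  have hb := h.b_pos
  have hα : 0 < 48 * b := by linarith
  set R := LocalLaw.linSum (nbhdBall G 2 i) c with hR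
  set W₂ : (V → ℝ) → ℝ := coordSum (Finset.univ \ nbhdBall G 2 i) with hW₂
  have hRm : Measurable R := LocalLaw.measurable_linSum _ _
  have hRd : DependsOn R (nbhdBall G 2 i : Set V) := LocalLaw.dependsOn_linSum _ _
  set χ : (V → ℝ) → ℝ := fun x => ζ x * |R x| with hχ
  have hχm : Measurable χ := hζ.mul hRm.abs
  have hχ0 : ∀ x, 0 ≤ χ x := fun x => mul_nonneg (hζ0 x) (abs_nonneg _)
  have hχd : DependsOn χ (nbhdBall G 2 i : Set V) := hζd.mul_fun fun x y hxy => by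
    simp only [hRd hxy]
  have hχT : ∀ᵐ x ∂μ, χ x ≤ ζ x * ∑ l ∈ nbhdBall G 3 i, |x l| ^ q := by
    filter_upwards [h.ae_abs_linSum_le hc] with x hx
    refine mul_le_mul_of_nonneg_left ?_ (hζ0 x)
    refine (Real.self_le_rpow_of_le_one (abs_nonneg _) (hx i) h.q_le_one).trans
      ((h.abs_linSum_rpow_le _ hc x).trans ?_)
    exact Finset.sum_le_sum_of_subset_of_nonneg (nbhdBall_mono (by norm_num) i)
      fun _ _ _ => by positivity
  have hχi : Integrable χ μ := by
    refine hζT.mono' hχm.aestronglyMeasurable ?_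
    filter_upwards [hχT] with x hx
    rwa [Real.norm_of_nonneg (hχ0 x)]
  obtain ⟨ip, bp⟩ := h.integral_mul_exp_le (t := 1) (by simp) i hχm hχ0 hχd hχi
  obtain ⟨im, bm⟩ := h.integral_mul_exp_le (t := -1) (by simp) i hχm hχ0 hχd hχi
  simp only [one_mul, neg_mul] at ip bp im bm
  have hχI : 0 ≤ ∫ x, χ x ∂μ := integral_nonneg hχ0
  have bp' := mul_le_mul_of_nonneg_right h.integral_exp_le hχI
  have bm' := mul_le_mul_of_nonneg_right h.integral_exp_neg_le hχI
  have hE := Real.exp_pos (-z / 4)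
  have hseg := LocalLaw.integral_ramp_sub_le (G := G) (α := 48 * b) (z := z)
    (c₀ := 7500 * Real.exp (-z / 4) * (48 * b) * ∫ x, χ x ∂μ) hα i hχm hχ0 hχi hRm ?_
  · have hpt : ∀ᵐ x ∂μ, ζ x * |avgDeriv (48 * b) z (W₂ x + R x) - avgDeriv (48 * b) z (W₂ x)|
        ≤ (16 * Real.exp (-z / 4) * (χ x * Real.exp (W₂ x))
          + 16 * Real.exp (-z / 4) * (χ x * Real.exp (-W₂ x)))
          + 1 / (48 * b) * ∫ r in (0 : ℝ)..1, χ x * window (48 * b) (W₂ x - z + r * R x) := by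
      filter_upwards [h.ae_abs_linSum_le hc] with x hx
      have h1 := avgDeriv_sub_eq hα z (W₂ x + R x) (W₂ x)
      have h2 := abs_mul_avgSol_sub_le_weighted hα hz (v := W₂ x + R x) (w := W₂ x) (by
        rw [add_sub_cancel_left]; exact (hx i).trans (by norm_num))
      have e : W₂ x + R x - z = W₂ x - z + R x := by ring
      have h3 := abs_ramp_add_sub hα (W₂ x - z) (R x)
      rw [add_sub_cancel_left] at h2
      rw [e] at h1
      have h4 : |avgDeriv (48 * b) z (W₂ x + R x) - avgDeriv (48 * b) z (W₂ x)|
          ≤ 16 * Real.exp (-z / 4) * (|R x| * (Real.exp (W₂ x) + Real.exp (-W₂ x)))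
            + |R x| / (48 * b) * ∫ r in (0 : ℝ)..1, window (48 * b) (W₂ x - z + r * R x) := by
        rw [h1, ← h3]
        exact (abs_sub _ _).trans (add_le_add h2 le_rfl)
      have h5 := mul_le_mul_of_nonneg_left h4 (hζ0 x)
      rw [intervalIntegral.integral_const_mul]
      refine h5.trans_eq ?_
      simp only [hχ]
      ring
    have iq : Integrable (fun x => 16 * Real.exp (-z / 4) * (χ x * Real.exp (W₂ x))
          + 16 * Real.exp (-z / 4) * (χ x * Real.exp (-W₂ x))) μ :=
      (ip.const_mul _).add (im.const_mul _)
    have h1 := integral_mono_of_nonneg (ae_of_all _ fun x => mul_nonneg (hζ0 x) (abs_nonneg _))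
      (iq.add hseg.1) hpt
    simp only [Pi.add_apply] at h1
    rw [integral_add iq hseg.1, integral_add (ip.const_mul _) (im.const_mul _),
      integral_const_mul, integral_const_mul] at h1
    refine h1.trans ?_
    have h2 := integral_mono_ae hχi hζT hχT
    have h3 := hseg.2
    have e : 1 / (48 * b) * (7500 * Real.exp (-z / 4) * (48 * b) * ∫ x, χ x ∂μ)
        = 7500 * (Real.exp (-z / 4) * ∫ x, χ x ∂μ) := by
      field_simp
    rw [e] at h3
    have h4 := mul_le_mul_of_nonneg_left bp (by linarith : 0 ≤ 16 * Real.exp (-z / 4))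
    have h5 := mul_le_mul_of_nonneg_left bm (by linarith : 0 ≤ 16 * Real.exp (-z / 4))
    have h6 := mul_le_mul_of_nonneg_left bp' (by linarith : 0 ≤ 144 * Real.exp (-z / 4))
    have h7 := mul_le_mul_of_nonneg_left bm' (by linarith : 0 ≤ 144 * Real.exp (-z / 4))
    have h8 := mul_le_mul_of_nonneg_left h2 hE.le
    have h9 : 0 ≤ Real.exp (-z / 4) * ∫ x, χ x ∂μ := by positivity
    linarith
  · rintro a ⟨r, hr, rfl⟩
    -- the windows lie beyond `z - 2`, where the exponential weight exceeds `exp (z / 2 - 1)`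
    set a : (V → ℝ) → ℝ := fun x => min (coordSum (nbhdBall G 2 i) x - r * R x + z) (z + 2) with ha
    have ham : Measurable a := by fun_prop
    have had : DependsOn a (nbhdBall G 2 i : Set V) := by
      intro x y hxy
      have h1 : coordSum (nbhdBall G 2 i) x = coordSum (nbhdBall G 2 i) y :=
        dependsOn_coordSum subset_rfl hxy
      simp only [ha, h1, hRd hxy]
    have hconc := h.concentration_exp i hχm hχ0 hχd hχi ham had (C := z + 2)
      fun x => min_le_right _ _
    have hle : ∀ᵐ x ∂μ, χ x * window (48 * b) (coordSum Finset.univ x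
        - (coordSum (nbhdBall G 2 i) x - r * R x + z))
        ≤ 3 * Real.exp (-z / 4) * (χ x * (Real.exp (1 / 2 * a x)
          * window (48 * b) (coordSum Finset.univ x - a x))) := by
      filter_upwards [h.ae_abs_linSum_le hc, h.ae_abs_coordSum_le] with x hx hx'
      have h1 := abs_le.1 (hx' i (nbhdBall G 2 i) (nbhdBall_mono (by norm_num) i))
      have h2 : |r * R x| ≤ 1 := by
        rw [abs_mul, abs_of_nonneg hr.1]
        exact mul_le_one₀ hr.2 (abs_nonneg _) (hx i)
      have h3 := abs_le.1 h2
      have e : a x = coordSum (nbhdBall G 2 i) x - r * R x + z := min_eq_left (by linarith)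
      rw [← e]
      have h4 : 1 ≤ 3 * Real.exp (-z / 4) * Real.exp (1 / 2 * a x) := by
        have h5 : 1 ≤ Real.exp 1 * Real.exp (-z / 4) * Real.exp (1 / 2 * a x) := by
          rw [← Real.exp_add, ← Real.exp_add]
          refine Real.one_le_exp ?_
          rw [e]
          linarith
        refine h5.trans ?_
        gcongr
        exact exp_le_three le_rfl
      have h6 := mul_le_mul_of_nonneg_right h4 (mul_nonneg (hχ0 x)
        (window_nonneg (48 * b) (coordSum Finset.univ x - a x)))
      linarith
    have hi : Integrable (fun x => χ x * (Real.exp (1 / 2 * a x)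
          * window (48 * b) (coordSum Finset.univ x - a x))) μ := by
      refine hχi.mul_bdd (c := Real.exp (1 / 2 * (z + 2))) (Measurable.aestronglyMeasurable
        ((ham.const_mul _).exp.mul ((measurable_window _).comp (by fun_prop))))
        (ae_of_all _ fun x => ?_)
      rw [Real.norm_of_nonneg (mul_nonneg (Real.exp_pos _).le (window_nonneg _ _))]
      have h1 : Real.exp (1 / 2 * a x) ≤ Real.exp (1 / 2 * (z + 2)) :=
        Real.exp_le_exp.2 (mul_le_mul_of_nonneg_left (min_le_right _ _) (by norm_num))
      exact (mul_le_of_le_one_right (Real.exp_pos _).le (window_le_one _ _)).trans h1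
    refine (integral_mono_of_nonneg (ae_of_all _ fun x => mul_nonneg (hχ0 x) (window_nonneg _ _))
      (hi.const_mul _) hle).trans ?_
    rw [integral_const_mul]
    have := mul_le_mul_of_nonneg_left hconc (by positivity : 0 ≤ 3 * Real.exp (-z / 4))
    linarith

end BoundedLaw

namespace BoundedLaw

variable {V : Type*} [Fintype V] [DecidableEq V] {G : SimpleGraph V} [DecidableRel G.Adj]
  {μ : Measure (V → ℝ)} [IsProbabilityMeasure μ] {q θ b : ℝ}

lemma integral_exp_half_le (h : BoundedLaw G μ q θ b) :
    ∫ x, Real.exp (1 / 2 * coordSum Finset.univ x) ∂μ ≤ 10 := by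
  have i1 : Integrable (fun x => Real.exp (coordSum Finset.univ x)) μ := by
    simpa using h.integrable_exp 1 Finset.univ
  have h1 := integral_mono (h.integrable_exp (1 / 2) Finset.univ) ((integrable_const 1).add i1)
    fun x => exp_half_mul_le (coordSum Finset.univ x)
  simp only [Pi.add_apply] at h1
  rw [integral_add (integrable_const _) i1, integral_const, probReal_univ, one_smul] at h1
  linarith [h.integral_exp_le]

/-- A function with the exponential bound of `avgSol_avgDeriv_weighted`, integrated. -/
lemma abs_integral_le_of_weighted (h : BoundedLaw G μ q θ b) {z M : ℝ} {S : Finset V}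
    (hM : ∫ x, Real.exp (1 / 2 * coordSum S x) ∂μ ≤ M) {g : ℝ → ℝ}
    (hg : ∀ w, |g w| ≤ 2 * Real.exp (-z / 4) * (1 + Real.exp (w / 2))) :
    |∫ x, g (coordSum S x) ∂μ| ≤ 2 * Real.exp (-z / 4) * (1 + M) := by
  have i0 := h.integrable_exp (1 / 2) S
  have i1 : Integrable (fun x => 2 * Real.exp (-z / 4) * (1 + Real.exp (1 / 2 * coordSum S x))) μ :=
    ((integrable_const 1).add i0).const_mul _
  have h1 := norm_integral_le_of_norm_le (f := fun x => g (coordSum S x)) i1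
    (ae_of_all _ fun x => by
      have e : 1 / 2 * coordSum S x = coordSum S x / 2 := by ring
      rw [e]
      exact hg (coordSum S x))
  rw [Real.norm_eq_abs, integral_const_mul, integral_add (integrable_const _) i0, integral_const,
    probReal_univ, one_smul] at h1
  refine h1.trans ?_
  gcongr

lemma abs_integral_ramp_sub_avgCDF_le (h : BoundedLaw G μ q θ b) {z : ℝ} (hz : 2 ≤ z) :
    |∫ x, (1 - ramp (48 * b) (coordSum Finset.univ x - z)) ∂μ - avgCDF (48 * b) z|
      ≤ 82000 * Real.exp (-z / 4) * b := by
  have hb := h.b_pos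
  have hα : 0 < 48 * b := by linarith
  have hE := Real.exp_pos (-z / 4)
  have h1 := h.stein_expansion (z := z) hα (K := 10100 * Real.exp (-z / 4)) (by positivity)
    fun i => h.smoothAt_avgDeriv hz i
  have h2 := mul_le_mul_of_nonneg_left h.four_mul_card_moment_le
    (by positivity : 0 ≤ 2 * (10100 * Real.exp (-z / 4)))
  have h3 : |∫ x, avgDeriv (48 * b) z (coordSum Finset.univ x) ∂μ|
      ≤ 2 * Real.exp (-z / 4) * (1 + 10) :=
    h.abs_integral_le_of_weighted h.integral_exp_half_le fun w =>
      (avgSol_avgDeriv_weighted hα hz w).2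
  have h4 : |(1 - ∑ i, ∫ x, x i * localSum G i x ∂μ)
      * ∫ x, avgDeriv (48 * b) z (coordSum Finset.univ x) ∂μ|
      ≤ 8 * b * (2 * Real.exp (-z / 4) * (1 + 10)) := by
    rw [abs_mul, abs_sub_comm]
    exact mul_le_mul h.cov_sum h3 (abs_nonneg _) (by linarith)
  have h5 : ∀ i, |∫ x, avgSol (48 * b) z (coordSum Finset.univ x - localSum G i x) ∂μ|
      ≤ 2 * Real.exp (-z / 4) * (1 + 30) := fun i => by
    have e : ∀ x : V → ℝ, coordSum Finset.univ x - localSum G i x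
        = coordSum (Finset.univ \ nbhdBall G 1 i) x := fun x =>
      (coordSum_sdiff (Finset.subset_univ _) x).symm
    simp_rw [e]
    refine h.abs_integral_le_of_weighted ?_ fun w => (avgSol_avgDeriv_weighted hα hz w).1
    have h6 := h.integral_exp_compl_le (t := 1 / 2) (by rw [abs_le]; norm_num) (i := i)
      (nbhdBall_mono (by norm_num : 1 ≤ 4) i)
    linarith [h.integral_exp_half_le]
  have h6 : |∑ i, (∫ x, x i ∂μ)
      * ∫ x, avgSol (48 * b) z (coordSum Finset.univ x - localSum G i x) ∂μ|
      ≤ 4 * b * (2 * Real.exp (-z / 4) * (1 + 30)) := by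
    refine (Finset.abs_sum_le_sum_abs _ _).trans ?_
    refine le_trans ?_ (mul_le_mul_of_nonneg_right h.sum_mean (by positivity))
    rw [Finset.sum_mul]
    refine Finset.sum_le_sum fun i _ => ?_
    rw [abs_mul]
    exact mul_le_mul_of_nonneg_left (h5 i) (abs_nonneg _)
  have h7 := abs_le.1 h1
  have h8 := abs_le.1 h4
  have h9 := abs_le.1 h6
  have h10 : 0 ≤ Real.exp (-z / 4) * b := by positivity
  rw [abs_le]
  constructor <;> linarith [h7.1, h7.2, h8.1, h8.2, h9.1, h9.2]

/-- The normal approximation of bounded local sums, with an error decreasing exponentially. -/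
theorem tail_bound (h : BoundedLaw G μ q θ b) {z : ℝ} (hz : 4 ≤ z) :
    |μ.real {x | coordSum Finset.univ x ≤ z} - stdNormalCDF z| ≤ 250000 * Real.exp (-z / 4) * b ∧
    |μ.real {x | coordSum Finset.univ x < z} - stdNormalCDF z|
      ≤ 250000 * Real.exp (-z / 4) * b := by
  have hb := h.b_pos
  have hb1 := h.b_le
  have hα : 0 < 48 * b := by linarith
  have hE := Real.exp_pos (-z / 4)
  have hφ : ∀ t, z - 1 ≤ t → normalDensity t ≤ Real.exp (-z / 4) := fun t ht => by
    refine (normalDensity_le_exp t).trans ?_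
    have h1 : Real.exp (-t ^ 2 / 2) ≤ Real.exp (-z / 4) := Real.exp_le_exp.2 (by nlinarith)
    linarith [Real.exp_pos (-t ^ 2 / 2)]
  have hΦ : ∀ y, z - 1 ≤ y →
      stdNormalCDF (y + 48 * b) - stdNormalCDF y ≤ Real.exp (-z / 4) * (48 * b) := by
    intro y hy
    have := stdNormalCDF_sub_le (by linarith : y ≤ y + 48 * b)
      fun t ht => hφ t (hy.trans ht.1)
    linarith
  have hE3 : Real.exp (-(z - 48 * b) / 4) ≤ 3 * Real.exp (-z / 4) := by
    have e : -(z - 48 * b) / 4 = 12 * b + -z / 4 := by ring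
    rw [e, Real.exp_add]
    exact mul_le_mul_of_nonneg_right (exp_le_three (by linarith)) hE.le
  have hWm : Measurable (coordSum (Finset.univ : Finset V)) := measurable_coordSum _
  have hup := measureReal_le_integral_ramp (μ := μ) hWm hα z
  have hlow := integral_ramp_le_measureReal (μ := μ) hWm hα z
  have hmono : μ.real {x | coordSum Finset.univ x < z} ≤ μ.real {x | coordSum Finset.univ x ≤ z} :=
    measureReal_mono fun x (hx : _ < z) => hx.le
  have h1 := abs_le.1 (h.abs_integral_ramp_sub_avgCDF_le (z := z) (by linarith))
  have h2 := abs_le.1 (h.abs_integral_ramp_sub_avgCDF_le (z := z - 48 * b) (by linarith))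
  have h3 := avgCDF_mem hα z
  have h4 := avgCDF_mem hα (z - 48 * b)
  have h5 := hΦ z (by linarith)
  have h6 := hΦ (z - 48 * b) (by linarith)
  rw [sub_add_cancel] at h6 h4
  have h7 := mul_le_mul_of_nonneg_right hE3 hb.le
  have h8 : 0 ≤ Real.exp (-z / 4) * b := by positivity
  have hlo : -(250000 * Real.exp (-z / 4) * b)
      ≤ μ.real {x | coordSum Finset.univ x < z} - stdNormalCDF z := by
    linarith [h2.1, h4.1]
  have hhi : μ.real {x | coordSum Finset.univ x ≤ z} - stdNormalCDF z
      ≤ 250000 * Real.exp (-z / 4) * b := by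
    linarith [h1.2, h3.2]
  rw [abs_le, abs_le]
  exact ⟨⟨by linarith, hhi⟩, hlo, by linarith⟩

end BoundedLaw

/-! ### Truncation -/

/-- Truncation at the level `1 / (2 * L)`: larger values are replaced by zero. -/
noncomputable def truncate (L t : ℝ) : ℝ := if 2 * L * |t| ≤ 1 then t else 0

lemma measurable_truncate (L : ℝ) : Measurable (truncate L) :=
  Measurable.ite (measurableSet_le (by fun_prop) measurable_const) measurable_id measurable_const

lemma abs_truncate_le (L t : ℝ) : |truncate L t| ≤ |t| := by
  unfold truncate; split_ifs <;> simp

lemma mul_abs_truncate_le (L t : ℝ) : 2 * L * |truncate L t| ≤ 1 := by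
  unfold truncate; split_ifs with h
  · exact h
  · simp

lemma one_le_of_truncated {L t a : ℝ} (hL : 1 ≤ L) (ht : ¬ 2 * L * |t| ≤ 1) (ha : 0 ≤ a) :
    1 ≤ 2 ^ a * L ^ a * |t| ^ a := by
  have h1 := Real.one_le_rpow (not_le.1 ht).le ha
  rwa [Real.mul_rpow (by positivity) (abs_nonneg _), Real.mul_rpow (by norm_num) (by positivity)]
    at h1

lemma abs_truncate_sub_le {L q : ℝ} (hL : 1 ≤ L) (hq : 0 < q) (hq1 : q ≤ 1) (t : ℝ) :
    |truncate L t - t| ≤ 4 * L ^ (2 + q) * |t| ^ (2 + q) := by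
  unfold truncate
  split_ifs with h
  · rw [sub_self, abs_zero]; positivity
  · rw [zero_sub, abs_neg]
    have h1 := one_le_of_truncated hL h (by linarith : 0 ≤ 1 + q)
    have h2 : (2 : ℝ) ^ (1 + q) ≤ 4 := by
      have := Real.rpow_le_rpow_of_exponent_le one_le_two (by linarith : 1 + q ≤ (2 : ℝ))
      rw [Real.rpow_two] at this
      linarith
    have h3 : L ^ (1 + q) ≤ L ^ (2 + q) := Real.rpow_le_rpow_of_exponent_le hL (by linarith)
    have e : |t| ^ (2 + q) = |t| ^ (1 + q) * |t| := by
      rw [← Real.rpow_add_one' (abs_nonneg _) (by linarith)]; ring_nf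
    calc |t| = 1 * |t| := (one_mul _).symm
      _ ≤ 2 ^ (1 + q) * L ^ (1 + q) * |t| ^ (1 + q) * |t| := by gcongr
      _ ≤ 4 * L ^ (2 + q) * |t| ^ (1 + q) * |t| := by gcongr
      _ = 4 * L ^ (2 + q) * |t| ^ (2 + q) := by rw [e]; ring

lemma abs_truncate_mul_sub_le {L q : ℝ} (hL : 1 ≤ L) (hq : 0 < q) (hq1 : q ≤ 1) (s t : ℝ) :
    |truncate L s * truncate L t - s * t|
      ≤ 2 * L ^ q * (|s| ^ (1 + q) * |t| + |s| * |t| ^ (1 + q)) := by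
  have h2 : (2 : ℝ) ^ q ≤ 2 := by
    simpa using Real.rpow_le_rpow_of_exponent_le one_le_two hq1
  have e : ∀ u : ℝ, |u| ^ (1 + q) = |u| ^ q * |u| := fun u => by
    rw [← Real.rpow_add_one' (abs_nonneg _) (by linarith)]; ring_nf
  have key : ∀ u : ℝ, ¬ 2 * L * |u| ≤ 1 → 1 ≤ 2 * L ^ q * |u| ^ q := fun u hu => by
    refine (one_le_of_truncated hL hu hq.le).trans ?_
    gcongr
  rw [e, e]
  unfold truncate
  by_cases hs : 2 * L * |s| ≤ 1
  · by_cases ht : 2 * L * |t| ≤ 1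
    · rw [if_pos hs, if_pos ht, sub_self, abs_zero]; positivity
    · rw [if_neg ht, mul_zero, zero_sub, abs_neg, abs_mul]
      have h1 := mul_le_mul_of_nonneg_right (key t ht) (by positivity : 0 ≤ |s| * |t|)
      have h3 : 0 ≤ 2 * L ^ q * (|s| ^ q * |s| * |t|) := by positivity
      linarith
  · rw [if_neg hs, zero_mul, zero_sub, abs_neg, abs_mul]
    have h1 := mul_le_mul_of_nonneg_right (key s hs) (by positivity : 0 ≤ |s| * |t|)
    have h3 : 0 ≤ 2 * L ^ q * (|s| * (|t| ^ q * |t|)) := by positivity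
    linarith

/-- The error rate `D ^ (5 p) |V| θ ^ p` of the nonuniform bound, with `p = 2 + q` and `D` the
maximal degree. -/
noncomputable def tailRate {V : Type*} [Fintype V] (G : SimpleGraph V) [DecidableRel G.Adj]
    (q θ : ℝ) : ℝ :=
  Fintype.card V * ((G.maxDegree : ℝ) ^ 5 * θ) ^ (2 + q)

namespace LocalLaw

variable {V : Type*} [Fintype V] [DecidableEq V] {G : SimpleGraph V} [DecidableRel G.Adj]
  {μ : Measure (V → ℝ)} [IsProbabilityMeasure μ] {q θ : ℝ}

lemma one_le_card (h : LocalLaw G μ q θ) : (1 : ℝ) ≤ Fintype.card V := by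
  exact_mod_cast (two_le_card_of_maxDegree h.one_le_maxDegree).trans' one_le_two

lemma tailRate_eq (h : LocalLaw G μ q θ) : tailRate G q θ
    = Fintype.card V * (((G.maxDegree : ℝ) ^ 5) ^ (2 + q) * θ ^ (2 + q)) := by
  rw [tailRate, Real.mul_rpow (by positivity) h.theta_pos.le]

lemma tailRate_pos (h : LocalLaw G μ q θ) : 0 < tailRate G q θ := by
  have h1 := h.one_le_card
  have h2 := h.one_le_maxDegree_real
  have h3 := h.theta_pos
  unfold tailRate
  positivity

/-- A power of the degree with exponent at most five is dominated in `tailRate`. -/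
lemma pow_mul_card_mul_le_tailRate (h : LocalLaw G μ q θ) {k : ℕ} (hk : k ≤ 5) :
    (G.maxDegree : ℝ) ^ k * (Fintype.card V * θ ^ (2 + q)) ≤ tailRate G q θ := by
  have h1 := pow_le_pow_right₀ h.one_le_maxDegree_real hk
  have h2 := Real.self_le_rpow_of_one_le (one_le_pow₀ (n := 5) h.one_le_maxDegree_real)
    (by linarith [h.q_pos] : 1 ≤ 2 + q)
  have h3 := Real.rpow_pos_of_pos h.theta_pos (2 + q)
  have h4 := mul_le_mul_of_nonneg_right (h1.trans h2)
    (by positivity : 0 ≤ Fintype.card V * θ ^ (2 + q))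
  rw [h.tailRate_eq]
  linarith

lemma pow_five_mul_theta_le (h : LocalLaw G μ q θ) (hB : tailRate G q θ ≤ 1 / 1000000) :
    (G.maxDegree : ℝ) ^ 5 * θ ≤ 1 / 100 := by
  by_contra hlt
  push Not at hlt
  have hq := h.q_pos
  have h1 := Real.rpow_lt_rpow (by norm_num) hlt (by linarith : 0 < 2 + q)
  have h2 := Real.rpow_le_rpow_of_exponent_ge (by norm_num : (0 : ℝ) < 1 / 100) (by norm_num)
    (by push_cast; linarith [h.q_le_one] : 2 + q ≤ (3 : ℕ))
  rw [Real.rpow_natCast] at h2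
  have h3 : ((G.maxDegree : ℝ) ^ 5 * θ) ^ (2 + q) ≤ tailRate G q θ :=
    le_mul_of_one_le_left (by have := h.theta_pos; positivity) h.one_le_card
  norm_num at h2
  linarith

lemma pow_five_mul_theta_sq_le (h : LocalLaw G μ q θ) (hB : tailRate G q θ ≤ 1 / 1000000) :
    (G.maxDegree : ℝ) ^ 5 * θ ^ 2 ≤ 1 / 10000 := by
  have h1 := h.pow_five_mul_theta_le hB
  have h2 := one_le_pow₀ (n := 5) h.one_le_maxDegree_real
  have h3 := h.theta_pos
  have h4 : (G.maxDegree : ℝ) ^ 5 * θ ^ 2 ≤ ((G.maxDegree : ℝ) ^ 5 * θ) ^ 2 := by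
    rw [mul_pow]
    exact mul_le_mul_of_nonneg_right (by nlinarith) (by positivity)
  have h5 := pow_le_pow_left₀ (by positivity) h1 2
  norm_num at h5
  linarith

lemma abs_integral_truncate_le (h : LocalLaw G μ q θ) (hmean : ∀ i, ∫ x, x i ∂μ = 0) {L : ℝ}
    (hL : 1 ≤ L) (i : V) :
    |∫ x, truncate L (x i) ∂μ| ≤ 4 * (L ^ (2 + q) * θ ^ (2 + q)) := by
  have hm : Measurable fun x : V → ℝ => truncate L (x i) :=
    (measurable_truncate L).comp (measurable_pi_apply i)
  have i1 : Integrable (fun x => truncate L (x i)) μ :=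
    (h.integrable_coord i).mono hm.aestronglyMeasurable (ae_of_all _ fun x => abs_truncate_le _ _)
  have e : ∫ x, truncate L (x i) ∂μ = ∫ x, (truncate L (x i) - x i) ∂μ := by
    rw [integral_sub i1 (h.integrable_coord i), hmean, sub_zero]
  rw [e]
  have h1 := norm_integral_le_of_norm_le (f := fun x => truncate L (x i) - x i)
    ((h.integrable_moment i).const_mul (4 * L ^ (2 + q)))
    (ae_of_all _ fun x => abs_truncate_sub_le hL h.q_pos h.q_le_one (x i))
  rw [integral_const_mul] at h1
  refine h1.trans ?_
  rw [← mul_assoc]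
  exact mul_le_mul_of_nonneg_left (h.moment_le i) (by positivity)

lemma abs_integral_truncate_mul_sub_le (h : LocalLaw G μ q θ) {L : ℝ} (hL : 1 ≤ L) (i k : V) :
    Integrable (fun x => truncate L (x i) * truncate L (x k)) μ ∧
    |∫ x, truncate L (x i) * truncate L (x k) ∂μ - ∫ x, x i * x k ∂μ|
      ≤ 4 * (L ^ q * θ ^ (2 + q)) := by
  have hm : ∀ i, Measurable fun x : V → ℝ => truncate L (x i) := fun i =>
    (measurable_truncate L).comp (measurable_pi_apply i)
  have i0 := h.integrable_coord_mul_coord i k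
  have i1 : Integrable (fun x => truncate L (x i) * truncate L (x k)) μ :=
    i0.mono ((hm i).mul (hm k)).aestronglyMeasurable (ae_of_all _ fun x => by
      rw [norm_mul, norm_mul]
      exact mul_le_mul (abs_truncate_le _ _) (abs_truncate_le _ _) (abs_nonneg _) (abs_nonneg _))
  refine ⟨i1, ?_⟩
  have hq := h.q_pos
  obtain ⟨j1, b1⟩ := h.moment_mul (a := 1 + q) (b := 1) (c := 0) (by linarith) zero_le_one le_rfl
    (by linarith) i k k
  obtain ⟨j2, b2⟩ := h.moment_mul (a := 1) (b := 1 + q) (c := 0) zero_le_one (by linarith) le_rfl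
    (by linarith) i k k
  have e1 : 1 + q + 1 + 0 = 2 + q := by ring
  have e2 : 1 + (1 + q) + 0 = 2 + q := by ring
  rw [e1] at b1
  rw [e2] at b2
  simp only [Real.rpow_one, Real.rpow_zero, mul_one] at j1 b1 j2 b2
  rw [← integral_sub i1 i0]
  have h1 := norm_integral_le_of_norm_le
    (f := fun x => truncate L (x i) * truncate L (x k) - x i * x k)
    ((j1.add j2).const_mul (2 * L ^ q))
    (ae_of_all _ fun x => abs_truncate_mul_sub_le hL hq h.q_le_one (x i) (x k))
  rw [integral_const_mul] at h1
  simp only [Pi.add_apply] at h1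
  rw [integral_add j1 j2] at h1
  refine h1.trans ?_
  have h2 := mul_le_mul_of_nonneg_left (add_le_add b1 b2) (by positivity : 0 ≤ 2 * L ^ q)
  linarith

/-- The truncated summands form a bounded law: by the moment condition, truncation changes the means
and the local covariances by multiples of `tailRate` only. -/
theorem boundedLaw_truncate (h : LocalLaw G μ q θ) (hmean : ∀ i, ∫ x, x i ∂μ = 0)
    (hvar : ∫ x, coordSum Finset.univ x ^ 2 ∂μ = 1) (hB : tailRate G q θ ≤ 1 / 1000000) :
    BoundedLaw G (_root_.mapLaw μ (truncate ((G.maxDegree : ℝ) ^ 5))) q θ (tailRate G q θ) where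
  toLocalLaw := h.mapLaw (measurable_truncate _) (abs_truncate_le _)
  bdd i := by
    refine (ae_map_iff (measurable_coordMap (measurable_truncate _)).aemeasurable
      (measurableSet_le (by fun_prop) measurable_const)).2 (ae_of_all _ fun x => ?_)
    exact mul_abs_truncate_le _ _
  card_moment := h.pow_mul_card_mul_le_tailRate le_rfl
  sum_mean := by
    have hL := one_le_pow₀ (n := 5) h.one_le_maxDegree_real
    have hθ := Real.rpow_pos_of_pos h.theta_pos (2 + q)
    refine (sum_le_card_mul Finset.univ (c := 4 * (((G.maxDegree : ℝ) ^ 5) ^ (2 + q)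
      * θ ^ (2 + q))) (by positivity) fun i => ?_).trans_eq ?_
    · rw [integral_mapLaw (measurable_truncate _) (measurable_pi_apply i)]
      exact h.abs_integral_truncate_le hmean hL i
    · rw [h.tailRate_eq]; ring
  cov_sum := by
    set L := (G.maxDegree : ℝ) ^ 5 with hLdef
    have hD := h.one_le_maxDegree_real
    have hL : 1 ≤ L := one_le_pow₀ hD
    have hθ := Real.rpow_pos_of_pos h.theta_pos (2 + q)
    have hs : ∑ j, ∫ x, x j * localSum G j x ∂μ = 1 := by
      rw [← hvar, h.integral_coordSum_sq_eq]
      exact Finset.sum_congr rfl fun j _ => h.integral_coord_mul_localSum hmean j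
    rw [← hs, ← Finset.sum_sub_distrib]
    refine (Finset.abs_sum_le_sum_abs _ _).trans ?_
    have hone : ∀ i, |∫ x, x i * localSum G i x ∂(_root_.mapLaw μ (truncate L))
        - ∫ x, x i * localSum G i x ∂μ| ≤ 2 * G.maxDegree * (4 * (L ^ q * θ ^ (2 + q))) := by
      intro i
      rw [integral_mapLaw (measurable_truncate _) (by fun_prop)]
      simp only [localSum, coordSum, Finset.mul_sum]
      rw [integral_finsetSum _ fun k _ => (h.abs_integral_truncate_mul_sub_le hL i k).1,
        integral_finsetSum _ fun k _ => h.integrable_coord_mul_coord i k,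
        ← Finset.sum_sub_distrib]
      refine (Finset.abs_sum_le_sum_abs _ _).trans ((Finset.sum_le_card_nsmul _ _ _ fun k _ =>
        (h.abs_integral_truncate_mul_sub_le hL i k).2).trans ?_)
      rw [nsmul_eq_mul]
      exact mul_le_mul_of_nonneg_right (h.card_ball_one_le i) (by positivity)
    refine (sum_le_card_mul Finset.univ (by positivity) hone).trans ?_
    have h1 : (G.maxDegree : ℝ) * L ^ q ≤ L ^ (2 + q) := by
      have h2 : (G.maxDegree : ℝ) ≤ L := le_self_pow₀ hD (by norm_num)
      rw [Real.rpow_add (by linarith), Real.rpow_two]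
      refine mul_le_mul_of_nonneg_right ?_ (by positivity)
      nlinarith
    have h3 := mul_le_mul_of_nonneg_left h1
      (by positivity : 0 ≤ 8 * (Fintype.card V * θ ^ (2 + q)))
    rw [h.tailRate_eq]
    linarith
  b_pos := h.tailRate_pos
  b_le := hB
  theta_le := h.pow_five_mul_theta_sq_le hB

end LocalLaw

/-! ### Removing the truncation -/

lemma two_rpow_le_eight {q : ℝ} (hq : q ≤ 1) : (2 : ℝ) ^ (2 + q) ≤ 8 := by
  have := Real.rpow_le_rpow_of_exponent_le one_le_two
    (by push_cast; linarith : 2 + q ≤ (3 : ℕ))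
  rw [Real.rpow_natCast] at this
  linarith

lemma abs_sub_rpow_le {q : ℝ} (hq : 0 < q) (hq1 : q ≤ 1) (a b : ℝ) :
    |a - b| ^ (2 + q) ≤ 8 * (|a| ^ (2 + q) + |b| ^ (2 + q)) := by
  have h8 := two_rpow_le_eight hq1
  have ha : 0 ≤ |a| ^ (2 + q) := by positivity
  have hb : 0 ≤ |b| ^ (2 + q) := by positivity
  have key : ∀ m, 0 ≤ m → |a - b| ≤ 2 * m → |a - b| ^ (2 + q) ≤ 8 * m ^ (2 + q) := by
    intro m hm h
    refine (Real.rpow_le_rpow (abs_nonneg _) h (by linarith)).trans ?_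
    rw [Real.mul_rpow zero_le_two hm]
    exact mul_le_mul_of_nonneg_right h8 (by positivity)
  have hab := abs_sub a b
  rcases le_total |a| |b| with h | h
  · exact (key |b| (abs_nonneg _) (by linarith)).trans (by linarith)
  · exact (key |a| (abs_nonneg _) (by linarith)).trans (by linarith)

/-- Markov's inequality for an absolute moment. -/
lemma measureReal_ge_le_rpow {Ω : Type*} [MeasurableSpace Ω] {μ : Measure Ω} [IsFiniteMeasure μ]
    {f : Ω → ℝ} {p M z : ℝ} (hp : 0 ≤ p) (hz : 0 < z) (hf : Integrable (fun x => |f x| ^ p) μ)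
    (hM : ∫ x, |f x| ^ p ∂μ ≤ M) : μ.real {x | z ≤ f x} ≤ z ^ (-p) * M := by
  have h1 := mul_meas_ge_le_integral_of_nonneg (ae_of_all _ fun x => by positivity) hf (z ^ p)
  have hzp := Real.rpow_pos_of_pos hz p
  have h2 : μ.real {x | z ≤ f x} ≤ μ.real {x | z ^ p ≤ |f x| ^ p} :=
    measureReal_mono fun x (hx : z ≤ f x) =>
      Real.rpow_le_rpow hz.le (hx.trans (le_abs_self _)) hp
  rw [Real.rpow_neg hz.le, ← div_eq_inv_mul, le_div_iff₀ hzp]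
  have h3 := mul_le_mul_of_nonneg_right h2 hzp.le
  linarith

lemma exp_neg_le_rpow {p z : ℝ} (hp : p ≤ 3) (hz : 1 ≤ z) : Real.exp (-z) ≤ 6 * z ^ (-p) := by
  have h1 := Real.pow_div_factorial_le_exp z (by linarith) 3
  have h2 : (z ^ 3)⁻¹ ≤ z ^ (-p) := by
    rw [← Real.rpow_natCast, ← Real.rpow_neg (by linarith)]
    exact Real.rpow_le_rpow_of_exponent_le hz (by push_cast; linarith)
  have h3 : Real.exp (-z) ≤ 6 * (z ^ 3)⁻¹ := by
    rw [Real.exp_neg, ← div_eq_mul_inv, inv_le_comm₀ (Real.exp_pos _) (by positivity), inv_div]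
    simpa [Nat.factorial] using h1
  linarith

namespace LocalLaw

variable {V : Type*} [Fintype V] [DecidableEq V] {G : SimpleGraph V} [DecidableRel G.Adj]
  {μ : Measure (V → ℝ)} [IsProbabilityMeasure μ] {q θ : ℝ}

lemma moment_coordSum_of_card (h : LocalLaw G μ q θ) (S : Finset V) :
    Integrable (fun x => |coordSum S x| ^ (2 + q)) μ ∧
    ∫ x, |coordSum S x| ^ (2 + q) ∂μ ≤ (S.card : ℝ) ^ (2 + q) * θ ^ (2 + q) := by
  have hq := h.q_pos
  have hle : ∀ x : V → ℝ, |coordSum S x| ^ (2 + q)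
      ≤ (S.card : ℝ) ^ (2 + q - 1) * ∑ k ∈ S, |x k| ^ (2 + q) := fun x =>
    (Real.rpow_le_rpow (abs_nonneg _) (abs_coordSum_le S x) (by linarith)).trans
      (Real.rpow_sum_le_const_mul_sum_rpow S x (by linarith))
  have hi : Integrable (fun x => (S.card : ℝ) ^ (2 + q - 1) * ∑ k ∈ S, |x k| ^ (2 + q)) μ :=
    (integrable_finsetSum _ fun k _ => h.integrable_moment k).const_mul _
  have h1 : Integrable (fun x => |coordSum S x| ^ (2 + q)) μ :=
    hi.mono' (((measurable_coordSum S).abs.pow_const _).aestronglyMeasurable)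
      (ae_of_all _ fun x => by
        rw [Real.norm_of_nonneg (by positivity)]
        exact hle x)
  refine ⟨h1, (integral_mono h1 hi hle).trans ?_⟩
  rw [integral_const_mul, integral_finsetSum _ fun k _ => h.integrable_moment k]
  have h2 : ∑ k ∈ S, ∫ x, |x k| ^ (2 + q) ∂μ ≤ S.card * θ ^ (2 + q) := by
    rw [← nsmul_eq_mul]
    exact Finset.sum_le_card_nsmul _ _ _ fun k _ => h.moment_le k
  refine (mul_le_mul_of_nonneg_left h2 (by positivity)).trans_eq ?_
  rw [← mul_assoc, ← Real.rpow_add_one' (by positivity) (by linarith), sub_add_cancel]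

/-- The summand in `tailRate` that belongs to one vertex. -/
lemma rpow_mul_rpow_le_tailRate (h : LocalLaw G μ q θ) :
    ((G.maxDegree : ℝ) ^ 5) ^ (2 + q) * θ ^ (2 + q) ≤ tailRate G q θ := by
  have := h.theta_pos
  rw [h.tailRate_eq]
  exact le_mul_of_one_le_left (by positivity) h.one_le_card

lemma moment_localSum_rpow (h : LocalLaw G μ q θ) (i : V) :
    Integrable (fun x => |localSum G i x| ^ (2 + q)) μ ∧
    ∫ x, |localSum G i x| ^ (2 + q) ∂μ
      ≤ 8 * (((G.maxDegree : ℝ) ^ 5) ^ (2 + q) * θ ^ (2 + q)) := by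
  obtain ⟨h1, h2⟩ := h.moment_coordSum_of_card (nbhdBall G 1 i)
  have hq := h.q_pos
  have hθ := Real.rpow_pos_of_pos h.theta_pos (2 + q)
  have hD := h.one_le_maxDegree_real
  refine ⟨h1, h2.trans ?_⟩
  have h3 : ((nbhdBall G 1 i).card : ℝ) ≤ 2 * (G.maxDegree : ℝ) ^ 5 :=
    (h.card_ball_one_le i).trans (by linarith [le_self_pow₀ hD (by norm_num : 5 ≠ 0)])
  have h4 := Real.rpow_le_rpow (Nat.cast_nonneg _) h3 (by linarith : 0 ≤ 2 + q)
  rw [Real.mul_rpow zero_le_two (by positivity)] at h4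
  have h5 := mul_le_mul_of_nonneg_right (two_rpow_le_eight h.q_le_one)
    (by positivity : 0 ≤ ((G.maxDegree : ℝ) ^ 5) ^ (2 + q))
  rw [← mul_assoc]
  exact mul_le_mul_of_nonneg_right (h4.trans h5) hθ.le

lemma measureReal_truncated_le (h : LocalLaw G μ q θ) {L : ℝ} (hL : 1 ≤ L) (i : V) :
    μ.real {x | ¬ 2 * L * |x i| ≤ 1} ≤ 8 * (L ^ (2 + q) * θ ^ (2 + q)) := by
  have hq := h.q_pos
  have h1 := mul_meas_ge_le_integral_of_nonneg (μ := μ)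
    (f := fun x => 8 * L ^ (2 + q) * |x i| ^ (2 + q)) (ae_of_all _ fun x => by positivity)
    ((h.integrable_moment i).const_mul _) 1
  rw [one_mul, integral_const_mul] at h1
  have h2 : μ.real {x | ¬ 2 * L * |x i| ≤ 1}
      ≤ μ.real {x | 1 ≤ 8 * L ^ (2 + q) * |x i| ^ (2 + q)} :=
    measureReal_mono fun x hx => by
      refine (one_le_of_truncated hL hx (by linarith : 0 ≤ 2 + q)).trans ?_
      gcongr
      exact two_rpow_le_eight h.q_le_one
  have h3 := mul_le_mul_of_nonneg_left (h.moment_le i) (by positivity : 0 ≤ 8 * L ^ (2 + q))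
  linarith

/-- The event that the coordinate `i` is truncated is independent of the distant coordinates. -/
lemma measureReal_truncated_inter (h : LocalLaw G μ q θ) (L : ℝ) (i : V) {φ : ℝ → ℝ}
    (hφ : Measurable φ) (t : ℝ) :
    μ.real ({x | ¬ 2 * L * |x i| ≤ 1}
      ∩ {x | t ≤ coordSum (Finset.univ \ nbhdBall G 1 i) fun k => φ (x k)})
    = μ.real {x | ¬ 2 * L * |x i| ≤ 1}
      * μ.real {x | t ≤ coordSum (Finset.univ \ nbhdBall G 1 i) fun k => φ (x k)} := by
  have hind := h.dep.indepFun (S := {i}) (T := Finset.univ \ nbhdBall G 1 i)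
    (f := fun x => x i)
    (g := fun x => coordSum (Finset.univ \ nbhdBall G 1 i) fun k => φ (x k))
    Finset.disjoint_sdiff (measurable_pi_apply i)
    ((measurable_coordSum _).comp (measurable_coordMap hφ))
    (fun x y hxy => hxy i (by simp))
    (fun x y hxy => Finset.sum_congr rfl fun k hk => congrArg φ (hxy k hk))
  have := hind.measure_inter_preimage_eq_mul {s | ¬ 2 * L * |s| ≤ 1} (Ici t)
    (measurableSet_le (measurable_const.mul measurable_norm) measurable_const).compl
    measurableSet_Ici
  have h2 := congrArg ENNReal.toReal this
  rwa [ENNReal.toReal_mul] at h2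

/-- The sum can be large on the event that the coordinate `i` is truncated only through the
neighbours of `i` or, independently of that event, through the remaining coordinates. -/
lemma measureReal_truncated_inter_ge (h : LocalLaw G μ q θ) (hmean : ∀ i, ∫ x, x i ∂μ = 0)
    (hvar : ∫ x, coordSum Finset.univ x ^ 2 ∂μ = 1) (hB : tailRate G q θ ≤ 1 / 1000000) {z : ℝ}
    (hz : 0 < z) (i : V) :
    μ.real ({x | ¬ 2 * (G.maxDegree : ℝ) ^ 5 * |x i| ≤ 1} ∩ {x | z ≤ coordSum Finset.univ x})
      ≤ 3200 * z ^ (-(2 + q)) * (((G.maxDegree : ℝ) ^ 5) ^ (2 + q) * θ ^ (2 + q)) := by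
  set L := (G.maxDegree : ℝ) ^ 5 with hLdef
  have hL : 1 ≤ L := one_le_pow₀ h.one_le_maxDegree_real
  have hq := h.q_pos
  have hθ := Real.rpow_pos_of_pos h.theta_pos (2 + q)
  set r := L ^ (2 + q) * θ ^ (2 + q) with hr
  have hr0 : 0 ≤ r := by positivity
  have hrB : r ≤ tailRate G q θ := h.rpow_mul_rpow_le_tailRate
  obtain ⟨iW, bW⟩ := h.moment_coordSum_le hmean hvar
  obtain ⟨iY, bY⟩ := h.moment_localSum_rpow i
  obtain ⟨iR, -⟩ := h.moment_coordSum_of_card (Finset.univ \ nbhdBall G 1 i)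
  have hz2 : (z / 2) ^ (-(2 + q)) ≤ 8 * z ^ (-(2 + q)) := by
    rw [Real.div_rpow hz.le zero_le_two, Real.rpow_neg zero_le_two, div_inv_eq_mul, mul_comm]
    exact mul_le_mul_of_nonneg_right (two_rpow_le_eight h.q_le_one) (by positivity)
  have hzp : 0 ≤ z ^ (-(2 + q)) := by positivity
  have bR : ∫ x, |coordSum (Finset.univ \ nbhdBall G 1 i) x| ^ (2 + q) ∂μ ≤ 48 := by
    have h1 := integral_mono iR ((iW.add iY).const_mul 8) fun x => by
      rw [coordSum_univ_sub_localSum]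
      exact abs_sub_rpow_le hq h.q_le_one _ _
    rw [integral_const_mul] at h1
    simp only [Pi.add_apply] at h1
    rw [integral_add iW iY] at h1
    have h2 := h.pow_mul_card_mul_le_tailRate (k := 4) (by norm_num)
    linarith
  have p1 := measureReal_ge_le_rpow (by linarith) (half_pos hz) iR bR
  have p2 := measureReal_ge_le_rpow (by linarith) (half_pos hz) iY bY
  have p3 := h.measureReal_truncated_inter L i (φ := fun t => t) measurable_id (z / 2)
  have p4 := h.measureReal_truncated_le hL i
  have hsub : ({x : V → ℝ | ¬ 2 * L * |x i| ≤ 1} ∩ {x | z ≤ coordSum Finset.univ x})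
      ⊆ ({x | ¬ 2 * L * |x i| ≤ 1}
        ∩ {x | z / 2 ≤ coordSum (Finset.univ \ nbhdBall G 1 i) fun k => x k})
        ∪ {x | z / 2 ≤ localSum G i x} := by
    rintro x ⟨hx1, hx2⟩
    have hx2' : z ≤ coordSum Finset.univ x := hx2
    have e := coordSum_univ_sub_localSum (G := G) i x
    by_cases hx3 : z / 2 ≤ localSum G i x
    · exact Or.inr hx3
    · refine Or.inl ⟨hx1, ?_⟩
      change z / 2 ≤ coordSum (Finset.univ \ nbhdBall G 1 i) x
      rw [e]
      linarith
  have h1 := (measureReal_mono hsub (μ := μ)).trans (measureReal_union_le _ _)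
  rw [p3] at h1
  have p5 : μ.real {x | z / 2 ≤ coordSum (Finset.univ \ nbhdBall G 1 i) fun k => x k}
      ≤ 8 * z ^ (-(2 + q)) * 48 := p1.trans (by linarith)
  have p6 := mul_le_mul p4 p5 measureReal_nonneg (by positivity)
  have p7 := mul_le_mul_of_nonneg_right hz2 (by positivity : 0 ≤ 8 * r)
  have p8 : 0 ≤ z ^ (-(2 + q)) * r := by positivity
  linarith

/-- The counterpart of `measureReal_truncated_inter_ge` for the sum of the truncated summands, whose
local sums are bounded and whose exponential moment is controlled. -/
lemma measureReal_truncated_inter_ge_truncate (h : LocalLaw G μ q θ)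
    (hmean : ∀ i, ∫ x, x i ∂μ = 0) (hvar : ∫ x, coordSum Finset.univ x ^ 2 ∂μ = 1)
    (hB : tailRate G q θ ≤ 1 / 1000000) (z : ℝ) (i : V) :
    μ.real ({x | ¬ 2 * (G.maxDegree : ℝ) ^ 5 * |x i| ≤ 1}
      ∩ {x | z ≤ coordSum Finset.univ fun k => truncate ((G.maxDegree : ℝ) ^ 5) (x k)})
      ≤ 648 * Real.exp (-z) * (((G.maxDegree : ℝ) ^ 5) ^ (2 + q) * θ ^ (2 + q)) := by
  have hT := h.boundedLaw_truncate hmean hvar hB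
  set L := (G.maxDegree : ℝ) ^ 5 with hLdef
  have hL : 1 ≤ L := one_le_pow₀ h.one_le_maxDegree_real
  have hθ := Real.rpow_pos_of_pos h.theta_pos (2 + q)
  have htm := measurable_truncate L
  have := isProbabilityMeasure_mapLaw (μ := μ) htm
  set R := Finset.univ \ nbhdBall G 1 i with hR
  have p1 : μ.real {x | z - 1 ≤ coordSum R fun k => truncate L (x k)} ≤ 81 * Real.exp (-z) := by
    have h1 := mul_meas_ge_le_integral_of_nonneg (ae_of_all _ fun x => (Real.exp_pos _).le)
      (hT.integrable_exp 1 R) (Real.exp (z - 1))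
    have h2 := hT.integral_exp_compl_le (t := 1) (by simp) (i := i)
      (nbhdBall_mono (by norm_num : 1 ≤ 4) i)
    simp only [one_mul] at h1 h2
    have h3 := hT.integral_exp_le
    have h4 : {x : V → ℝ | Real.exp (z - 1) ≤ Real.exp (coordSum R x)}
        = {x | z - 1 ≤ coordSum R x} := by
      ext x; exact Real.exp_le_exp
    rw [h4, _root_.mapLaw, map_measureReal_apply (measurable_coordMap htm)
      (measurableSet_le measurable_const (measurable_coordSum R))] at h1
    have h5 : Real.exp (-z) * (Real.exp (z - 1) * Real.exp 1) = 1 := by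
      rw [← Real.exp_add, ← Real.exp_add]; simp
    change Real.exp (z - 1) * μ.real {x | z - 1 ≤ coordSum R fun k => truncate L (x k)} ≤ _ at h1
    set P := μ.real {x | z - 1 ≤ coordSum R fun k => truncate L (x k)}
    have h6 : Real.exp (z - 1) * P ≤ 27 := h1.trans (by
      change ∫ x, Real.exp (coordSum R x) ∂(_root_.mapLaw μ (truncate L)) ≤ 27
      linarith)
    have h7 := mul_le_mul_of_nonneg_left (mul_le_mul h6 (BoundedLaw.exp_le_three (le_refl (1 : ℝ)))
      (Real.exp_pos _).le (by norm_num)) (Real.exp_pos (-z)).le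
    have h8 : Real.exp (-z) * (Real.exp (z - 1) * P * Real.exp 1) = P := by
      linear_combination P * h5
    linarith
  have hsub : ({x : V → ℝ | ¬ 2 * L * |x i| ≤ 1}
      ∩ {x | z ≤ coordSum Finset.univ fun k => truncate L (x k)})
      ⊆ ({x | ¬ 2 * L * |x i| ≤ 1} ∩ {x | z - 1 ≤ coordSum R fun k => truncate L (x k)}) := by
    rintro x ⟨hx1, hx2⟩
    have hx2' : z ≤ coordSum Finset.univ fun k => truncate L (x k) := hx2
    refine ⟨hx1, ?_⟩
    change z - 1 ≤ coordSum R fun k => truncate L (x k)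
    have e := coordSum_univ_sub_localSum (G := G) i fun k => truncate L (x k)
    have hY : localSum G i (fun k => truncate L (x k)) ≤ 1 := by
      have h1 : ∀ k ∈ nbhdBall G 1 i, truncate L (x k) ≤ 1 / (2 * L) := fun k _ => by
        rw [le_div_iff₀ (by positivity), mul_comm]
        exact (mul_le_mul_of_nonneg_left (le_abs_self _) (by positivity)).trans
          (mul_abs_truncate_le L (x k))
      refine (Finset.sum_le_card_nsmul _ _ _ h1).trans ?_
      rw [nsmul_eq_mul, mul_one_div, div_le_one (by positivity)]
      exact (h.card_ball_one_le i).trans (mul_le_mul_of_nonneg_left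
        (le_self_pow₀ h.one_le_maxDegree_real (by norm_num)) zero_le_two)
    rw [hR, e]
    linarith
  refine (measureReal_mono hsub).trans ?_
  rw [h.measureReal_truncated_inter L i htm]
  have p2 := mul_le_mul (h.measureReal_truncated_le hL i) p1 measureReal_nonneg (by positivity)
  linarith

/-- An event on the sum and the same event on the sum of the truncated summands differ only where
some summand is truncated and one of the two sums is large. -/
lemma abs_measureReal_sub_truncate_le (h : LocalLaw G μ q θ) (hmean : ∀ i, ∫ x, x i ∂μ = 0)
    (hvar : ∫ x, coordSum Finset.univ x ^ 2 ∂μ = 1) (hB : tailRate G q θ ≤ 1 / 1000000) {z : ℝ}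
    (hz : 1 ≤ z) {s : Set ℝ} (hs : MeasurableSet s) (hsz : ∀ t, t ∉ s → z ≤ t) :
    |μ.real {x | coordSum Finset.univ x ∈ s}
      - (_root_.mapLaw μ (truncate ((G.maxDegree : ℝ) ^ 5))).real {x | coordSum Finset.univ x ∈ s}|
      ≤ 8000 * z ^ (-(2 + q)) * tailRate G q θ := by
  have hq := h.q_pos
  set L := (G.maxDegree : ℝ) ^ 5 with hLdef
  have htm := measurable_truncate L
  have hWm := measurable_coordSum (V := V) Finset.univ
  set W' : (V → ℝ) → ℝ := fun x => coordSum Finset.univ fun k => truncate L (x k) with hW'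
  have hW'm : Measurable W' := hWm.comp (measurable_coordMap htm)
  have hθ := Real.rpow_pos_of_pos h.theta_pos (2 + q)
  have hmap := map_measureReal_apply (μ := μ) (measurable_coordMap htm) (hWm hs)
  change |μ.real (coordSum Finset.univ ⁻¹' s)
    - (Measure.map (fun x i => truncate L (x i)) μ).real (coordSum Finset.univ ⁻¹' s)| ≤ _
  rw [hmap]
  change |μ.real (coordSum Finset.univ ⁻¹' s) - μ.real (W' ⁻¹' s)| ≤ _
  refine (abs_measureReal_sub_le_measureReal_symmDiff (hWm hs).nullMeasurableSet
    (hW'm hs).nullMeasurableSet).trans ?_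
  have hsub : symmDiff (coordSum (Finset.univ : Finset V) ⁻¹' s) (W' ⁻¹' s)
      ⊆ ⋃ i, (({x : V → ℝ | ¬ 2 * L * |x i| ≤ 1} ∩ {x | z ≤ coordSum Finset.univ x})
        ∪ ({x : V → ℝ | ¬ 2 * L * |x i| ≤ 1} ∩ {x | z ≤ W' x})) := by
    intro x hx
    have hex : ∃ i, ¬ 2 * L * |x i| ≤ 1 := by
      by_contra hall
      push Not at hall
      have e : W' x = coordSum Finset.univ x :=
        Finset.sum_congr rfl fun k _ => if_pos (hall k)
      rcases hx with ⟨h1, h2⟩ | ⟨h1, h2⟩ <;> simp only [mem_preimage, e] at h1 h2 <;>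
        exact h2 h1
    obtain ⟨i, hi⟩ := hex
    rw [mem_iUnion]
    refine ⟨i, ?_⟩
    rcases hx with ⟨-, h2⟩ | ⟨-, h2⟩
    · exact Or.inr ⟨hi, hsz _ h2⟩
    · exact Or.inl ⟨hi, hsz _ h2⟩
  refine (measureReal_mono hsub).trans ((measureReal_iUnion_fintype_le _).trans ?_)
  refine (sum_le_card_mul Finset.univ (c := 8000 * z ^ (-(2 + q)) * (L ^ (2 + q) * θ ^ (2 + q)))
    (by positivity) fun i => ?_).trans_eq ?_
  · refine (measureReal_union_le _ _).trans ?_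
    have h1 := h.measureReal_truncated_inter_ge hmean hvar hB (by linarith : 0 < z) i
    have h2 := h.measureReal_truncated_inter_ge_truncate hmean hvar hB z i
    have h3 := mul_le_mul_of_nonneg_right
      (exp_neg_le_rpow (by linarith [h.q_le_one] : 2 + q ≤ 3) hz)
      (by positivity : 0 ≤ L ^ (2 + q) * θ ^ (2 + q))
    have h4 : 0 ≤ z ^ (-(2 + q)) * (L ^ (2 + q) * θ ^ (2 + q)) := by positivity
    linarith
  · rw [h.tailRate_eq]; ring

end LocalLaw

/-! ### The nonuniform bound -/

lemma stdNormalCDF_neg_le_exp {z : ℝ} (hz : 2 ≤ z) : stdNormalCDF (-z) ≤ Real.exp (-z) := by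
  have h1 := normalDensity_add_mul_cdf_nonneg (-z)
  have h2 := normalDensity_le_exp (-z)
  have h3 : Real.exp (-(-z) ^ 2 / 2) ≤ Real.exp (-z) := Real.exp_le_exp.2 (by nlinarith)
  have h4 := stdNormalCDF_nonneg (-z)
  have h5 := Real.exp_pos (-z)
  nlinarith

lemma abs_sub_le_of_compl {a b c d : ℝ} (ha : 1 - a ≤ c) (ha1 : a ≤ 1) (hb : 1 - b ≤ d)
    (hb1 : b ≤ 1) : |a - b| ≤ c + d := by
  rw [abs_le]
  constructor <;> linarith

namespace LocalLaw

variable {V : Type*} [Fintype V] [DecidableEq V] {G : SimpleGraph V} [DecidableRel G.Adj]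
  {μ : Measure (V → ℝ)} [IsProbabilityMeasure μ] {q θ : ℝ}

/-- When `tailRate` is small, the tail bound follows by truncation. Strict inequalities are included
for the sake of the reflection `W ↦ -W`. -/
lemma tail_bound_of_small (h : LocalLaw G μ q θ) (hmean : ∀ i, ∫ x, x i ∂μ = 0)
    (hvar : ∫ x, coordSum Finset.univ x ^ 2 ∂μ = 1) (hB : tailRate G q θ ≤ 1 / 1000000) {z : ℝ}
    (hz : 4 ≤ z) {s : Set ℝ} (hs : s = Iic z ∨ s = Iio z) :
    |μ.real {x | coordSum Finset.univ x ∈ s} - stdNormalCDF z|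
      ≤ 100000000 * z ^ (-(2 + q)) * tailRate G q θ := by
  have := isProbabilityMeasure_mapLaw (μ := μ) (measurable_truncate ((G.maxDegree : ℝ) ^ 5))
  have hT := h.boundedLaw_truncate hmean hvar hB
  have hB0 := h.tailRate_pos
  obtain ⟨t1, t2⟩ := hT.tail_bound hz
  have hsm : MeasurableSet s := by
    rcases hs with rfl | rfl
    · exact measurableSet_Iic
    · exact measurableSet_Iio
  have hsz : ∀ t, t ∉ s → z ≤ t := by
    rcases hs with rfl | rfl
    · exact fun t ht => (not_le.1 ht).le
    · exact fun t ht => not_lt.1 ht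
  have h1 := h.abs_measureReal_sub_truncate_le hmean hvar hB (by linarith) hsm hsz
  have h2 : |(_root_.mapLaw μ (truncate ((G.maxDegree : ℝ) ^ 5))).real
      {x | coordSum Finset.univ x ∈ s} - stdNormalCDF z|
      ≤ 250000 * Real.exp (-z / 4) * tailRate G q θ := by
    rcases hs with rfl | rfl
    · exact t1
    · exact t2
  have h3 := abs_sub_le (μ.real {x | coordSum Finset.univ x ∈ s})
    ((_root_.mapLaw μ (truncate ((G.maxDegree : ℝ) ^ 5))).real {x | coordSum Finset.univ x ∈ s})
    (stdNormalCDF z)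
  have h4 : Real.exp (-z / 4) ≤ 384 * z ^ (-(2 + q)) := by
    have h5 := exp_neg_le_rpow (p := 2 + q) (z := z / 4) (by linarith [h.q_le_one]) (by linarith)
    have h6 : (z / 4) ^ (-(2 + q)) ≤ 64 * z ^ (-(2 + q)) := by
      rw [Real.div_rpow (by linarith) (by norm_num), Real.rpow_neg (by norm_num : (0 : ℝ) ≤ 4),
        div_inv_eq_mul, mul_comm]
      refine mul_le_mul_of_nonneg_right ?_ (by positivity)
      have := Real.rpow_le_rpow_of_exponent_le (by norm_num : (1 : ℝ) ≤ 4)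
        (by push_cast; linarith [h.q_le_one] : 2 + q ≤ (3 : ℕ))
      rw [Real.rpow_natCast] at this
      linarith
    rw [neg_div]
    linarith
  have h5 := mul_le_mul_of_nonneg_right h4 hB0.le
  have h6 : 0 ≤ z ^ (-(2 + q)) * tailRate G q θ := by
    have : 0 ≤ z ^ (-(2 + q)) := Real.rpow_nonneg (by linarith) _
    positivity
  linarith

/-- When `tailRate` is not small, the tail bound follows from Markov's inequality. -/
lemma tail_bound_of_large (h : LocalLaw G μ q θ) (hmean : ∀ i, ∫ x, x i ∂μ = 0)
    (hvar : ∫ x, coordSum Finset.univ x ^ 2 ∂μ = 1) (hB : 1 / 1000000 ≤ tailRate G q θ) {z : ℝ}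
    (hz : 4 ≤ z) {s : Set ℝ} (hs : s = Iic z ∨ s = Iio z) :
    |μ.real {x | coordSum Finset.univ x ∈ s} - stdNormalCDF z|
      ≤ 100000000 * z ^ (-(2 + q)) * tailRate G q θ := by
  have hq := h.q_pos
  have hsm : MeasurableSet s := by
    rcases hs with rfl | rfl
    · exact measurableSet_Iic
    · exact measurableSet_Iio
  have hsz : ∀ t, t ∉ s → z ≤ t := by
    rcases hs with rfl | rfl
    · exact fun t ht => (not_le.1 ht).le
    · exact fun t ht => not_lt.1 ht
  obtain ⟨iW, bW⟩ := h.moment_coordSum_le hmean hvar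
  have h1 := measureReal_ge_le_rpow (by linarith) (by linarith : 0 < z) iW bW
  have h2 : 1 - μ.real {x | coordSum Finset.univ x ∈ s}
      ≤ μ.real {x | z ≤ coordSum Finset.univ x} := by
    refine (probReal_compl_eq_one_sub (μ := μ)
      (measurable_coordSum Finset.univ hsm)).symm.trans_le ?_
    exact measureReal_mono fun x hx => hsz _ hx
  have h3 : 1 - stdNormalCDF z ≤ 6 * z ^ (-(2 + q)) := by
    rw [← stdNormalCDF_neg]
    exact (stdNormalCDF_neg_le_exp (by linarith)).trans
      (exp_neg_le_rpow (by linarith [h.q_le_one]) (by linarith))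
  refine (abs_sub_le_of_compl (h2.trans h1) measureReal_le_one h3 (stdNormalCDF_le_one z)).trans ?_
  have h4 := h.pow_mul_card_mul_le_tailRate (k := 4) (by norm_num)
  have hz0 : 0 ≤ z ^ (-(2 + q)) := Real.rpow_nonneg (by linarith) _
  have h5 := mul_le_mul_of_nonneg_left h4 hz0
  have h6 := mul_le_mul_of_nonneg_left hB hz0
  linarith

lemma tail_bound (h : LocalLaw G μ q θ) (hmean : ∀ i, ∫ x, x i ∂μ = 0)
    (hvar : ∫ x, coordSum Finset.univ x ^ 2 ∂μ = 1) {z : ℝ}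
    (hz : 4 ≤ z) {s : Set ℝ} (hs : s = Iic z ∨ s = Iio z) :
    |μ.real {x | coordSum Finset.univ x ∈ s} - stdNormalCDF z|
      ≤ 200000000 * (1 + z) ^ (-(2 + q)) * tailRate G q θ := by
  have h1 : |μ.real {x | coordSum Finset.univ x ∈ s} - stdNormalCDF z|
      ≤ 100000000 * z ^ (-(2 + q)) * tailRate G q θ := by
    rcases le_total (tailRate G q θ) (1 / 1000000) with hB | hB
    · exact h.tail_bound_of_small hmean hvar hB hz hs
    · exact h.tail_bound_of_large hmean hvar hB hz hs
  have h2 : z ^ (-(2 + q)) ≤ 2 * (1 + z) ^ (-(2 + q)) := by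
    have hq := h.q_pos
    have h3 := Real.rpow_le_rpow (by linarith) (by linarith : 1 + z ≤ 5 / 4 * z)
      (by linarith : 0 ≤ 2 + q)
    have h4 := Real.rpow_le_rpow_of_exponent_le (by norm_num : (1 : ℝ) ≤ 5 / 4)
        (by push_cast; linarith [h.q_le_one] : 2 + q ≤ (3 : ℕ))
    rw [Real.rpow_natCast] at h4
    have hz0 : 0 < z ^ (2 + q) := Real.rpow_pos_of_pos (by linarith) _
    rw [Real.mul_rpow (by norm_num) (by linarith)] at h3
    have h5 := mul_le_mul_of_nonneg_right h4 hz0.le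
    rw [Real.rpow_neg (by linarith), Real.rpow_neg (by linarith), ← div_eq_mul_inv,
      le_div_iff₀ (Real.rpow_pos_of_pos (by linarith) _), inv_mul_le_iff₀ hz0]
    norm_num at h5
    linarith
  have h3 := mul_le_mul_of_nonneg_right h2 h.tailRate_pos.le
  linarith

lemma central_bound (h : LocalLaw G μ q θ) (hmean : ∀ i, ∫ x, x i ∂μ = 0)
    (hvar : ∫ x, coordSum Finset.univ x ^ 2 ∂μ = 1) {z : ℝ} (hz : |z| ≤ 4) :
    |μ.real {x | coordSum Finset.univ x ≤ z} - stdNormalCDF z|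
      ≤ 200000000 * (1 + |z|) ^ (-(2 + q)) * tailRate G q θ := by
  have hB0 := h.tailRate_pos
  have h1 : |μ.real {x | coordSum Finset.univ x ≤ z} - stdNormalCDF z|
      ≤ 1000000 * tailRate G q θ := by
    rcases le_total (tailRate G q θ) (1 / 1000000) with hB | hB
    · have h2 := h.pow_five_mul_theta_sq_le hB
      have h3 := h.pow_mul_card_mul_le_tailRate (k := 5) le_rfl
      have hD := h.one_le_maxDegree_real
      have hn := h.one_le_card
      have hθ := Real.rpow_pos_of_pos h.theta_pos (2 + q)
      refine (h.uniform_bound_of_small hmean hvar (by linarith) rfl (by positivity)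
        (by linarith) z).trans (by linarith)
    · have h2 : |μ.real {x | coordSum Finset.univ x ≤ z} - stdNormalCDF z| ≤ 1 := by
        have h3 : 0 ≤ μ.real {x | coordSum Finset.univ x ≤ z} := measureReal_nonneg
        have h4 : μ.real {x | coordSum Finset.univ x ≤ z} ≤ 1 := measureReal_le_one
        rw [abs_le]
        constructor <;> linarith [stdNormalCDF_nonneg z, stdNormalCDF_le_one z]
      linarith
  have h2 : 1 ≤ 125 * (1 + |z|) ^ (-(2 + q)) := by
    have hz0 := abs_nonneg z
    have h3 := Real.rpow_le_rpow (by linarith) (by linarith : 1 + |z| ≤ 5)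
      (by linarith [h.q_pos] : 0 ≤ 2 + q)
    have h4 := Real.rpow_le_rpow_of_exponent_le (by norm_num : (1 : ℝ) ≤ 5)
        (by push_cast; linarith [h.q_le_one] : 2 + q ≤ (3 : ℕ))
    rw [Real.rpow_natCast] at h4
    rw [Real.rpow_neg (by linarith), ← div_eq_mul_inv,
      one_le_div (Real.rpow_pos_of_pos (by linarith) _)]
    linarith
  have h3 := mul_le_mul_of_nonneg_right h2 hB0.le
  have h4 : 0 ≤ (1 + |z|) ^ (-(2 + q)) * tailRate G q θ := by positivity
  linarith

/-- The nonuniform normal approximation for centred summands with `E W ^ 2 = 1`. -/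
theorem nonuniform_bound (h : LocalLaw G μ q θ) (hmean : ∀ i, ∫ x, x i ∂μ = 0)
    (hvar : ∫ x, coordSum Finset.univ x ^ 2 ∂μ = 1) (z : ℝ) :
    |μ.real {x | coordSum Finset.univ x ≤ z} - stdNormalCDF z|
      ≤ 200000000 * (1 + |z|) ^ (-(2 + q)) * tailRate G q θ := by
  rcases le_or_gt |z| 4 with hz | hz
  · exact h.central_bound hmean hvar hz
  rcases lt_abs.1 hz with hz | hz
  · rw [abs_of_pos (by linarith : 0 < z)]
    exact h.tail_bound hmean hvar hz.le (Or.inl rfl)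
  -- below `-4`, reflect: `W ≤ z` fails exactly when `-W < -z`
  have hprob := isProbabilityMeasure_mapLaw (μ := μ) measurable_neg
  have hn : LocalLaw G (_root_.mapLaw μ fun t => -t) q θ :=
    h.mapLaw measurable_neg fun t => (abs_neg t).le
  have hsum : ∀ x : V → ℝ, coordSum Finset.univ (fun i => -x i) = -coordSum Finset.univ x :=
    fun x => Finset.sum_neg_distrib _
  have h1 := hn.tail_bound (fun i => by
      rw [integral_mapLaw measurable_neg (measurable_pi_apply i), integral_neg, hmean, neg_zero])
    (by
      rw [integral_mapLaw measurable_neg ((measurable_coordSum _).pow_const 2), ← hvar]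
      simp_rw [hsum, neg_sq]) hz.le (s := Iio (-z)) (Or.inr rfl)
  have hWm := measurable_coordSum (V := V) Finset.univ
  have e1 : (_root_.mapLaw μ fun t => -t).real {x | coordSum Finset.univ x ∈ Iio (-z)}
      = 1 - μ.real {x | coordSum Finset.univ x ≤ z} := by
    have hmap := map_measureReal_apply (μ := μ) (measurable_coordMap measurable_neg)
      (hWm measurableSet_Iio : MeasurableSet (coordSum Finset.univ ⁻¹' Iio (-z)))
    have hc := probReal_compl_eq_one_sub (μ := μ)
      (hWm measurableSet_Iic : MeasurableSet (coordSum Finset.univ ⁻¹' Iic z))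
    refine (hmap.trans ?_).trans hc
    congr 1
    ext x
    simp [hsum]
  rw [e1, stdNormalCDF_neg, sub_sub_sub_cancel_left, abs_sub_comm] at h1
  rwa [abs_of_neg (by linarith : z < 0)]

/-- The uniform normal approximation for centred summands with `E W ^ 2 = 1`. -/
theorem uniform_bound (h : LocalLaw G μ q θ) (hmean : ∀ i, ∫ x, x i ∂μ = 0)
    (hvar : ∫ x, coordSum Finset.univ x ^ 2 ∂μ = 1) (z : ℝ) :
    |μ.real {x | coordSum Finset.univ x ≤ z} - stdNormalCDF z|
      ≤ 75 * ((G.maxDegree : ℝ) ^ 5) ^ (1 + q) * Fintype.card V * θ ^ (2 + q) := by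
  set L := (G.maxDegree : ℝ) ^ 5 with hLdef
  have hq := h.q_pos
  have hD := h.one_le_maxDegree_real
  have hL : 1 ≤ L := one_le_pow₀ hD
  have hn2 : (2 : ℝ) ≤ Fintype.card V := by
    exact_mod_cast two_le_card_of_maxDegree h.one_le_maxDegree
  have hθ := Real.rpow_pos_of_pos h.theta_pos (2 + q)
  have hL1 : L ≤ L ^ (1 + q) := Real.self_le_rpow_of_one_le hL (by linarith)
  have hmain : L * (Fintype.card V * θ ^ (2 + q))
      ≤ L ^ (1 + q) * (Fintype.card V * θ ^ (2 + q)) := by gcongr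
  rcases le_or_gt 1 (75 * L ^ (1 + q) * Fintype.card V * θ ^ (2 + q)) with hbig | hsmall
  · refine le_trans ?_ hbig
    have h3 : 0 ≤ μ.real {x | coordSum Finset.univ x ≤ z} := measureReal_nonneg
    have h4 : μ.real {x | coordSum Finset.univ x ≤ z} ≤ 1 := measureReal_le_one
    rw [abs_le]
    constructor <;> linarith [stdNormalCDF_nonneg z, stdNormalCDF_le_one z]
  -- `(L θ²) ^ (1 + q / 2) ≤ L ^ (1 + q) θ ^ (2 + q) ≤ 1 / 150`, and `150 ^ (2 / 3) > 28`
  have hε : L * θ ^ 2 ≤ 1 / 28 := by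
    by_contra hlt
    push Not at hlt
    have h1 := Real.rpow_le_rpow (by norm_num) hlt.le (by linarith : 0 ≤ 2 + q)
    have h2 := Real.rpow_le_rpow_of_exponent_ge (by norm_num : (0 : ℝ) < 1 / 28) (by norm_num)
      (by push_cast; linarith [h.q_le_one] : 2 + q ≤ (3 : ℕ))
    rw [Real.rpow_natCast] at h2
    have h3 : (L * θ ^ 2) ^ (2 + q) ≤ (L ^ (1 + q) * θ ^ (2 + q)) ^ 2 := by
      rw [Real.mul_rpow (by linarith) (by positivity), mul_pow, ← Real.rpow_natCast θ 2,
        ← Real.rpow_natCast (L ^ (1 + q)), ← Real.rpow_natCast (θ ^ (2 + q)),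
        ← Real.rpow_mul h.theta_pos.le, ← Real.rpow_mul h.theta_pos.le, mul_comm (2 + q),
        ← Real.rpow_mul (by linarith)]
      refine mul_le_mul_of_nonneg_right
        (Real.rpow_le_rpow_of_exponent_le hL (by push_cast; linarith)) ?_
      exact Real.rpow_nonneg h.theta_pos.le _
    have h5 : 0 ≤ L ^ (1 + q) * θ ^ (2 + q) := by positivity
    have h4 : L ^ (1 + q) * θ ^ (2 + q) ≤ 1 / 150 := by
      have := mul_le_mul_of_nonneg_right hn2 h5
      linarith
    have h6 := pow_le_pow_left₀ h5 h4 2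
    norm_num at h2 h6
    linarith
  have h1 : 4 * L * (Fintype.card V * θ ^ (2 + q)) ≤ 4 / 75 := by linarith
  refine (h.uniform_bound_of_small hmean hvar (by linarith) rfl (by positivity) h1 z).trans ?_
  have h2 : 0 ≤ L * (Fintype.card V * θ ^ (2 + q)) := by positivity
  rw [← hLdef]
  linarith

end LocalLaw

theorem theorem2p7 :
    ∃ C : ℝ, 0 < C ∧
      ∀ {V Ω : Type*} [Fintype V] [MeasurableSpace Ω] (P : Measure Ω) [IsProbabilityMeasure P]
        (G : SimpleGraph V) [DecidableRel G.Adj] (X : V → Ω → ℝ) (p θ : ℝ),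
        2 < p → p ≤ 3 → 0 < θ →
        (∀ i, Measurable (X i)) →
        IsDependencyGraph G X P →
        1 ≤ G.maxDegree →
        (∀ i, Integrable (fun ω => |X i ω| ^ p) P) →
        (∀ i, ∫ ω, |X i ω| ^ p ∂P ≤ θ ^ p) →
        (∀ i, ∫ ω, X i ω ∂P = 0) →
        ∫ ω, (∑ i, X i ω) ^ 2 ∂P = 1 →
        (⨆ z : ℝ, |P.real {ω | ∑ i, X i ω ≤ z} - stdNormalCDF z|)
            ≤ 75 * (G.maxDegree : ℝ) ^ (5 * (p - 1)) * (Fintype.card V : ℝ) * θ ^ p ∧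
        ∀ z : ℝ, |P.real {ω | ∑ i, X i ω ≤ z} - stdNormalCDF z|
            ≤ C * (1 + |z|) ^ (-p) * (G.maxDegree : ℝ) ^ (5 * p) * (Fintype.card V : ℝ) * θ ^ p := by
  refine ⟨200000000, by norm_num, ?_⟩
  intro V Ω _ _ P _ G _ X p θ hp2 hp3 hθ hX hdep hdeg hint hmom hmean hvar
  classical
  have hT : Measurable fun ω i => X i ω := measurable_pi_lambda _ hX
  set μ := P.map fun ω i => X i ω with hμ
  have hprob : IsProbabilityMeasure μ := Measure.isProbabilityMeasure_map hT.aemeasurable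
  obtain ⟨q, rfl⟩ : ∃ q, p = 2 + q := ⟨p - 2, by ring⟩
  have hpow : ∀ i, Measurable fun x : V → ℝ => |x i| ^ (2 + q) := fun i => by fun_prop
  have h : LocalLaw G μ q θ :=
    { dep := hdep.map hX
      one_le_maxDegree := hdeg
      q_pos := by linarith
      q_le_one := by linarith
      theta_pos := hθ
      integrable_moment := fun i =>
        (integrable_map_measure (hpow i).aestronglyMeasurable hT.aemeasurable).2 (hint i)
      moment_le := fun i =>
        (integral_map hT.aemeasurable (hpow i).aestronglyMeasurable).trans_le (hmom i) }
  have hmean' : ∀ i, ∫ x, x i ∂μ = 0 := fun i =>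
    (integral_map hT.aemeasurable (measurable_pi_apply i).aestronglyMeasurable).trans (hmean i)
  have hvar' : ∫ x, coordSum Finset.univ x ^ 2 ∂μ = 1 :=
    (integral_map hT.aemeasurable
      ((measurable_coordSum _).pow_const 2).aestronglyMeasurable).trans hvar
  have hreal : ∀ z, μ.real {x | coordSum Finset.univ x ≤ z} = P.real {ω | ∑ i, X i ω ≤ z} :=
    fun z => map_measureReal_apply hT (measurable_coordSum Finset.univ measurableSet_Iic)
  have hD0 : (0 : ℝ) ≤ G.maxDegree := Nat.cast_nonneg _
  have hDpow : ∀ a : ℝ, (G.maxDegree : ℝ) ^ (5 * a) = ((G.maxDegree : ℝ) ^ 5) ^ a := fun a => by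
    rw [Real.rpow_mul hD0]
    norm_cast
  constructor
  · refine ciSup_le fun z => ?_
    have h1 := h.uniform_bound hmean' hvar' z
    rw [hreal] at h1
    have e : 2 + q - 1 = 1 + q := by ring
    rwa [hDpow, e]
  · intro z
    have h1 := h.nonuniform_bound hmean' hvar' z
    rw [hreal, h.tailRate_eq] at h1
    rw [hDpow]
    linarith
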